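/- **Theorem (product rule for the $S$-functional calculus).** Consider one of the following two settings. *Quaternionic setting.* $\mathbb F_0=\mathbb F=\mathbb H$; $V$ is a two-sided quaternionic Banach space ($\|av\|=|a|\|v\|=\|va\|$); $T:\operatorname{dom}(T)\subseteq V\to V$ is a closed right linear operator, defined on a right subspace. *Clifford setting.* $n\ge 1$, $\mathbb F=\mathbb R_n$ is the real Clifford algebra with $n$ anticommuting units $e_i^2=-1$, $\mathbb F_0=\mathbb R^{n+1}$ is the space of paravectors $\xi_0+\sum_i\xi_ie_i$; $V=V_{\mathbb R}\otimes\mathbb R_n$ for a real Banach space $V_{\mathbb R}$, with $\|\sum_A v_A\otimes e_A\|=\sum_A\|v_A\|$; $T=T_0+\sum_{i=1}^nT_ie_i$ with closed operators $T_0,\dots,T_n$ on $V_{\mathbb R}$, $Tv=\sum_{i}\sum_A T_i(v_A)\otimes e_ie_A$ (with $e_0=1$), whose domain consists of all $v$ with $v_A\in\bigcap_i\operatorname{dom}(T_i)$ for all $A$. Let $\mathbb S$ be the sphere of imaginary units $I\in\mathbb F_0$ ($\operatorname{Re}I=0$, $|I|=1$) and $\mathbb C_I=\mathbb R+I\mathbb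 R$. A set $U\subseteq\mathbb F_0$ is axially symmetric if $x_0+Ix_1\in U$ implies $x_0+Jx_1\in U$ for all $J\in\mathbb S$. On an open axially symmetric set $D$, a real differentiable $f:D\to\mathbb F$ is *left slice hyperholomorphic* if $f(x_0+Ix_1)=\alpha(x_0,x_1)+I\beta(x_0,x_1)$, and *right slice hyperholomorphic* if $f(x_0+Ix_1)=\alpha(x_0,x_1)+\beta(x_0,x_1)I$, where $\alpha$ is even and $\beta$ is odd in $x_1$, and $\partial_{x_0}\alpha=\partial_{x_1}\beta$, $\partial_{x_0}\beta=-\partial_{x_1}\alpha$. It is *intrinsic* if it is left slice hyperholomorphic with real-valued $\alpha,\beta$. For $s\in\mathbb F_0$ let $\mathcal Q_s(T)=T^2-2\operatorname{Re}(s)T+|s|^2\mathcal I$ on $\operatorname{dom}(T^2)$. Let $\rho_S(T)$ be the set of all $s\in\mathbb F_0$ for which $\mathcal Q_s(T)$ has a bounded inverse $V\to\operatorname{dom}(T^2)$, and $\sigma_S(T)=\mathbb F_0\setminus\rho_S(T)$. For $s\in\rho_S(T)$ put $$S_L^{-1}(s,T)=\mathcal Q_s(T)^{-1}\overline s-T\mathcal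 Q_s(T)^{-1},\qquad S_R^{-1}(s,T)=-(T-\mathcal I\overline s)\mathcal Q_s(T)^{-1}.$$ Let $\mathcal{SH}_L(\sigma_S(T)\cup\{\infty\})$, $\mathcal{SH}_R(\sigma_S(T)\cup\{\infty\})$ and $\mathcal N(\sigma_S(T)\cup\{\infty\})$ be the sets of left slice hyperholomorphic, right slice hyperholomorphic and intrinsic functions $f$ whose open axially symmetric domain $\mathcal D(f)$ contains $\sigma_S(T)$ and $\{s:|s|>r\}$ for some $r>0$, and for which $f(\infty)=\lim_{s\to\infty}f(s)$ exists in $\mathbb F$. For these one sets $$f(T)=f(\infty)\mathcal I+\frac1{2\pi}\int_{\partial(U\cap\mathbb C_I)}S_L^{-1}(s,T)\,ds_I\,f(s)\qquad(f\in\mathcal{SH}_L(\sigma_S(T)\cup\{\infty\})),$$ $$f(T)=f(\infty)\mathcal I+\frac1{2\pi}\int_{\partial(U\cap\mathbb C_I)}f(s)\,ds_I\,S_R^{-1}(s,T)\qquad(f\in\mathcal{SH}_R(\sigma_S(T)\cup\{\infty\})),$$ where $ds_I=(-I)\,ds$, $I\in\mathbb S$, the boundary is positively oriented, and $U$ is any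 unbounded slice Cauchy domain with $\sigma_S(T)\subset U$ and $\overline U\subset\mathcal D(f)$. (A slice Cauchy domain is an axially symmetric set $U$ such that for every $I\in\mathbb S$ the set $U\cap\mathbb C_I$ is open, has finitely many components, whose closures are pairwise disjoint, and its boundary consists of a finite positive number of pairwise disjoint closed piecewise continuously differentiable Jordan curves.) Assume $\rho_S(T)\neq\emptyset$. 1. If $f\in\mathcal N(\sigma_S(T)\cup\{\infty\})$ and $g\in\mathcal{SH}_L(\sigma_S(T)\cup\{\infty\})$, then $fg$, with domain $\mathcal D(f)\cap\mathcal D(g)$, belongs to $\mathcal{SH}_L(\sigma_S(T)\cup\{\infty\})$ and $(fg)(T)=f(T)g(T)$. 2. If $f\in\mathcal{SH}_R(\sigma_S(T)\cup\{\infty\})$ and $g\in\mathcal N(\sigma_S(T)\cup\{\infty\})$, then $fg$, with domain $\mathcal D(f)\cap\mathcal D(g)$, belongs to $\mathcal{SH}_R(\sigma_S(T)\cup\{\infty\})$ and $(fg)(T)=f(T)g(T)$. Here $(fg)(T)$ is taken in the calculus for left slice hyperholomorphic functions in part 1 and for right slice hyperholomorphic functions in part 2, and all the operators involved are well defined: domains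 $U$ as above exist, the bounded operator obtained does not depend on $U$ and $I$, and for the intrinsic factor the two formulas give the same operator. -/

import Mathlib

noncomputable section

namespace SliceCalc

open scoped symmDiff

/-- The quadratic form `v ↦ -(v₁² + ⋯ + vₙ²)` on `ℝⁿ`. -/
def negSq (n : ℕ) : QuadraticForm ℝ (Fin n → ℝ) :=
  QuadraticMap.weightedSumSquares ℝ (fun _ : Fin n => (-1 : ℝ))

/-- The real Clifford algebra `ℝₙ` over `n` units with `eᵢ² = -1`, `eᵢ eⱼ = -eⱼ eᵢ`. -/
abbrev Cliff (n : ℕ) : Type := CliffordAlgebra (negSq n)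

/-- The unit `eᵢ`. -/
def Cliff.e {n : ℕ} (i : Fin n) : Cliff n := CliffordAlgebra.ι (negSq n) (Pi.single i 1)

/-- `e_A = e_{i₁} ⋯ e_{iₖ}` for `A = {i₁ < ⋯ < iₖ}`. -/
def Cliff.eProd {n : ℕ} (A : Finset (Fin n)) : Cliff n := ((A.sort).map Cliff.e).prod

lemma negSq_apply {n : ℕ} (v : Fin n → ℝ) : negSq n v = -∑ i, v i ^ 2 := by
  simp [negSq, QuadraticMap.weightedSumSquares_apply, pow_two]

lemma Cliff.e_mul_self {n : ℕ} (i : Fin n) : Cliff.e i * Cliff.e i = -1 := by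
  have : negSq n (Pi.single i 1) = -1 := by
    simp [negSq_apply, Pi.single_apply, ite_pow]
  rw [Cliff.e, CliffordAlgebra.ι_sq_scalar, this]; simp

lemma Cliff.e_anticomm {n : ℕ} {i j : Fin n} (h : i ≠ j) :
    Cliff.e i * Cliff.e j = -(Cliff.e j * Cliff.e i) := by
  apply CliffordAlgebra.ι_mul_ι_comm_of_isOrtho
  rw [QuadraticMap.isOrtho_def]
  simp only [negSq_apply, Pi.add_apply]
  rw [← neg_add, ← Finset.sum_add_distrib]
  congr 1
  refine Finset.sum_congr rfl fun k _ => ?_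
  by_cases hi : k = i
  · subst hi; simp [h]
  · simp [Pi.single_apply, hi]

/-- The sign in `eᵢ e_A = ± e_{A ∆ {i}}`. -/
def genSign {n : ℕ} (i : Fin n) (A : Finset (Fin n)) : ℝ := (-1) ^ (A.filter (· ≤ i)).card

lemma genSign_sq {n : ℕ} (i : Fin n) (A : Finset (Fin n)) : genSign i A * genSign i A = 1 := by
  rw [genSign, ← mul_pow]; simp

lemma genSign_flip {n : ℕ} {i j : Fin n} (A : Finset (Fin n)) (h : j ≤ i) :
    genSign i (A ∆ {j}) = - genSign i A := by
  by_cases hj : j ∈ A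
  · have h1 : A ∆ {j} = A.erase j := by
      ext x; simp only [Finset.mem_symmDiff, Finset.mem_singleton, Finset.mem_erase]
      grind
    have h2 : (A.filter (· ≤ i)) = insert j ((A.erase j).filter (· ≤ i)) := by
      ext x; simp only [Finset.mem_filter, Finset.mem_insert, Finset.mem_erase]; grind
    rw [genSign, genSign, h1, h2, Finset.card_insert_of_notMem (by simp), pow_succ]; simp
  · have h1 : A ∆ {j} = insert j A := by
      ext x; simp only [Finset.mem_symmDiff, Finset.mem_singleton, Finset.mem_insert]
      grind
    have h2 : ((insert j A).filter (· ≤ i)) = insert j (A.filter (· ≤ i)) := by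
      ext x; simp only [Finset.mem_filter, Finset.mem_insert]; grind
    rw [genSign, genSign, h1, h2, Finset.card_insert_of_notMem (by simp [hj]), pow_succ]; simp

lemma genSign_keep {n : ℕ} {i j : Fin n} (A : Finset (Fin n)) (h : i < j) :
    genSign i (A ∆ {j}) = genSign i A := by
  rw [genSign, genSign]
  congr 2
  ext x; simp only [Finset.mem_filter, Finset.mem_symmDiff, Finset.mem_singleton]; grind

def genOp {n : ℕ} (i : Fin n) : Module.End ℝ (Finset (Fin n) → ℝ) where
  toFun φ C := genSign i (C ∆ {i}) * φ (C ∆ {i})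
  map_add' φ ψ := by ext C; simp [mul_add]
  map_smul' r φ := by ext C; simp [mul_left_comm]

lemma genOp_sq {n : ℕ} (i : Fin n) : genOp i * genOp i = -1 := by
  refine LinearMap.ext fun φ => funext fun C => ?_
  simp only [genOp, Module.End.mul_apply, LinearMap.coe_mk, AddHom.coe_mk, symmDiff_symmDiff_cancel_right,
    LinearMap.neg_apply, Module.End.one_apply, Pi.neg_apply]
  rw [genSign_flip _ le_rfl, ← mul_assoc, neg_mul, genSign_sq]; simp

lemma genOp_anti {n : ℕ} {i j : Fin n} (h : i ≠ j) : genOp i * genOp j = -(genOp j * genOp i) := by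
  wlog hij : i < j generalizing i j
  · rw [this h.symm (lt_of_le_of_ne (not_lt.1 hij) h.symm), neg_neg]
  refine LinearMap.ext fun φ => funext fun C => ?_
  simp only [genOp, Module.End.mul_apply, LinearMap.coe_mk, AddHom.coe_mk,
    LinearMap.neg_apply, Pi.neg_apply]
  have h1 : genSign i (C ∆ {i} ∆ {j}) = genSign i (C ∆ {i}) := genSign_keep _ hij
  have h2 : genSign j (C ∆ {i} ∆ {j}) = - genSign j (C ∆ {j}) := by
    rw [symmDiff_right_comm, genSign_flip _ hij.le]
  rw [symmDiff_right_comm C {j} {i}, h1, h2]; ring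

def genMap (n : ℕ) : (Fin n → ℝ) →ₗ[ℝ] Module.End ℝ (Finset (Fin n) → ℝ) :=
  Fintype.linearCombination ℝ (genOp (n := n))

lemma genMap_sq {n : ℕ} (v : Fin n → ℝ) :
    genMap n v * genMap n v = algebraMap ℝ _ (negSq n v) := by
  have e1 : genMap n v * genMap n v = ∑ i, ∑ j, (v i * v j) • (genOp i * genOp j) := by
    simp only [genMap, Fintype.linearCombination_apply, Finset.sum_mul_sum, smul_mul_smul_comm]
  have e2 : genMap n v * genMap n v = ∑ i, ∑ j, (v i * v j) • (genOp j * genOp i) := by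
    rw [e1, Finset.sum_comm]
    simp only [mul_comm (v _) (v _)]
  have e3 : ∀ i j : Fin n, genOp i * genOp j + genOp j * genOp i = if i = j then (-2 : ℝ) • 1 else 0 := by
    intro i j
    by_cases h : i = j
    · subst h; rw [if_pos rfl, genOp_sq, show (-2 : ℝ) = -1 + -1 by norm_num, add_smul]; simp
    · rw [if_neg h, genOp_anti h]; abel
  have e4 : (2 : ℝ) • (genMap n v * genMap n v) = (2 : ℝ) • algebraMap ℝ _ (negSq n v) := by
    rw [two_smul]
    nth_rewrite 1 [e1]
    rw [e2]
    simp only [← Finset.sum_add_distrib, ← smul_add, e3]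
    simp only [smul_ite, smul_zero, Finset.sum_ite_eq, Finset.mem_univ, if_true]
    rw [negSq_apply, Algebra.algebraMap_eq_smul_one, smul_smul]
    simp only [smul_smul, ← Finset.sum_smul]
    congr 1
    rw [mul_neg, Finset.mul_sum, ← Finset.sum_neg_distrib]
    exact Finset.sum_congr rfl fun i _ => by ring
  exact smul_right_injective _ (two_ne_zero (α := ℝ)) e4

def regRep (n : ℕ) : Cliff n →ₐ[ℝ] Module.End ℝ (Finset (Fin n) → ℝ) :=
  CliffordAlgebra.lift (negSq n) ⟨genMap n, genMap_sq⟩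

lemma regRep_e {n : ℕ} (i : Fin n) : regRep n (Cliff.e i) = genOp i := by
  simp [regRep, Cliff.e, genMap, Fintype.linearCombination_apply_single]

lemma Cliff.eProd_insert {n : ℕ} {i : Fin n} {A : Finset (Fin n)} (h : ∀ x ∈ A, i < x) :
    Cliff.eProd (insert i A) = Cliff.e i * Cliff.eProd A := by
  rw [Cliff.eProd, Finset.sort_insert _ (fun b hb => (h b hb).le) (fun hi => (h i hi).false)]
  simp [Cliff.eProd]

lemma regRep_eProd {n : ℕ} (A : Finset (Fin n)) :
    regRep n (Cliff.eProd A) (Pi.single ∅ 1) = Pi.single A 1 := by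
  induction A using Finset.induction_on_min with
  | empty => simp [Cliff.eProd]
  | insert i A h ih =>
    rw [Cliff.eProd_insert h, map_mul, Module.End.mul_apply, ih, regRep_e]
    funext C
    have hi : i ∉ A := fun hi => (h i hi).false
    have hs : genSign i A = 1 := by
      rw [genSign, Finset.filter_false_of_mem (fun x hx => not_le.2 (h x hx))]; simp
    have hA : A ∆ {i} = insert i A := by
      ext x; simp only [Finset.mem_symmDiff, Finset.mem_singleton, Finset.mem_insert]; grind
    simp only [genOp, LinearMap.coe_mk, AddHom.coe_mk, Pi.single_apply]
    by_cases hC : C = insert i A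
    · have : C ∆ {i} = A := by rw [hC, ← hA, symmDiff_symmDiff_cancel_right]
      rw [if_pos this, if_pos hC, this, hs]; simp
    · have : C ∆ {i} ≠ A := fun h' => hC (by rw [← hA, ← h', symmDiff_symmDiff_cancel_right])
      rw [if_neg this, if_neg hC]; simp

lemma Cliff.e_mul_eProd {n : ℕ} (i : Fin n) (A : Finset (Fin n)) :
    ∃ c : ℝ, Cliff.e i * Cliff.eProd A = c • Cliff.eProd (A ∆ {i}) := by
  induction A using Finset.induction_on_min with
  | empty =>
    refine ⟨1, ?_⟩
    have := Cliff.eProd_insert (i := i) (A := ∅) (by simp)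
    rw [one_smul, ← this]; congr 1
  | insert m A h ih =>
    have hm : m ∉ A := fun hi => (h m hi).false
    rcases lt_trichotomy i m with him | him | him
    · refine ⟨1, ?_⟩
      have : insert m A ∆ {i} = insert i (insert m A) := by
        ext x; simp only [Finset.mem_symmDiff, Finset.mem_singleton, Finset.mem_insert]; grind
      rw [this, one_smul, ← Cliff.eProd_insert]
      intro x hx
      rcases Finset.mem_insert.1 hx with rfl | hx
      · exact him
      · exact him.trans (h x hx)
    · subst him
      refine ⟨-1, ?_⟩
      have : insert i A ∆ {i} = A := by
        ext x; simp only [Finset.mem_symmDiff, Finset.mem_singleton, Finset.mem_insert]; grind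
      rw [this, Cliff.eProd_insert h, ← mul_assoc, Cliff.e_mul_self]; simp
    · obtain ⟨c, hc⟩ := ih
      refine ⟨-c, ?_⟩
      have : insert m A ∆ {i} = insert m (A ∆ {i}) := by
        ext x; simp only [Finset.mem_symmDiff, Finset.mem_singleton, Finset.mem_insert]; grind
      rw [this, Cliff.eProd_insert h, ← mul_assoc, Cliff.e_anticomm him.ne', neg_mul, mul_assoc, hc,
        Cliff.eProd_insert, mul_smul_comm, neg_smul]
      intro x hx
      simp only [Finset.mem_symmDiff, Finset.mem_singleton] at hx
      rcases hx with ⟨hx, -⟩ | ⟨rfl, -⟩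
      · exact h x hx
      · exact him

lemma Cliff.linearIndependent_eProd (n : ℕ) :
    LinearIndependent ℝ (Cliff.eProd (n := n)) := by
  let ev : Cliff n →ₗ[ℝ] (Finset (Fin n) → ℝ) :=
    (LinearMap.applyₗ (Pi.single ∅ 1)).comp (regRep n).toLinearMap
  apply LinearIndependent.of_comp ev
  have : ev ∘ Cliff.eProd = Pi.basisFun ℝ (Finset (Fin n)) := by
    funext A
    simpa [ev] using regRep_eProd A
  rw [this]
  exact (Pi.basisFun ℝ _).linearIndependent

lemma Cliff.span_eProd (n : ℕ) : ⊤ ≤ Submodule.span ℝ (Set.range (Cliff.eProd (n := n))) := by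
  have key : ∀ v : Fin n → ℝ, ∀ x ∈ Submodule.span ℝ (Set.range (Cliff.eProd (n := n))),
      CliffordAlgebra.ι (negSq n) v * x ∈ Submodule.span ℝ (Set.range (Cliff.eProd (n := n))) := by
    intro v x hx
    have hv : CliffordAlgebra.ι (negSq n) v = ∑ i, v i • Cliff.e i := by
      conv_lhs => rw [← (Pi.basisFun ℝ (Fin n)).sum_repr v]
      simp [Cliff.e]
    rw [hv, Finset.sum_mul]
    refine Submodule.sum_mem _ fun i _ => ?_
    rw [smul_mul_assoc]
    refine Submodule.smul_mem _ _ ?_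
    induction hx using Submodule.span_induction with
    | mem y hy =>
      obtain ⟨A, rfl⟩ := hy
      obtain ⟨c, hc⟩ := Cliff.e_mul_eProd i A
      rw [hc]
      exact Submodule.smul_mem _ _ (Submodule.subset_span ⟨_, rfl⟩)
    | zero => simp
    | add y z _ _ hy hz => rw [mul_add]; exact Submodule.add_mem _ hy hz
    | smul r y _ hy => rw [mul_smul_comm]; exact Submodule.smul_mem _ _ hy
  rintro x -
  have h1 : (1 : Cliff n) ∈ Submodule.span ℝ (Set.range (Cliff.eProd (n := n))) :=
    Submodule.subset_span ⟨∅, by simp [Cliff.eProd]⟩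
  induction x using CliffordAlgebra.left_induction with
  | algebraMap r =>
    rw [Algebra.algebraMap_eq_smul_one]
    exact Submodule.smul_mem _ _ h1
  | add x y hx hy => exact Submodule.add_mem _ hx hy
  | ι_mul x v hx => exact key v x hx

/-- The basis `(e_A)_{A ⊆ {1,…,n}}` of `ℝₙ`. -/
def Cliff.basis (n : ℕ) : Module.Basis (Finset (Fin n)) ℝ (Cliff n) :=
  Module.Basis.mk (Cliff.linearIndependent_eProd n) (Cliff.span_eProd n)

/-! ### The two settings -/

/-- The data of a setting: the space `P` of the variable (quaternions or paravectors, with its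
Euclidean norm) embedded in the algebra `F` of the values. -/
structure SliceSetting (P F : Type*) [NormedAddCommGroup P] [NormedSpace ℝ P] [Ring F]
    [Algebra ℝ F] where
  /-- the unit `1` -/
  one : P
  /-- the real part -/
  re : P →ₗ[ℝ] ℝ
  /-- the inclusion of `P` into the algebra -/
  emb : P →ₗ[ℝ] F
  re_one : re one = 1
  emb_one : emb one = 1
  emb_sq : ∀ x, emb x * emb x = (2 * re x) • emb x - (‖x‖ ^ 2) • (1 : F)

open scoped Quaternion in
/-- The quaternionic setting: variable and values in `ℍ`. -/
def quatSetting : SliceSetting ℍ[ℝ] ℍ[ℝ] where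
  one := 1
  re := { toFun := fun x => x.re, map_add' := fun _ _ => rfl, map_smul' := fun _ _ => rfl }
  emb := LinearMap.id
  re_one := rfl
  emb_one := rfl
  emb_sq x := by
    have h : ‖x‖ ^ 2 = x.re ^ 2 + x.imI ^ 2 + x.imJ ^ 2 + x.imK ^ 2 := by
      rw [pow_two, ← Quaternion.normSq_eq_norm_mul_self, Quaternion.normSq_def']
    change x * x = (2 * x.re) • x - _
    rw [h]
    ext <;> simp <;> ring

/-- The modulus `|x|² = ∑ ξ_A²` on `ℝₙ`, for `x = ∑ ξ_A e_A`. -/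
instance (n : ℕ) : NormedAddCommGroup (Cliff n) :=
  NormedAddCommGroup.induced (Cliff n) (EuclideanSpace ℝ (Finset (Fin n)))
    ((WithLp.linearEquiv 2 ℝ (Finset (Fin n) → ℝ)).symm.toLinearMap ∘ₗ
      (Cliff.basis n).equivFun.toLinearMap)
    ((WithLp.linearEquiv 2 ℝ (Finset (Fin n) → ℝ)).symm.injective.comp
      (Cliff.basis n).equivFun.injective)

instance (n : ℕ) : NormedSpace ℝ (Cliff n) :=
  NormedSpace.induced ℝ (Cliff n) (EuclideanSpace ℝ (Finset (Fin n)))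
    ((WithLp.linearEquiv 2 ℝ (Finset (Fin n) → ℝ)).symm.toLinearMap ∘ₗ
      (Cliff.basis n).equivFun.toLinearMap)

/-- The paravectors `ξ₀ + ξ₁ e₁ + ⋯ + ξₙ eₙ`, as the space `ℝⁿ⁺¹` of their coordinates. -/
abbrev Paravector (n : ℕ) : Type := EuclideanSpace ℝ (Fin (n + 1))

/-- The units `e₀ = 1, e₁, …, eₙ`. -/
def Cliff.unit {n : ℕ} : Fin (n + 1) → Cliff n := Fin.cons 1 Cliff.e

/-- The paravector `∑ᵢ ξᵢ eᵢ` as an element of `ℝₙ`. -/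
def Paravector.emb (n : ℕ) : Paravector n →ₗ[ℝ] Cliff n where
  toFun x := ∑ i, x i • Cliff.unit i
  map_add' x y := by simp [add_smul, Finset.sum_add_distrib]
  map_smul' r x := by simp [mul_smul, Finset.smul_sum]

lemma Paravector.emb_eq {n : ℕ} (x : Paravector n) :
    Paravector.emb n x = x 0 • (1 : Cliff n) +
      CliffordAlgebra.ι (negSq n) (fun i => x i.succ) := by
  have hv : CliffordAlgebra.ι (negSq n) (fun i => x i.succ) = ∑ i, x i.succ • Cliff.e i := by
    conv_lhs => rw [← (Pi.basisFun ℝ (Fin n)).sum_repr (fun i => x i.succ)]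
    simp [Cliff.e]
  simp [Paravector.emb, Fin.sum_univ_succ, Cliff.unit, hv]

/-- The Clifford setting: paravector variable, values in `ℝₙ`. -/
def cliffSetting (n : ℕ) : SliceSetting (Paravector n) (Cliff n) where
  one := EuclideanSpace.single 0 1
  re := { toFun := fun x => x 0, map_add' := fun _ _ => rfl, map_smul' := fun _ _ => rfl }
  emb := Paravector.emb n
  re_one := by
    change (EuclideanSpace.single (0 : Fin (n + 1)) (1 : ℝ)) 0 = 1
    simp
  emb_one := by
    simp [Paravector.emb, Fin.sum_univ_succ, Cliff.unit]
  emb_sq x := by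
    have h : ‖x‖ ^ 2 = x 0 ^ 2 + ∑ i : Fin n, x i.succ ^ 2 := by
      rw [EuclideanSpace.norm_sq_eq, Fin.sum_univ_succ]; simp
    have h2 := CliffordAlgebra.ι_sq_scalar (negSq n) (fun i => x i.succ)
    rw [negSq_apply, Algebra.algebraMap_eq_smul_one] at h2
    change _ = (2 * x 0) • _ - _
    rw [Paravector.emb_eq, h]
    simp only [mul_add, add_mul, h2, smul_mul_assoc, mul_smul_comm, one_mul, mul_one]
    module

namespace SliceSetting

variable {P F : Type*} [NormedAddCommGroup P] [NormedSpace ℝ P] [Ring F] [Algebra ℝ F]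
  (S : SliceSetting P F)

/-- The sphere of imaginary units. -/
def units : Set P := {I | S.re I = 0 ∧ ‖I‖ = 1}

/-- The point `x₀ + I x₁` of the plane `ℂ_I` that corresponds to `z = x₀ + i x₁`. -/
def pt (I : P) (z : ℂ) : P := z.re • S.one + z.im • I

/-- Conjugation `x₀ + I x₁ ↦ x₀ - I x₁`. -/
def conj (x : P) : P := (2 * S.re x) • S.one - x

/-- `U ∩ ℂ_I`, as a subset of `ℂ`. -/
def slice (I : P) (U : Set P) : Set ℂ := {z | S.pt I z ∈ U}

/-- `[x] ⊆ U` for every `x ∈ U`. -/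
def AxiallySymmetric (U : Set P) : Prop :=
  ∀ I ∈ S.units, ∀ J ∈ S.units, ∀ z : ℂ, S.pt I z ∈ U → S.pt J z ∈ U

/-! ### Slice hyperholomorphic functions

A function with domain `D ⊆ P` is given by a function on `P`, of which only the values on `D`
matter. -/

section Functions

variable [TopologicalSpace F] [ContinuousSMul ℝ F]

/-- The conditions on the components `α(x₀,x₁)`, `β(x₀,x₁)` of a slice hyperholomorphic function
on `D`: symmetry in `x₁` and the Cauchy-Riemann equations. -/
structure IsHolPair (D : Set P) (α β : ℝ → ℝ → F) : Prop where
  even : ∀ I ∈ S.units, ∀ z : ℂ, S.pt I z ∈ D → α z.re (-z.im) = α z.re z.im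
  odd : ∀ I ∈ S.units, ∀ z : ℂ, S.pt I z ∈ D → β z.re (-z.im) = -β z.re z.im
  cauchyRiemann : ∀ I ∈ S.units, ∀ z : ℂ, S.pt I z ∈ D → ∃ a b : F,
    HasDerivAt (fun x₀ => α x₀ z.im) a z.re ∧ HasDerivAt (fun x₁ => β z.re x₁) a z.im ∧
    HasDerivAt (fun x₀ => β x₀ z.im) b z.re ∧ HasDerivAt (fun x₁ => α z.re x₁) (-b) z.im

/-- `f ∈ SH_L(D)`, for `D` open and axially symmetric. -/
def IsLeftSH (D : Set P) (f : P → F) : Prop :=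
  DifferentiableOn ℝ f D ∧ ∃ α β : ℝ → ℝ → F, S.IsHolPair D α β ∧
    ∀ I ∈ S.units, ∀ z : ℂ, S.pt I z ∈ D → f (S.pt I z) = α z.re z.im + S.emb I * β z.re z.im

/-- `f ∈ SH_R(D)`, for `D` open and axially symmetric. -/
def IsRightSH (D : Set P) (f : P → F) : Prop :=
  DifferentiableOn ℝ f D ∧ ∃ α β : ℝ → ℝ → F, S.IsHolPair D α β ∧
    ∀ I ∈ S.units, ∀ z : ℂ, S.pt I z ∈ D → f (S.pt I z) = α z.re z.im + β z.re z.im * S.emb I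

/-- `f ∈ N(D)`: `f` is left slice hyperholomorphic with real-valued components. -/
def IsIntrinsic (D : Set P) (f : P → F) : Prop :=
  DifferentiableOn ℝ f D ∧ ∃ α β : ℝ → ℝ → F, S.IsHolPair D α β ∧
    (∀ I ∈ S.units, ∀ z : ℂ, S.pt I z ∈ D →
      f (S.pt I z) = α z.re z.im + S.emb I * β z.re z.im) ∧
    ∀ I ∈ S.units, ∀ z : ℂ, S.pt I z ∈ D →
      α z.re z.im ∈ Set.range (algebraMap ℝ F) ∧ β z.re z.im ∈ Set.range (algebraMap ℝ F)

end Functions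

end SliceSetting

/-! ### Cauchy domains in the plane and their oriented boundaries -/

/-- `γ`, restricted to `[0,1]`, is a closed piecewise continuously differentiable Jordan curve. -/
def IsPiecewiseC1Jordan (γ : ℝ → ℂ) : Prop :=
  γ 0 = γ 1 ∧ Set.InjOn γ (Set.Ico 0 1) ∧
    ∃ (k : ℕ) (t : Fin (k + 1) → ℝ), StrictMono t ∧ t 0 = 0 ∧ t (Fin.last k) = 1 ∧
      ∀ j : Fin k, ContDiffOn ℝ 1 γ (Set.Icc (t j.castSucc) (t j.succ))

/-- The boundary of `W` consists of the finitely many (at least one), pairwise disjoint, closed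
piecewise continuously differentiable Jordan curves `Γ ℓ`. -/
structure IsBoundary (W : Set ℂ) {m : ℕ} (Γ : Fin m → ℝ → ℂ) : Prop where
  pos : 0 < m
  jordan : ∀ ℓ, IsPiecewiseC1Jordan (Γ ℓ)
  disjoint : ∀ ℓ k, ℓ ≠ k → Disjoint (Γ ℓ '' Set.Icc 0 1) (Γ k '' Set.Icc 0 1)
  frontier_eq : frontier W = ⋃ ℓ, Γ ℓ '' Set.Icc 0 1

/-- Cauchy domains in `ℂ`. -/
structure IsCauchyDomain (W : Set ℂ) : Prop where
  isOpen : IsOpen W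
  finite_components : {C | ∃ z ∈ W, C = connectedComponentIn W z}.Finite
  disjoint_closures : ∀ z ∈ W, ∀ w ∈ W, connectedComponentIn W z ≠ connectedComponentIn W w →
    Disjoint (closure (connectedComponentIn W z)) (closure (connectedComponentIn W w))
  boundary : ∃ (m : ℕ) (Γ : Fin m → ℝ → ℂ), IsBoundary W Γ

/-- The winding number of the closed curve `γ` about `z`. -/
def windingNumber (γ : ℝ → ℂ) (z : ℂ) : ℂ :=
  (2 * Real.pi * Complex.I)⁻¹ * ∫ t in (0 : ℝ)..1, deriv γ t / (γ t - z)

/-- `Γ` is the boundary of the unbounded Cauchy domain `W` with its positive orientation (`W` on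
the left): the total winding number is `0` about the points of `W` and `-1` about the points of the
exterior of `W`. -/
structure IsOrientedBoundary (W : Set ℂ) {m : ℕ} (Γ : Fin m → ℝ → ℂ) : Prop
    extends IsBoundary W Γ where
  winding_inside : ∀ z ∈ W, ∑ ℓ, windingNumber (Γ ℓ) z = 0
  winding_outside : ∀ z ∉ closure W, ∑ ℓ, windingNumber (Γ ℓ) z = -1

/-! ### Operators

Bounded operators are elements of `V →L[ℝ] V`; the operators built below from a right linear
operator are automatically right linear. -/

section Operators

variable {V : Type*} [NormedAddCommGroup V] [NormedSpace ℝ V]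

open Classical in
/-- The bounded operator with underlying map `φ` (and `0` if `φ` is not a bounded operator). -/
def boundedOp (φ : V → V) : V →L[ℝ] V :=
  if h : ∃ A : V →L[ℝ] V, ⇑A = φ then h.choose else 0

/-- The operator `a𝓘 : v ↦ a v`. -/
def scalarOp {F : Type*} [Ring F] [Module F V] (a : F) : V →L[ℝ] V := boundedOp fun v => a • v

variable {R : Type*} [Ring R] [Module R V]

open Classical in
/-- `T v` for `v ∈ dom(T)`, and `0` otherwise. -/
def opApply (T : V →ₗ.[R] V) (v : V) : V := if h : v ∈ T.domain then T ⟨v, h⟩ else 0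

/-- `dom(T²)`. -/
def domSq (T : V →ₗ.[R] V) : Set V := {v | v ∈ T.domain ∧ opApply T v ∈ T.domain}

namespace SliceSetting

variable {P F : Type*} [NormedAddCommGroup P] [NormedSpace ℝ P] [Ring F] [Algebra ℝ F]
  (S : SliceSetting P F)

/-- `𝒬_s(T) v = (T² - 2 Re(s) T + |s|²) v`, for `v ∈ dom(T²)`. -/
def qOp (T : V →ₗ.[R] V) (s : P) (v : V) : V :=
  opApply T (opApply T v) - (2 * S.re s) • opApply T v + (‖s‖ ^ 2) • v

/-- `B` is a bounded inverse `V → dom(T²)` of `𝒬_s(T) : dom(T²) → V`. -/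
def IsQInv (T : V →ₗ.[R] V) (s : P) (B : V →L[ℝ] V) : Prop :=
  (∀ w, B w ∈ domSq T ∧ S.qOp T s (B w) = w) ∧ ∀ v ∈ domSq T, B (S.qOp T s v) = v

/-- The `S`-resolvent set. -/
def resolventSet (T : V →ₗ.[R] V) : Set P := {s | ∃ B : V →L[ℝ] V, S.IsQInv T s B}

/-- The `S`-spectrum. -/
def spectrum (T : V →ₗ.[R] V) : Set P := (S.resolventSet T)ᶜ

open Classical in
/-- The pseudo-resolvent `𝒬_s(T)⁻¹`, for `s` in the `S`-resolvent set. -/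
def qInv (T : V →ₗ.[R] V) (s : P) : V →L[ℝ] V :=
  if h : ∃ B : V →L[ℝ] V, S.IsQInv T s B then h.choose else 0

variable [Module F V]

/-- The left `S`-resolvent operator `𝒬_s(T)⁻¹ s̄ - T 𝒬_s(T)⁻¹`. -/
def leftResolvent (T : V →ₗ.[R] V) (s : P) : V →L[ℝ] V :=
  boundedOp fun v => S.qInv T s (S.emb (S.conj s) • v) - opApply T (S.qInv T s v)

/-- The right `S`-resolvent operator `-(T - 𝓘 s̄) 𝒬_s(T)⁻¹`. -/
def rightResolvent (T : V →ₗ.[R] V) (s : P) : V →L[ℝ] V :=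
  boundedOp fun v => -(opApply T (S.qInv T s v) - S.emb (S.conj s) • S.qInv T s v)

/-! ### The `S`-functional calculus -/

/-- `∫_Γ S_L⁻¹(s,T) ds_I f(s)` with `ds_I = (-I) ds`, for curves `Γ` in `ℂ_I`. -/
def leftIntegral (T : V →ₗ.[R] V) (f : P → F) (I : P) {m : ℕ} (Γ : Fin m → ℝ → ℂ) : V →L[ℝ] V :=
  ∑ ℓ, ∫ t in (0 : ℝ)..1, S.leftResolvent T (S.pt I (Γ ℓ t)) ∘L
    scalarOp (-S.emb I * S.emb (S.pt I (deriv (Γ ℓ) t)) * f (S.pt I (Γ ℓ t)))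

/-- `∫_Γ f(s) ds_I S_R⁻¹(s,T)` with `ds_I = (-I) ds`, for curves `Γ` in `ℂ_I`. -/
def rightIntegral (T : V →ₗ.[R] V) (f : P → F) (I : P) {m : ℕ} (Γ : Fin m → ℝ → ℂ) : V →L[ℝ] V :=
  ∑ ℓ, ∫ t in (0 : ℝ)..1,
    scalarOp (f (S.pt I (Γ ℓ t)) * (-S.emb I) * S.emb (S.pt I (deriv (Γ ℓ) t))) ∘L
      S.rightResolvent T (S.pt I (Γ ℓ t))

/-- `D` is the domain of a function on a neighborhood of `σ_S(T) ∪ {∞}`: an open axially symmetric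
set that contains `σ_S(T)` and `{s : r < |s|}` for some `r > 0`. -/
structure IsSpectralNhd (T : V →ₗ.[R] V) (D : Set P) : Prop where
  isOpen : IsOpen D
  axial : S.AxiallySymmetric D
  spectrum_subset : S.spectrum T ⊆ D
  infinity : ∃ r > 0, ∀ s : P, r < ‖s‖ → s ∈ D

/-- `U` is an unbounded slice Cauchy domain with `σ_S(T) ⊆ U` and `closure U ⊆ D`. -/
structure IsCalcDomain (T : V →ₗ.[R] V) (D U : Set P) : Prop where
  axial : S.AxiallySymmetric U
  cauchy : ∀ I ∈ S.units, IsCauchyDomain (S.slice I U)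
  unbounded : ¬ Bornology.IsBounded U
  spectrum_subset : S.spectrum T ⊆ U
  closure_subset : closure U ⊆ D

section Calculus

variable [TopologicalSpace F] [ContinuousSMul ℝ F]

/-- `f`, with domain `D`, belongs to `SH_L(σ_S(T) ∪ {∞})`. -/
def MemLeftSH (T : V →ₗ.[R] V) (D : Set P) (f : P → F) : Prop :=
  S.IsSpectralNhd T D ∧ S.IsLeftSH D f ∧ ∃ c, Filter.Tendsto f (Bornology.cobounded P) (nhds c)

/-- `f`, with domain `D`, belongs to `SH_R(σ_S(T) ∪ {∞})`. -/
def MemRightSH (T : V →ₗ.[R] V) (D : Set P) (f : P → F) : Prop :=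
  S.IsSpectralNhd T D ∧ S.IsRightSH D f ∧ ∃ c, Filter.Tendsto f (Bornology.cobounded P) (nhds c)

/-- `f`, with domain `D`, belongs to `N(σ_S(T) ∪ {∞})`. -/
def MemIntrinsic (T : V →ₗ.[R] V) (D : Set P) (f : P → F) : Prop :=
  S.IsSpectralNhd T D ∧ S.IsIntrinsic D f ∧ ∃ c, Filter.Tendsto f (Bornology.cobounded P) (nhds c)

/-- `f(T)` is defined as an element of the calculus for left slice hyperholomorphic functions, and
`f(T) = A`: `f` belongs to `SH_L(σ_S(T) ∪ {∞})`, there is a slice Cauchy domain `U` over whose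
boundary one can integrate, and for every such `U`, every imaginary unit `I` and every
parametrization `Γ` of the oriented boundary of `U ∩ ℂ_I`,
`A = f(∞)𝓘 + (2π)⁻¹ ∫_Γ S_L⁻¹(s,T) ds_I f(s)`. -/
structure IsLeftCalc (T : V →ₗ.[R] V) (D : Set P) (f : P → F) (A : V →L[ℝ] V) : Prop where
  mem : S.MemLeftSH T D f
  exists_domain : ∃ U, S.IsCalcDomain T D U ∧ ∀ I ∈ S.units,
    ∃ (m : ℕ) (Γ : Fin m → ℝ → ℂ), IsOrientedBoundary (S.slice I U) Γ
  eq_integral : ∀ c, Filter.Tendsto f (Bornology.cobounded P) (nhds c) →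
    ∀ U, S.IsCalcDomain T D U → ∀ I ∈ S.units, ∀ (m : ℕ) (Γ : Fin m → ℝ → ℂ),
      IsOrientedBoundary (S.slice I U) Γ →
        A = scalarOp c + (2 * Real.pi)⁻¹ • S.leftIntegral T f I Γ

/-- `f(T) = A` in the calculus for right slice hyperholomorphic functions: the same with
`A = f(∞)𝓘 + (2π)⁻¹ ∫_Γ f(s) ds_I S_R⁻¹(s,T)`. -/
structure IsRightCalc (T : V →ₗ.[R] V) (D : Set P) (f : P → F) (A : V →L[ℝ] V) : Prop where
  mem : S.MemRightSH T D f
  exists_domain : ∃ U, S.IsCalcDomain T D U ∧ ∀ I ∈ S.units,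
    ∃ (m : ℕ) (Γ : Fin m → ℝ → ℂ), IsOrientedBoundary (S.slice I U) Γ
  eq_integral : ∀ c, Filter.Tendsto f (Bornology.cobounded P) (nhds c) →
    ∀ U, S.IsCalcDomain T D U → ∀ I ∈ S.units, ∀ (m : ℕ) (Γ : Fin m → ℝ → ℂ),
      IsOrientedBoundary (S.slice I U) Γ →
        A = scalarOp c + (2 * Real.pi)⁻¹ • S.rightIntegral T f I Γ

end Calculus

end SliceSetting

end Operators

/-! ### Clifford modules and operators of paravector type -/

/-- `V = W ⊗ ℝₙ` for a real Banach space `W`: the element `∑ v_A ⊗ e_A` is the family `(v_A)`, and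
`‖v‖ = ∑ ‖v_A‖`. -/
def CliffMod (n : ℕ) (W : Type*) : Type _ := PiLp 1 (fun _ : Finset (Fin n) => W)

section CliffMod

variable {n : ℕ} {W : Type*} [NormedAddCommGroup W] [NormedSpace ℝ W]

instance : NormedAddCommGroup (CliffMod n W) :=
  inferInstanceAs (NormedAddCommGroup (PiLp 1 (fun _ : Finset (Fin n) => W)))

instance : NormedSpace ℝ (CliffMod n W) :=
  inferInstanceAs (NormedSpace ℝ (PiLp 1 (fun _ : Finset (Fin n) => W)))

instance [CompleteSpace W] : CompleteSpace (CliffMod n W) :=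
  inferInstanceAs (CompleteSpace (PiLp 1 (fun _ : Finset (Fin n) => W)))

/-- `v ↦ (v_A)`. -/
def CliffMod.coeff : CliffMod n W ≃ₗ[ℝ] (Finset (Fin n) → W) :=
  WithLp.linearEquiv 1 ℝ (Finset (Fin n) → W)

/-- Left multiplication `a v = ∑ v_A ⊗ (a e_A)`. -/
instance : SMul (Cliff n) (CliffMod n W) where
  smul a v := CliffMod.coeff.symm fun B =>
    ∑ A, (Cliff.basis n).repr (a * Cliff.basis n A) B • CliffMod.coeff v A

lemma CliffMod.coeff_smul (a : Cliff n) (v : CliffMod n W) (B : Finset (Fin n)) :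
    CliffMod.coeff (a • v) B =
      ∑ A, (Cliff.basis n).repr (a * Cliff.basis n A) B • CliffMod.coeff v A := by
  have : a • v = CliffMod.coeff.symm fun B =>
    ∑ A, (Cliff.basis n).repr (a * Cliff.basis n A) B • CliffMod.coeff v A := rfl
  rw [this, LinearEquiv.apply_symm_apply]

instance : Module (Cliff n) (CliffMod n W) where
  one_smul v := by
    apply CliffMod.coeff.injective
    funext B
    simp [CliffMod.coeff_smul, Finsupp.single_apply]
  mul_smul a b v := by
    apply CliffMod.coeff.injective
    funext B
    simp only [CliffMod.coeff_smul, Finset.smul_sum, smul_smul]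
    rw [Finset.sum_comm]
    refine Finset.sum_congr rfl fun A _ => ?_
    rw [← Finset.sum_smul]
    congr 1
    conv_lhs => rw [mul_assoc, ← (Cliff.basis n).sum_repr (b * Cliff.basis n A)]
    simp only [Finset.mul_sum, mul_smul_comm, map_sum, map_smul, Finsupp.coe_finsetSum,
      Finset.sum_apply, Finsupp.smul_apply, smul_eq_mul]
    exact Finset.sum_congr rfl fun C _ => mul_comm _ _
  smul_zero a := by
    apply CliffMod.coeff.injective
    funext B
    simp [CliffMod.coeff_smul]
  smul_add a v w := by
    apply CliffMod.coeff.injective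
    funext B
    simp [CliffMod.coeff_smul, Finset.sum_add_distrib]
  add_smul a b v := by
    apply CliffMod.coeff.injective
    funext B
    simp [CliffMod.coeff_smul, Finset.sum_add_distrib, add_mul, add_smul]
  zero_smul v := by
    apply CliffMod.coeff.injective
    funext B
    simp [CliffMod.coeff_smul]

instance : SMulCommClass ℝ (Cliff n) (CliffMod n W) where
  smul_comm r a v := by
    apply CliffMod.coeff.injective
    funext B
    simp [CliffMod.coeff_smul, Finset.smul_sum, smul_comm r]

/-- The operator `T = T₀ + ∑ᵢ Tᵢ eᵢ` of paravector type on `V = W ⊗ ℝₙ`, that is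
`T v = ∑ᵢ ∑_A Tᵢ(v_A) ⊗ (eᵢ e_A)`, whose domain consists of all `v` with `v_A ∈ ⋂ᵢ dom(Tᵢ)` for
every `A`. -/
def paravectorOp (T : Fin (n + 1) → (W →ₗ.[ℝ] W)) : CliffMod n W →ₗ.[ℝ] CliffMod n W where
  domain :=
    { carrier := {v | ∀ A i, CliffMod.coeff v A ∈ (T i).domain}
      add_mem' := fun hv hw A i => by
        rw [map_add]; exact (T i).domain.add_mem (hv A i) (hw A i)
      zero_mem' := fun A i => by rw [map_zero]; exact (T i).domain.zero_mem
      smul_mem' := fun r v hv A i => by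
        rw [map_smul]; exact (T i).domain.smul_mem r (hv A i) }
  toFun :=
    { toFun := fun v => ∑ i, Cliff.unit i •
        CliffMod.coeff.symm fun A => T i ⟨CliffMod.coeff v.1 A, v.2 A i⟩
      map_add' := fun v w => by
        rw [← Finset.sum_add_distrib]
        refine Finset.sum_congr rfl fun i _ => ?_
        rw [← smul_add, ← map_add]
        congr 2
        funext A
        exact (T i).map_add ⟨CliffMod.coeff v.1 A, v.2 A i⟩ ⟨CliffMod.coeff w.1 A, w.2 A i⟩
      map_smul' := fun r v => by
        rw [RingHom.id_apply, Finset.smul_sum]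
        refine Finset.sum_congr rfl fun i _ => ?_
        rw [smul_comm r]
        congr 1
        rw [← LinearEquiv.map_smul]
        congr 1
        funext A
        exact (T i).map_smul r ⟨CliffMod.coeff v.1 A, v.2 A i⟩ }

end CliffMod

end SliceCalc

end

/-!
The product rule rests on a translation of the `S`-functional calculus into the holomorphic
functional calculus of a resolvent on a complex Banach space.

Fix an imaginary unit `I` and let `V_ℂ` be the complexification of `V` as a real space, with a new
imaginary unit `i` that commutes with the algebra acting on `V`. For `z = x₀ + i x₁`, the operator
`R(z) = (z̄ - T) (T² - 2 x₀ T + |z|²)⁻¹` is the resolvent `(z - T)⁻¹` of the complexified operator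
(`cxResolvent`); it satisfies the resolvent identity (`cxResolvent_sub`) and is holomorphic on the
open set of all `z` with `x₀ + I x₁ ∈ ρ_S(T)`. A slice hyperholomorphic function with components
`α`, `β` gives the holomorphic function `H = α + i β` with values in the operators on `V_ℂ`
(`isCxHol_of_left`, `isCxHol_of_right`). Both `R` and `H` intertwine the complex conjugations, so
that `(2πi)⁻¹ ∫ R H dz`, over a cycle invariant under reflection up to homology, is a real operator.
It is equal to the integral that defines `f(T)` (`leftIntegral_eq`, `rightIntegral_eq`): the
integrand of the slice integral is the real part of the sum of `-i R H dz` and of a term whose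
integral is purely imaginary by the same symmetry. In particular `f(T)` does not depend on `I`, and
by Cauchy's theorem it does not depend on the domain.

In this form the product rule becomes `pseudoResolvent_product`: for nested cycles, the resolvent
identity and Cauchy's formula for unbounded domains turn
`(f₀ + (2πi)⁻¹ ∫ f R dz) (g₀ + (2πi)⁻¹ ∫ R g dw)` into `f₀ g₀ + (2πi)⁻¹ ∫ f R g dz` for arbitrary
operator-valued `f` and `g`. An intrinsic factor is needed only to identify the last integral: its
representation is a complex scalar, commutes with `R`, and `f R g` becomes `R (f g)` or `(f g) R`.

Cauchy's theorem for cycles (`sum_integral_eq_zero`) and the existence of slice Cauchy domains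
(`exists_cauchyDomain`) are both obtained from a square grid. A compact subset of an open set is
covered by squares that stay in the open set, and the boundary edges of the union of these squares
give Cauchy's formula. If the squares are taken in pairs, arranged like the bricks of a wall, the
union never looks like a checkerboard near a vertex (`IsBrickwork.no_checkerboard`), so that the
boundary edges form disjoint Jordan polygons.

The two concrete settings enter only through the boundedness of `T B` for bounded `B` with range in
`dom(T)`, a consequence of the closed graph theorem (`exists_clm_opApply`,
`hasBoundedComp_paravectorOp`).
-/

noncomputable section

namespace SliceCalc

open Set Filter Topology MeasureTheory Complex

/-! ### Double integrals over curves -/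

section Swap

variable {E : Type*} [NormedAddCommGroup E] [NormedSpace ℂ E]

lemma intervalIntegral_smul_swap {a b c d : ℝ} (hab : a ≤ b) (hcd : c ≤ d) {φ ψ : ℝ → ℂ}
    (hφ : IntervalIntegrable φ volume a b) (hψ : IntervalIntegrable ψ volume c d)
    {K : ℝ → ℝ → E} (hK : ContinuousOn (Function.uncurry K) (Icc a b ×ˢ Icc c d)) :
    ∫ t in a..b, φ t • ∫ u in c..d, ψ u • K t u =
      ∫ u in c..d, ψ u • ∫ t in a..b, φ t • K t u := by
  have h1 : ∀ t, φ t • ∫ u in c..d, ψ u • K t u = ∫ u in c..d, φ t • ψ u • K t u := fun t =>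
    (intervalIntegral.integral_smul _ _).symm
  have h2 : ∀ u, ψ u • ∫ t in a..b, φ t • K t u = ∫ t in a..b, φ t • ψ u • K t u := fun u => by
    rw [← intervalIntegral.integral_smul]
    simp only [smul_comm (ψ u)]
  simp only [h1, h2]
  refine intervalIntegral_intervalIntegral_swap ?_
  rw [uIoc_of_le hab, uIoc_of_le hcd]
  have hsub : Ioc a b ×ˢ Ioc c d ⊆ Icc a b ×ˢ Icc c d :=
    prod_mono Ioc_subset_Icc_self Ioc_subset_Icc_self
  have hmeas : MeasurableSet (Ioc a b ×ˢ Ioc c d) := measurableSet_Ioc.prod measurableSet_Ioc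
  obtain ⟨C, hC⟩ := (isCompact_Icc.prod isCompact_Icc).exists_bound_of_continuousOn hK
  have hprod : Integrable (fun p : ℝ × ℝ => φ p.1 * ψ p.2)
      (volume.restrict (Ioc a b ×ˢ Ioc c d)) := by
    rw [Measure.volume_eq_prod, ← Measure.prod_restrict]
    exact ((intervalIntegrable_iff_integrableOn_Ioc_of_le hab).1 hφ).mul_prod
      ((intervalIntegrable_iff_integrableOn_Ioc_of_le hcd).1 hψ)
  have hKm : AEStronglyMeasurable (Function.uncurry K)
      (volume.restrict (Ioc a b ×ˢ Ioc c d)) :=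
    (hK.mono hsub).aestronglyMeasurable hmeas
  refine (hprod.norm.const_mul C).mono' ?_ ?_
  · refine (hprod.aestronglyMeasurable.smul hKm).congr (ae_of_all _ fun p => ?_)
    simp [Function.uncurry, mul_smul]
  · refine (ae_restrict_iff' hmeas).2 (ae_of_all _ fun p hp => ?_)
    have := hC p (hsub hp)
    simp only [Function.uncurry] at this ⊢
    rw [norm_smul, norm_smul, ← mul_assoc, ← norm_mul, mul_comm]
    exact mul_le_mul_of_nonneg_right this (norm_nonneg _)

lemma intervalIntegrable_smul_continuousOn {a b : ℝ} (hab : a ≤ b) {φ : ℝ → ℂ}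
    (hφ : IntervalIntegrable φ volume a b) {k : ℝ → E} (hk : ContinuousOn k (Icc a b)) :
    IntervalIntegrable (fun t => φ t • k t) volume a b :=
  hφ.smul_continuousOn (by rwa [uIcc_of_le hab])

lemma continuousOn_intervalIntegral_smul {a b c d : ℝ} (hab : a ≤ b) {φ : ℝ → ℂ}
    (hφ : IntervalIntegrable φ volume a b)
    {K : ℝ → ℝ → E} (hK : ContinuousOn (Function.uncurry K) (Icc a b ×ˢ Icc c d)) :
    ContinuousOn (fun u => ∫ t in a..b, φ t • K t u) (Icc c d) := by
  obtain ⟨C, hC⟩ := (isCompact_Icc.prod isCompact_Icc).exists_bound_of_continuousOn hK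
  have hsub : Ioc a b ⊆ Icc a b := Ioc_subset_Icc_self
  intro u hu
  refine intervalIntegral.continuousWithinAt_of_dominated_interval
    (bound := fun t => ‖φ t‖ * C) ?_ ?_ (hφ.norm.mul_const C) ?_
  · refine eventually_mem_nhdsWithin.mono fun v hv => ?_
    rw [uIoc_of_le hab]
    refine AEStronglyMeasurable.smul
      ((intervalIntegrable_iff_integrableOn_Ioc_of_le hab).1 hφ).aestronglyMeasurable ?_
    refine ContinuousOn.aestronglyMeasurable ?_ measurableSet_Ioc
    exact hK.comp (by fun_prop : ContinuousOn (fun t => (t, v)) (Ioc a b)) fun t ht => ⟨hsub ht, hv⟩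
  · refine eventually_mem_nhdsWithin.mono fun v hv => ae_of_all _ fun t ht => ?_
    rw [uIoc_of_le hab] at ht
    rw [norm_smul]
    exact mul_le_mul_of_nonneg_left (hC (t, v) ⟨hsub ht, hv⟩) (norm_nonneg _)
  · refine ae_of_all _ fun t ht => ?_
    rw [uIoc_of_le hab] at ht
    refine ContinuousWithinAt.const_smul ?_ _
    exact (hK.comp (by fun_prop : ContinuousOn (fun v => (t, v)) (Icc c d))
      fun v hv => ⟨hsub ht, hv⟩) u hu

end Swap

/-! ### The square grid -/

section Grid

open GaussianInt

/-- The four directions `1, i, -1, -i`. -/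
def dirs : Finset GaussianInt := {1, ⟨0, 1⟩, -1, ⟨0, -1⟩}

/-- The Gaussian integer `i`. -/
def gI : GaussianInt := ⟨0, 1⟩

@[simp] lemma coe_gI : ((gI : GaussianInt) : ℂ) = I := by simp [gI, toComplex_def]

lemma gI_mul_gI : gI * gI = -1 := by decide

lemma mem_dirs {d : GaussianInt} : d ∈ dirs ↔ d = 1 ∨ d = gI ∨ d = -1 ∨ d = -gI := by
  have : dirs = {1, gI, -1, -gI} := by decide
  simp [this]

lemma gI_mul_mem_dirs {d : GaussianInt} (hd : d ∈ dirs) : gI * d ∈ dirs := by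
  rw [mem_dirs] at *
  rcases hd with rfl | rfl | rfl | rfl <;> decide

lemma neg_mem_dirs {d : GaussianInt} (hd : d ∈ dirs) : -d ∈ dirs := by
  rw [mem_dirs] at *
  rcases hd with rfl | rfl | rfl | rfl <;> decide

lemma sum_dirs {M : Type*} [AddCommMonoid M] (H : GaussianInt → M) :
    ∑ d ∈ dirs, H d = H 1 + H gI + H (-1) + H (-gI) := by
  have : dirs = {1, gI, -1, -gI} := by decide
  rw [this, Finset.sum_insert (by decide), Finset.sum_insert (by decide),
    Finset.sum_insert (by decide), Finset.sum_singleton]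
  abel

/-- The closed unit square with centre `g`. -/
def sq (g : GaussianInt) : Set ℂ :=
  Icc ((g : ℂ).re - 1 / 2) ((g : ℂ).re + 1 / 2) ×ℂ Icc ((g : ℂ).im - 1 / 2) ((g : ℂ).im + 1 / 2)

/-- The open unit square with centre `g`. -/
def osq (g : GaussianInt) : Set ℂ :=
  Ioo ((g : ℂ).re - 1 / 2) ((g : ℂ).re + 1 / 2) ×ℂ Ioo ((g : ℂ).im - 1 / 2) ((g : ℂ).im + 1 / 2)

lemma mem_sq {g : GaussianInt} {z : ℂ} :
    z ∈ sq g ↔ |z.re - (g : ℂ).re| ≤ 1 / 2 ∧ |z.im - (g : ℂ).im| ≤ 1 / 2 := by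
  simp only [sq, mem_reProdIm, mem_Icc, abs_le]
  constructor <;> rintro ⟨⟨_, _⟩, _, _⟩ <;> refine ⟨⟨?_, ?_⟩, ?_, ?_⟩ <;> linarith

lemma mem_osq {g : GaussianInt} {z : ℂ} :
    z ∈ osq g ↔ |z.re - (g : ℂ).re| < 1 / 2 ∧ |z.im - (g : ℂ).im| < 1 / 2 := by
  simp only [osq, mem_reProdIm, mem_Ioo, abs_lt]
  constructor <;> rintro ⟨⟨_, _⟩, _, _⟩ <;> refine ⟨⟨?_, ?_⟩, ?_, ?_⟩ <;> linarith

lemma isClosed_sq (g : GaussianInt) : IsClosed (sq g) := isClosed_Icc.reProdIm isClosed_Icc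

lemma closure_osq (g : GaussianInt) : closure (osq g) = sq g := by
  rw [osq, closure_reProdIm, closure_Ioo (by linarith), closure_Ioo (by linarith), sq]

lemma osq_subset_sq (g : GaussianInt) : osq g ⊆ sq g := closure_osq g ▸ subset_closure

lemma eq_of_mem_osq_of_mem_sq {g g' : GaussianInt} {z : ℂ} (h : z ∈ osq g) (h' : z ∈ sq g') :
    g = g' := by
  rw [mem_osq, abs_lt, abs_lt] at h
  rw [mem_sq, abs_le, abs_le] at h'
  simp only [← GaussianInt.intCast_re, ← GaussianInt.intCast_im] at h h'
  have h1 : ((g.re - g'.re : ℤ) : ℝ) < 1 := by push_cast; linarith [h.1.1, h'.1.2]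
  have h2 : (-1 : ℝ) < ((g.re - g'.re : ℤ) : ℝ) := by push_cast; linarith [h.1.2, h'.1.1]
  have h3 : ((g.im - g'.im : ℤ) : ℝ) < 1 := by push_cast; linarith [h.2.1, h'.2.2]
  have h4 : (-1 : ℝ) < ((g.im - g'.im : ℤ) : ℝ) := by push_cast; linarith [h.2.2, h'.2.1]
  norm_cast at h1 h2 h3 h4
  ext <;> omega

/-- The union of the closed unit squares with centres in `S`. -/
def carrier (S : Finset GaussianInt) : Set ℂ := ⋃ g ∈ S, sq g

lemma mem_carrier {S : Finset GaussianInt} {z : ℂ} : z ∈ carrier S ↔ ∃ g ∈ S, z ∈ sq g := by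
  simp [carrier]

lemma isClosed_carrier (S : Finset GaussianInt) : IsClosed (carrier S) :=
  S.finite_toSet.isClosed_biUnion fun g _ => isClosed_sq g

lemma disjoint_osq_carrier {S : Finset GaussianInt} {g : GaussianInt} (hg : g ∉ S) :
    Disjoint (osq g) (carrier S) := by
  rw [Set.disjoint_left]
  intro z hz hz'
  obtain ⟨g', hg', hzg'⟩ := mem_carrier.1 hz'
  exact hg (eq_of_mem_osq_of_mem_sq hz hzg' ▸ hg')

/-- The point with parameter `t` of the edge with direction `d` that has the square `g` on its
right. -/
def edgePt (e : GaussianInt × GaussianInt) (t : ℝ) : ℂ := e.1 + ((I - 1) / 2 + t) * e.2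

/-- `∫ Φ dz` along the edge `e`. -/
def edgeInt {E : Type*} [NormedAddCommGroup E] [NormedSpace ℂ E] (Φ : ℂ → E)
    (e : GaussianInt × GaussianInt) : E :=
  ∫ t in (0 : ℝ)..1, (e.2 : ℂ) • Φ (edgePt e t)

/-- The directed edges that have a square of `S` on their right and a square outside `S` on their
left. -/
def bdry (S : Finset GaussianInt) : Finset (GaussianInt × GaussianInt) :=
  (S ×ˢ dirs).filter fun e => e.1 + gI * e.2 ∉ S

lemma mem_bdry {S : Finset GaussianInt} {e : GaussianInt × GaussianInt} :
    e ∈ bdry S ↔ e.1 ∈ S ∧ e.2 ∈ dirs ∧ e.1 + gI * e.2 ∉ S := by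
  simp [bdry, and_assoc]

lemma continuous_edgePt (e : GaussianInt × GaussianInt) : Continuous (edgePt e) := by
  unfold edgePt; fun_prop

lemma edgePt_mem_sq {e : GaussianInt × GaussianInt} (he : e.2 ∈ dirs) {t : ℝ}
    (ht : t ∈ Icc (0 : ℝ) 1) : edgePt e t ∈ sq e.1 := by
  obtain ⟨g, d⟩ := e
  obtain ⟨h0, h1⟩ := ht
  rw [mem_sq, abs_le, abs_le]
  rw [mem_dirs] at he
  rcases he with h | h | h | h <;> simp only at h <;> subst h <;>
    simp [edgePt] <;> norm_num <;> constructor <;> linarith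

lemma edgePt_flip (g d : GaussianInt) (t : ℝ) :
    edgePt (g + gI * d, -d) t = edgePt (g, d) (1 - t) := by
  simp only [edgePt, toComplex_add, toComplex_mul, coe_gI, toComplex_neg]
  push_cast
  ring

lemma edgePt_mem_sq_left {e : GaussianInt × GaussianInt} (he : e.2 ∈ dirs) {t : ℝ}
    (ht : t ∈ Icc (0 : ℝ) 1) : edgePt e t ∈ sq (e.1 + gI * e.2) := by
  have := edgePt_mem_sq (e := (e.1 + gI * e.2, -e.2)) (neg_mem_dirs he) (t := 1 - t)
    ⟨by linarith [ht.2], by linarith [ht.1]⟩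
  rwa [edgePt_flip, sub_sub_cancel] at this

lemma edgePt_notMem_interior {S : Finset GaussianInt} {e : GaussianInt × GaussianInt}
    (he : e ∈ bdry S) {t : ℝ} (ht : t ∈ Icc (0 : ℝ) 1) :
    edgePt e t ∉ interior (carrier S) := by
  intro h
  obtain ⟨_, h2, h3⟩ := mem_bdry.1 he
  have hcl : edgePt e t ∈ closure (osq (e.1 + gI * e.2)) := by
    rw [closure_osq]; exact edgePt_mem_sq_left h2 ht
  obtain ⟨z, hz, hz'⟩ := mem_closure_iff.1 hcl _ isOpen_interior h
  exact Set.disjoint_left.1 (disjoint_osq_carrier h3) hz' (interior_subset hz)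

lemma edgePt_mem_carrier {S : Finset GaussianInt} {e : GaussianInt × GaussianInt}
    (he : e ∈ bdry S) {t : ℝ} (ht : t ∈ Icc (0 : ℝ) 1) : edgePt e t ∈ carrier S := by
  obtain ⟨h1, h2, _⟩ := mem_bdry.1 he
  exact mem_carrier.2 ⟨_, h1, edgePt_mem_sq h2 ht⟩

variable {E : Type*} [NormedAddCommGroup E] [NormedSpace ℂ E]

lemma edgeInt_flip (Φ : ℂ → E) (g d : GaussianInt) :
    edgeInt Φ (g + gI * d, -d) = -edgeInt Φ (g, d) := by
  have h := intervalIntegral.integral_comp_sub_left (a := 0) (b := 1)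
    (fun t => (d : ℂ) • Φ (edgePt (g, d) t)) 1
  simp only [sub_self, sub_zero] at h
  simp only [edgeInt, edgePt_flip, toComplex_neg, neg_smul, intervalIntegral.integral_neg, h]

/-- The edges between two squares of `S` cancel. -/
lemma sum_edgeInt_bdry (S : Finset GaussianInt) (Φ : ℂ → E) :
    ∑ e ∈ bdry S, edgeInt Φ e = ∑ g ∈ S, ∑ d ∈ dirs, edgeInt Φ (g, d) := by
  rw [← Finset.sum_product', bdry]
  rw [← Finset.sum_filter_add_sum_filter_not (S ×ˢ dirs) (fun e => e.1 + gI * e.2 ∉ S)]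
  have : ∑ e ∈ (S ×ˢ dirs).filter (fun e => ¬ e.1 + gI * e.2 ∉ S), edgeInt Φ (e.1, e.2) = 0 := by
    refine Finset.sum_involution (fun e _ => (e.1 + gI * e.2, -e.2)) ?_ ?_ ?_ ?_
    · intro e _
      rw [edgeInt_flip, add_neg_cancel]
    · intro e he hne heq
      have h2 := congrArg Prod.snd heq
      simp only [Finset.mem_filter, Finset.mem_product] at he
      have := he.1.2
      rw [mem_dirs] at this
      rcases this with h | h | h | h <;> simp only [h] at h2 <;> exact absurd h2 (by decide)
    · intro e he
      simp only [Finset.mem_filter, Finset.mem_product, not_not] at he ⊢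
      refine ⟨⟨he.2, neg_mem_dirs he.1.2⟩, ?_⟩
      rw [mul_neg, add_neg_cancel_right]; exact he.1.1
    · intro e _
      ext <;> simp
  rw [this, add_zero]

/-- Cauchy's theorem for a single square. -/
lemma sum_edgeInt_sq_eq_zero [CompleteSpace E] {Φ : ℂ → E} {g : GaussianInt}
    (h : DifferentiableOn ℂ Φ (sq g)) : ∑ d ∈ dirs, edgeInt Φ (g, d) = 0 := by
  have key := Complex.integral_boundary_rect_eq_zero_of_differentiableOn Φ
    ((g : ℂ) - (1 + I) / 2) ((g : ℂ) + (1 + I) / 2) (by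
      refine h.mono ?_
      rw [uIcc_of_le, uIcc_of_le]
      · intro z hz
        simp only [mem_reProdIm, mem_Icc] at hz
        simp at hz
        simp only [sq, mem_reProdIm, mem_Icc]
        norm_num at hz ⊢
        exact hz
      · simp; linarith
      · simp; linarith)
  rw [sum_dirs]
  simp only [edgeInt]
  have e1 : ∫ t in (0 : ℝ)..1, ((1 : GaussianInt) : ℂ) • Φ (edgePt (g, 1) t) =
      ∫ x in ((g : ℂ) - (1 + I) / 2).re..((g : ℂ) + (1 + I) / 2).re,
        Φ (x + ((g : ℂ) + (1 + I) / 2).im * I) := by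
    rw [show ((g : ℂ) - (1 + I) / 2).re = ((g : ℂ).re - 1 / 2 : ℝ) + 0 by simp,
      show ((g : ℂ) + (1 + I) / 2).re = ((g : ℂ).re - 1 / 2 : ℝ) + 1 by
        simp; ring,
      ← intervalIntegral.integral_comp_add_left]
    refine intervalIntegral.integral_congr fun t _ => ?_
    simp only [toComplex_one, one_smul, edgePt]
    congr 1
    apply Complex.ext <;> simp <;> ring
  have e2 : ∫ t in (0 : ℝ)..1, ((-1 : GaussianInt) : ℂ) • Φ (edgePt (g, -1) t) =
      -∫ x in ((g : ℂ) - (1 + I) / 2).re..((g : ℂ) + (1 + I) / 2).re,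
        Φ (x + ((g : ℂ) - (1 + I) / 2).im * I) := by
    rw [show ((g : ℂ) - (1 + I) / 2).re = ((g : ℂ).re + 1 / 2 : ℝ) - 1 by
        simp; ring,
      show ((g : ℂ) + (1 + I) / 2).re = ((g : ℂ).re + 1 / 2 : ℝ) - 0 by
        simp,
      ← intervalIntegral.integral_comp_sub_left, ← intervalIntegral.integral_neg]
    refine intervalIntegral.integral_congr fun t _ => ?_
    simp only [toComplex_neg, toComplex_one, neg_smul, one_smul, edgePt]
    congr 2
    apply Complex.ext <;> simp <;> ring
  have e3 : ∫ t in (0 : ℝ)..1, ((gI : GaussianInt) : ℂ) • Φ (edgePt (g, gI) t) =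
      I • ∫ y in ((g : ℂ) - (1 + I) / 2).im..((g : ℂ) + (1 + I) / 2).im,
        Φ (((g : ℂ) - (1 + I) / 2).re + y * I) := by
    rw [show ((g : ℂ) - (1 + I) / 2).im = ((g : ℂ).im - 1 / 2 : ℝ) + 0 by simp,
      show ((g : ℂ) + (1 + I) / 2).im = ((g : ℂ).im - 1 / 2 : ℝ) + 1 by
        simp; ring,
      ← intervalIntegral.integral_comp_add_left, ← intervalIntegral.integral_smul]
    refine intervalIntegral.integral_congr fun t _ => ?_
    simp only [coe_gI, edgePt]
    congr 2
    apply Complex.ext <;> simp <;> ring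
  have e4 : ∫ t in (0 : ℝ)..1, ((-gI : GaussianInt) : ℂ) • Φ (edgePt (g, -gI) t) =
      -(I • ∫ y in ((g : ℂ) - (1 + I) / 2).im..((g : ℂ) + (1 + I) / 2).im,
        Φ (((g : ℂ) + (1 + I) / 2).re + y * I)) := by
    rw [show ((g : ℂ) - (1 + I) / 2).im = ((g : ℂ).im + 1 / 2 : ℝ) - 1 by
        simp; ring,
      show ((g : ℂ) + (1 + I) / 2).im = ((g : ℂ).im + 1 / 2 : ℝ) - 0 by
        simp,
      ← intervalIntegral.integral_comp_sub_left, ← intervalIntegral.integral_smul,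
      ← intervalIntegral.integral_neg]
    refine intervalIntegral.integral_congr fun t _ => ?_
    simp only [toComplex_neg, coe_gI, neg_smul, edgePt]
    congr 3
    apply Complex.ext <;> simp <;> ring
  rw [e1, e2, e3, e4]
  rw [← neg_eq_zero, ← key]
  abel

lemma log_neg_I_mul {y : ℂ} (hy : 0 < y.re) :
    Complex.log (-I * y) = Complex.log y - Real.pi / 2 * I := by
  have hy0 : y ≠ 0 := by rintro rfl; simp at hy
  have h := abs_arg_lt_pi_div_two_iff.2 (Or.inl hy)
  rw [abs_lt] at h
  rw [(Complex.log_mul_eq_add_log_iff (by simp) hy0).2, Complex.log_neg_I]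
  · ring
  · rw [Complex.arg_neg_I]
    constructor <;> linarith [Real.pi_pos]

/-- The integral of `1 / (z - w)` along an edge, as a difference of logarithms: the edge is turned
into the right half plane by a factor `1 / d`, so that the principal branch can be used. -/
lemma edgeInt_inv {g d : GaussianInt} (hd : d ∈ dirs) {w : ℂ} (hw : w ∈ osq g) :
    edgeInt (fun z => (z - w)⁻¹) (g, d) =
      Complex.log (((g : ℂ) - w) / d + (1 + I) / 2) -
        Complex.log (((g : ℂ) - w) / (gI * d : GaussianInt) + (1 + I) / 2) - Real.pi / 2 * I := by
  have hd0 : (d : ℂ) ≠ 0 := by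
    rw [mem_dirs] at hd
    rcases hd with rfl | rfl | rfl | rfl <;> simp
  have hpos : ∀ d ∈ dirs, 0 < (((g : ℂ) - w) / d + (1 + I) / 2).re := by
    intro d hd
    rw [mem_osq, abs_lt, abs_lt] at hw
    rw [mem_dirs] at hd
    rcases hd with rfl | rfl | rfl | rfl <;> simp [div_neg] <;> linarith
  set a := ((g : ℂ) - w) / d + (1 + I) / 2 with ha
  set b := ((g : ℂ) - w) / (gI * d : GaussianInt) + (1 + I) / 2 with hb
  have hapos : 0 < a.re := hpos d hd
  have hbpos : 0 < b.re := hpos _ (gI_mul_mem_dirs hd)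
  have hx : ((g : ℂ) - w) / (gI * d : GaussianInt) = -I * (((g : ℂ) - w) / d) := by
    rw [toComplex_mul, coe_gI, div_mul_eq_div_div_swap, div_I]; ring
  have hab : -I * a = b - I := by
    rw [ha, hb, hx]
    linear_combination (-1 / 2) * I_sq
  have hline : ∀ t : ℝ, edgePt (g, d) t - w = d * I * (b - I * t) := by
    intro t
    have hgx : (g : ℂ) - w = d * (((g : ℂ) - w) / d) := by field_simp
    rw [hb, hx, edgePt]
    linear_combination hgx + (d : ℂ) * (((g : ℂ) - w) / d - 1 / 2 + t) * I_sq
  have hder : ∀ t ∈ uIcc (0 : ℝ) 1,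
      HasDerivAt (fun t : ℝ => Complex.log (b - I * t)) ((d : ℂ) * (edgePt (g, d) t - w)⁻¹) t := by
    intro t _
    have h1 : HasDerivAt (fun t : ℝ => b - I * (t : ℂ)) (-I) t := by
      simpa using ((Complex.ofRealCLM.hasDerivAt (x := t)).const_mul I).const_sub b
    have h2 : b - I * t ∈ slitPlane := Or.inl (by simpa using hbpos)
    have h3 := h1.clog_real h2
    convert h3 using 1
    rw [hline, div_eq_mul_inv, mul_inv, mul_inv, inv_I]
    field_simp
  have := intervalIntegral.integral_eq_sub_of_hasDerivAt hder (by
    refine ContinuousOn.intervalIntegrable ?_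
    refine continuousOn_const.mul (ContinuousOn.inv₀ ?_ ?_)
    · exact ((continuous_edgePt _).sub continuous_const).continuousOn
    · intro t _
      rw [hline]
      have : b - I * t ≠ 0 := fun h0 => by
        have := congrArg Complex.re h0
        simp at this; linarith
      simp [hd0, this])
  rw [edgeInt]
  simp only [smul_eq_mul]
  rw [this]
  simp only [ofReal_one, ofReal_zero, mul_one, mul_zero, sub_zero]
  rw [← hab, log_neg_I_mul hapos]
  ring

/-- The logarithms at the four corners telescope; the sign reflects the clockwise orientation. -/
lemma sum_edgeInt_inv {g : GaussianInt} {w : ℂ} (hw : w ∈ osq g) :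
    ∑ d ∈ dirs, edgeInt (fun z => (z - w)⁻¹) (g, d) = -(2 * Real.pi * I) := by
  rw [sum_dirs, edgeInt_inv (by decide) hw, edgeInt_inv (by decide) hw, edgeInt_inv (by decide) hw,
    edgeInt_inv (by decide) hw]
  have h1 : gI * 1 = gI := by decide
  have h2 : gI * gI = -1 := by decide
  have h3 : gI * -1 = -gI := by decide
  have h4 : gI * -gI = 1 := by decide
  rw [h1, h2, h3, h4]
  ring

end Grid

/-! ### Cauchy's theorem for cycles -/

section GridCauchy

open GaussianInt

variable {E : Type*} [NormedAddCommGroup E] [NormedSpace ℂ E] [CompleteSpace E]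

omit [CompleteSpace E] in
/-- A Cauchy integral along an edge depends continuously on the point off the edge. -/
lemma continuousOn_edgeInt_cauchy {f : ℂ → E} {Ω U : Set ℂ} (hf : ContinuousOn f Ω)
    {e : GaussianInt × GaussianInt} (heΩ : ∀ t ∈ Icc (0 : ℝ) 1, edgePt e t ∈ Ω)
    (heU : ∀ t ∈ Icc (0 : ℝ) 1, edgePt e t ∉ U) :
    ContinuousOn (fun w => edgeInt (fun z => (z - w)⁻¹ • f z) e) U := by
  rw [continuousOn_iff_continuous_domRestrict]
  have hproj : Continuous fun t : ℝ => ((projIcc 0 1 zero_le_one t : Icc (0 : ℝ) 1) : ℝ) :=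
    continuous_subtype_val.comp continuous_projIcc
  have hcont : Continuous (Function.uncurry fun (w : U) (t : ℝ) =>
      (e.2 : ℂ) • (edgePt e (projIcc 0 1 zero_le_one t : Icc (0 : ℝ) 1) - (w : ℂ))⁻¹ •
        f (edgePt e (projIcc 0 1 zero_le_one t : Icc (0 : ℝ) 1))) := by
    have h1 : Continuous fun p : U × ℝ => edgePt e (projIcc 0 1 zero_le_one p.2 : Icc (0 : ℝ) 1) :=
      (continuous_edgePt e).comp (hproj.comp continuous_snd)
    refine continuous_const.smul (Continuous.smul (Continuous.inv₀ ?_ ?_) ?_)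
    · exact h1.sub (continuous_subtype_val.comp continuous_fst)
    · rintro ⟨w, t⟩ h0
      exact heU _ (projIcc 0 1 zero_le_one t).2 (by rw [sub_eq_zero.1 h0]; exact w.2)
    · exact hf.comp_continuous h1 fun p => heΩ _ (projIcc 0 1 zero_le_one p.2).2
  have := intervalIntegral.continuous_parametric_intervalIntegral_of_continuous (a₀ := 0)
    (μ := volume) hcont (continuous_const (y := (1 : ℝ)))
  refine this.congr fun w => ?_
  rw [domRestrict_apply, edgeInt]
  refine intervalIntegral.integral_congr fun t ht => ?_
  rw [uIcc_of_le zero_le_one] at ht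
  simp only [projIcc_of_mem zero_le_one ht]

/-- Cauchy's integral formula for a point in the interior of a square. -/
lemma sum_edgeInt_cauchy_osq {S : Finset GaussianInt} {Ω : Set ℂ} (hΩ : IsOpen Ω)
    (hS : carrier S ⊆ Ω) {f : ℂ → E} (hf : DifferentiableOn ℂ f Ω) {g : GaussianInt} (hg : g ∈ S)
    {w : ℂ} (hw : w ∈ osq g) :
    ∑ e ∈ bdry S, edgeInt (fun z => (z - w)⁻¹ • f z) e = -(2 * Real.pi * I) • f w := by
  rw [sum_edgeInt_bdry, Finset.sum_eq_single g]
  · have hwΩ : Ω ∈ 𝓝 w :=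
      hΩ.mem_nhds (hS (mem_carrier.2 ⟨g, hg, osq_subset_sq g hw⟩))
    have hd : DifferentiableOn ℂ (dslope f w) (sq g) :=
      ((Complex.differentiableOn_dslope hwΩ).2 hf).mono
        fun z hz => hS (mem_carrier.2 ⟨g, hg, hz⟩)
    have key : ∀ d ∈ dirs, edgeInt (fun z => (z - w)⁻¹ • f z) (g, d) =
        edgeInt (dslope f w) (g, d) + (edgeInt (fun z => (z - w)⁻¹) (g, d)) • f w := by
      intro d hd'
      have hne : ∀ t ∈ Icc (0 : ℝ) 1, edgePt (g, d) t ≠ w := by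
        intro t ht h
        have h1 := edgePt_mem_sq_left (e := (g, d)) hd' ht
        rw [h] at h1
        have := eq_of_mem_osq_of_mem_sq hw h1
        rw [left_eq_add] at this
        rw [mem_dirs] at hd'
        rcases hd' with rfl | rfl | rfl | rfl <;> exact absurd this (by simp only; decide)
      have hcont : ContinuousOn (edgePt (g, d)) (Icc 0 1) := (continuous_edgePt _).continuousOn
      have hmaps : MapsTo (edgePt (g, d)) (Icc 0 1) (sq g) := fun t ht =>
        edgePt_mem_sq (e := (g, d)) hd' ht
      have hinv : ContinuousOn (fun t => (edgePt (g, d) t - w)⁻¹) (Icc 0 1) :=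
        (hcont.sub continuousOn_const).inv₀ fun t ht => sub_ne_zero.2 (hne t ht)
      rw [edgeInt, edgeInt, edgeInt, ← intervalIntegral.integral_smul_const,
        ← intervalIntegral.integral_add]
      · refine intervalIntegral.integral_congr fun t ht => ?_
        rw [uIcc_of_le zero_le_one] at ht
        simp only [dslope_of_ne f (hne t ht), slope_def_module, smul_sub, smul_assoc]
        abel
      · refine ContinuousOn.intervalIntegrable ?_
        rw [uIcc_of_le zero_le_one]
        exact continuousOn_const.smul (hd.continuousOn.comp hcont hmaps)
      · refine ContinuousOn.intervalIntegrable ?_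
        rw [uIcc_of_le zero_le_one]
        exact ContinuousOn.smul (hinv.const_smul ((g, d).2 : ℂ)) (continuousOn_const (c := f w))
    rw [Finset.sum_congr rfl key, Finset.sum_add_distrib, sum_edgeInt_sq_eq_zero hd,
      ← Finset.sum_smul, sum_edgeInt_inv hw, zero_add]
  · intro g' hg' hne
    refine sum_edgeInt_sq_eq_zero (DifferentiableOn.smul ?_ ?_)
    · refine DifferentiableOn.inv (differentiableOn_id.sub_const w) fun z hz h => hne ?_
      have h := sub_eq_zero.1 h
      exact (eq_of_mem_osq_of_mem_sq hw (h ▸ hz)).symm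
    · exact hf.mono fun z hz => hS (mem_carrier.2 ⟨g', hg', hz⟩)
  · exact fun h => absurd hg h

/-- Cauchy's integral formula for the union of the squares with centres in `S`; the boundary is run
through clockwise. -/
lemma sum_edgeInt_cauchy {S : Finset GaussianInt} {Ω : Set ℂ} (hΩ : IsOpen Ω)
    (hS : carrier S ⊆ Ω) {f : ℂ → E} (hf : DifferentiableOn ℂ f Ω) {w : ℂ}
    (hw : w ∈ interior (carrier S)) :
    ∑ e ∈ bdry S, edgeInt (fun z => (z - w)⁻¹ • f z) e = -(2 * Real.pi * I) • f w := by
  set U := interior (carrier S) with hU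
  have hdense : U ⊆ closure (U ∩ ⋃ g ∈ S, osq g) := by
    have : U ⊆ closure (⋃ g ∈ S, osq g) := by
      refine interior_subset.trans fun z hz => ?_
      obtain ⟨g, hg, hzg⟩ := mem_carrier.1 hz
      rw [← closure_osq] at hzg
      exact closure_mono (subset_biUnion_of_mem (u := fun g => osq g) hg) hzg
    exact (subset_inter subset_rfl this).trans (isOpen_interior.inter_closure)
  refine EqOn.of_subset_closure (s := U ∩ ⋃ g ∈ S, osq g) (t := U)
    (f := fun w => ∑ e ∈ bdry S, edgeInt (fun z => (z - w)⁻¹ • f z) e)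
    (g := fun w => -(2 * Real.pi * I) • f w) ?_ ?_ ?_ inter_subset_left hdense hw
  · rintro z ⟨-, hz⟩
    simp only [mem_iUnion] at hz
    obtain ⟨g, hg, hz⟩ := hz
    exact sum_edgeInt_cauchy_osq hΩ hS hf hg hz
  · refine continuousOn_finsetSum _ fun e he => ?_
    exact continuousOn_edgeInt_cauchy hf.continuousOn
      (fun t ht => hS (edgePt_mem_carrier he ht)) fun t ht => edgePt_notMem_interior he ht
  · exact continuousOn_const.smul (hf.continuousOn.mono (interior_subset.trans hS))

lemma sum_edgeInt_inv_of_notMem {S : Finset GaussianInt} {w : ℂ} (hw : w ∉ carrier S) :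
    ∑ e ∈ bdry S, edgeInt (fun z => (z - w)⁻¹) e = 0 := by
  rw [sum_edgeInt_bdry]
  refine Finset.sum_eq_zero fun g hg => sum_edgeInt_sq_eq_zero ?_
  refine DifferentiableOn.inv (differentiableOn_id.sub_const w) fun z hz h => hw ?_
  have h := sub_eq_zero.1 h
  exact mem_carrier.2 ⟨g, hg, h ▸ hz⟩

/-- Cauchy's theorem for a cycle in the union of the squares with centres in `S`. -/
lemma sum_integral_eq_zero_of_carrier {ι : Type*} [Fintype ι] {S : Finset GaussianInt} {Ω K : Set ℂ}
    (hΩ : IsOpen Ω) (hS : carrier S ⊆ Ω) (hK : K ⊆ interior (carrier S)) {f : ℂ → E}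
    (hf : DifferentiableOn ℂ f Ω) {a b : ι → ℝ} (hab : ∀ i, a i ≤ b i) {γ : ι → ℝ → ℂ}
    {φ : ι → ℝ → ℂ} (hγ : ∀ i, ContinuousOn (γ i) (Icc (a i) (b i)))
    (hφ : ∀ i, IntervalIntegrable (φ i) volume (a i) (b i))
    (hγK : ∀ i, ∀ t ∈ Icc (a i) (b i), γ i t ∈ K)
    (hw : ∀ z ∉ K, ∑ i, ∫ t in a i..b i, φ i t / (γ i t - z) = 0) :
    ∑ i, ∫ t in a i..b i, φ i t • f (γ i t) = 0 := by
  have hne : ∀ i, ∀ t ∈ Icc (a i) (b i), ∀ e ∈ bdry S, ∀ u ∈ Icc (0 : ℝ) 1,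
      edgePt e u - γ i t ≠ 0 := fun i t ht e he u hu h =>
    edgePt_notMem_interior he hu (by rw [sub_eq_zero.1 h]; exact hK (hγK i t ht))
  have hK' : ∀ i, ∀ e ∈ bdry S, ContinuousOn (Function.uncurry fun t u =>
      ((edgePt e u - γ i t)⁻¹ • f (edgePt e u))) (Icc (a i) (b i) ×ˢ Icc (0 : ℝ) 1) := by
    intro i e he
    have c1 : ContinuousOn (fun p : ℝ × ℝ => edgePt e p.2) (Icc (a i) (b i) ×ˢ Icc (0 : ℝ) 1) :=
      ((continuous_edgePt e).comp continuous_snd).continuousOn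
    refine ContinuousOn.smul (ContinuousOn.inv₀ (c1.sub ?_) ?_) ?_
    · exact (hγ i).comp continuousOn_fst fun p hp => hp.1
    · exact fun p hp => hne i _ hp.1 e he _ hp.2
    · exact hf.continuousOn.comp c1 fun p hp => hS (edgePt_mem_carrier he hp.2)
  -- Cauchy's formula represents `f` on the curves by its values on the boundary edges; after an
  -- exchange of the integrations the winding numbers of the cycle about the edge points appear
  have h1 : ∀ i, ∫ t in a i..b i, φ i t • f (γ i t) = -(2 * Real.pi * I)⁻¹ •
      ∑ e ∈ bdry S, ∫ u in (0 : ℝ)..1, (e.2 : ℂ) •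
        ∫ t in a i..b i, φ i t • ((edgePt e u - γ i t)⁻¹ • f (edgePt e u)) := by
    intro i
    have h2 : ∀ t ∈ uIcc (a i) (b i), φ i t • f (γ i t) = -(2 * Real.pi * I)⁻¹ •
        ∑ e ∈ bdry S, φ i t • ∫ u in (0 : ℝ)..1, (e.2 : ℂ) •
          ((edgePt e u - γ i t)⁻¹ • f (edgePt e u)) := by
      intro t ht
      rw [uIcc_of_le (hab i)] at ht
      have := sum_edgeInt_cauchy hΩ hS hf (hK (hγK i t ht))
      simp only [edgeInt] at this
      rw [← Finset.smul_sum, this, smul_comm (φ i t), smul_smul, neg_mul_neg,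
        inv_mul_cancel₀ two_pi_I_ne_zero, one_smul]
    rw [intervalIntegral.integral_congr h2, intervalIntegral.integral_smul,
      intervalIntegral.integral_finsetSum]
    · congr 1
      refine Finset.sum_congr rfl fun e he => ?_
      exact intervalIntegral_smul_swap (hab i) zero_le_one (hφ i) (by simp) (hK' i e he)
    · intro e he
      refine intervalIntegrable_smul_continuousOn (hab i) (hφ i) ?_
      have := continuousOn_edgeInt_cauchy hf.continuousOn (U := interior (carrier S))
        (fun t ht => hS (edgePt_mem_carrier he ht)) fun t ht => edgePt_notMem_interior he ht
      exact this.comp (hγ i) fun t ht => hK (hγK i t ht)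
  simp only [h1]
  rw [← Finset.smul_sum, Finset.sum_comm]
  refine smul_eq_zero_of_right _ (Finset.sum_eq_zero fun e he => ?_)
  have h3 : ∀ i, ∀ u ∈ Icc (0 : ℝ) 1,
      ∫ t in a i..b i, φ i t • ((edgePt e u - γ i t)⁻¹ • f (edgePt e u)) =
        (-∫ t in a i..b i, φ i t / (γ i t - edgePt e u)) • f (edgePt e u) := by
    intro i u _
    rw [← intervalIntegral.integral_neg, ← intervalIntegral.integral_smul_const]
    refine intervalIntegral.integral_congr fun t _ => ?_
    simp only [smul_smul]
    rw [← neg_sub (γ i t), inv_neg, mul_neg, div_eq_mul_inv]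
  have hint : ∀ i, IntervalIntegrable (fun u => (e.2 : ℂ) •
        ∫ t in a i..b i, φ i t • ((edgePt e u - γ i t)⁻¹ • f (edgePt e u))) volume 0 1 := by
    intro i
    refine ContinuousOn.intervalIntegrable ?_
    rw [uIcc_of_le zero_le_one]
    exact continuousOn_const.smul (continuousOn_intervalIntegral_smul (hab i) (hφ i) (hK' i e he))
  rw [← intervalIntegral.integral_finsetSum fun i _ => hint i]
  rw [intervalIntegral.integral_congr (g := fun _ => (0 : E)), intervalIntegral.integral_zero]
  intro u hu
  rw [uIcc_of_le zero_le_one] at hu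
  simp only
  rw [← Finset.smul_sum, Finset.sum_congr rfl fun i _ => h3 i u hu, ← Finset.sum_smul,
    Finset.sum_neg_distrib, hw, neg_zero, zero_smul, smul_zero]
  exact fun h => edgePt_notMem_interior he hu (hK h)

end GridCauchy

section Covering

open GaussianInt

/-- The brick relation: the squares of the grid are grouped in pairs of horizontal neighbours, with
a shift by one from each row to the next. -/
def SameBrick (g g' : GaussianInt) : Prop := g.im = g'.im ∧ (g.re + g.im) / 2 = (g'.re + g'.im) / 2

/-- `S` is a union of bricks. -/
def IsBrickwork (S : Finset GaussianInt) : Prop := ∀ g g', SameBrick g g' → g ∈ S → g' ∈ S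

lemma exists_mem_sq_round (z : ℂ) : ∃ g : GaussianInt, z ∈ sq g := by
  refine ⟨⟨round z.re, round z.im⟩, mem_sq.2 ⟨?_, ?_⟩⟩
  · rw [re_toComplex]; exact abs_sub_round _
  · rw [im_toComplex]; exact abs_sub_round _

lemma norm_sub_le_of_mem_sq {g : GaussianInt} {z : ℂ} (h : z ∈ sq g) : ‖z - g‖ ≤ 1 := by
  rw [mem_sq] at h
  have := Complex.norm_le_abs_re_add_abs_im (z - g)
  rw [sub_re, sub_im] at this
  linarith [h.1, h.2]

lemma SameBrick.norm_sub_le {g g' : GaussianInt} (h : SameBrick g g') : ‖(g : ℂ) - g'‖ ≤ 1 := by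
  obtain ⟨h1, h2⟩ := h
  have h3 : |((g.re - g'.re : ℤ) : ℝ)| ≤ 1 := by
    rw [← Int.cast_abs]
    have : |g.re - g'.re| ≤ 1 := by rw [abs_le]; omega
    exact_mod_cast this
  have := Complex.norm_le_abs_re_add_abs_im ((g : ℂ) - g')
  rw [sub_re, sub_im, ← GaussianInt.intCast_re, ← GaussianInt.intCast_re,
    ← GaussianInt.intCast_im, ← GaussianInt.intCast_im, h1, sub_self, abs_zero, add_zero,
    ← Int.cast_sub] at this
  exact this.trans h3

lemma finite_gaussianInt_norm_le (M : ℝ) : {g : GaussianInt | ‖(g : ℂ)‖ ≤ M}.Finite := by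
  set N := ⌈M⌉
  refine (((Finset.Icc (-N) N ×ˢ Finset.Icc (-N) N).image
    fun p : ℤ × ℤ => (⟨p.1, p.2⟩ : GaussianInt)).finite_toSet).subset fun g hg => ?_
  have h1 := (Complex.abs_re_le_norm (g : ℂ)).trans (hg.trans (Int.le_ceil M))
  have h2 := (Complex.abs_im_le_norm (g : ℂ)).trans (hg.trans (Int.le_ceil M))
  rw [← GaussianInt.intCast_re] at h1
  rw [← GaussianInt.intCast_im] at h2
  have h1 : |g.re| ≤ N := by exact_mod_cast h1
  have h2 : |g.im| ≤ N := by exact_mod_cast h2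
  rw [abs_le] at h1 h2
  simp only [Finset.coe_image, mem_image, Finset.mem_coe, Finset.mem_product, Finset.mem_Icc]
  exact ⟨(g.re, g.im), ⟨h1, h2⟩, rfl⟩

/-- A compact set in an open set can be covered by a finite brickwork of small mesh `δ`. -/
lemma exists_brickwork {K Ω : Set ℂ} (hK : IsCompact K) (hΩ : IsOpen Ω) (h : K ⊆ Ω) :
    ∃ δ : ℝ, 0 < δ ∧ ∃ S : Finset GaussianInt, IsBrickwork S ∧
      {z : ℂ | (δ : ℂ) * z ∈ K} ⊆ interior (carrier S) ∧ (∀ z ∈ carrier S, (δ : ℂ) * z ∈ Ω) ∧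
      ((∀ z ∈ K, (starRingEnd ℂ) z ∈ K) → ∀ g ∈ S, star g ∈ S) := by
  obtain ⟨ε, hε, hεΩ⟩ := hK.exists_cthickening_subset_open hΩ h
  -- a brick chosen for a point of `K` stays within distance `4` of this point, in units of the mesh
  set δ := ε / 4 with hδ
  have hδ0 : 0 < δ := by positivity
  have hfin : {g : GaussianInt | ∃ z : ℂ, (δ : ℂ) * z ∈ K ∧ ∃ g', SameBrick g g' ∧
      ‖z - g'‖ < 2}.Finite := by
    obtain ⟨M, hM⟩ := hK.isBounded.exists_norm_le
    refine (finite_gaussianInt_norm_le (M / δ + 3)).subset ?_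
    rintro g ⟨z, hz, g', hg, hd⟩
    have h1 := hM _ hz
    rw [norm_mul, Complex.norm_real, Real.norm_of_nonneg hδ0.le, mul_comm, ← le_div_iff₀ hδ0] at h1
    have h2 := hg.norm_sub_le
    have h3 : (g : ℂ) = ((g : ℂ) - g') - (z - g') + z := by ring
    rw [mem_ofPred_eq, h3]
    refine (norm_add_le _ _).trans ?_
    have := norm_sub_le ((g : ℂ) - g') (z - g')
    linarith
  have hmem : ∀ g, g ∈ hfin.toFinset ↔ ∃ z : ℂ, (δ : ℂ) * z ∈ K ∧ ∃ g', SameBrick g g' ∧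
      ‖z - g'‖ < 2 := fun g => by rw [Set.Finite.mem_toFinset]; rfl
  refine ⟨δ, hδ0, hfin.toFinset, ?_, ?_, ?_, ?_⟩
  · intro g g' hgg hg
    rw [hmem] at *
    obtain ⟨z, hz, g'', h1, h2⟩ := hg
    exact ⟨z, hz, g'', ⟨hgg.1.symm.trans h1.1, hgg.2.symm.trans h1.2⟩, h2⟩
  · intro z hz
    rw [mem_interior_iff_mem_nhds]
    refine Filter.mem_of_superset (Metric.ball_mem_nhds z one_pos) fun w hw => ?_
    obtain ⟨g, hg⟩ := exists_mem_sq_round w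
    refine mem_carrier.2 ⟨g, (hmem g).2 ⟨z, hz, g, ⟨rfl, rfl⟩, ?_⟩, hg⟩
    have h1 := norm_sub_le_of_mem_sq hg
    rw [Metric.mem_ball, dist_comm, dist_eq_norm] at hw
    have := norm_add_le (z - w) (w - g)
    rw [sub_add_sub_cancel] at this
    linarith
  · intro w hw
    obtain ⟨g, hg, hwg⟩ := mem_carrier.1 hw
    obtain ⟨z, hz, g', h1, h2⟩ := (hmem g).1 hg
    refine hεΩ (Metric.mem_cthickening_of_dist_le _ _ _ _ hz ?_)
    have h3 := norm_sub_le_of_mem_sq hwg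
    have h4 := h1.norm_sub_le
    have h5 : w - z = (w - g) + ((g : ℂ) - g') - (z - g') := by ring
    have h6 : ‖w - z‖ ≤ 4 := by
      rw [h5]
      have := norm_sub_le ((w - g) + ((g : ℂ) - g')) (z - g')
      have := norm_add_le (w - g) ((g : ℂ) - g')
      linarith
    rw [dist_eq_norm, ← mul_sub, norm_mul, Complex.norm_real, Real.norm_of_nonneg hδ0.le]
    calc δ * ‖w - z‖ ≤ δ * 4 := by gcongr
      _ = ε := by rw [hδ]; ring
  · intro hsymm g hg
    rw [hmem] at *
    obtain ⟨z, hz, g', ⟨h1, h2⟩, h3⟩ := hg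
    refine ⟨(starRingEnd ℂ) z, ?_, star g', ⟨?_, ?_⟩, ?_⟩
    · have := hsymm _ hz
      rwa [map_mul, Complex.conj_ofReal] at this
    · simp [h1]
    · simp only [Zsqrtd.re_star, Zsqrtd.im_star]; omega
    · rw [toComplex_star, ← map_sub, Complex.norm_conj]; exact h3

variable {E : Type*} [NormedAddCommGroup E] [NormedSpace ℂ E] [CompleteSpace E]

/-- Cauchy's theorem: if the curves `γ i`, with the densities `φ i`, lie in the compact set
`K ⊆ Ω` and have total winding number `0` about all points outside `K`, then the integral of a
holomorphic function on `Ω` vanishes. -/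
lemma sum_integral_eq_zero {ι : Type*} [Fintype ι] {Ω K : Set ℂ}
    (hΩ : IsOpen Ω) (hK : IsCompact K) (hKΩ : K ⊆ Ω) {f : ℂ → E}
    (hf : DifferentiableOn ℂ f Ω) {a b : ι → ℝ} (hab : ∀ i, a i ≤ b i) {γ : ι → ℝ → ℂ}
    {φ : ι → ℝ → ℂ} (hγ : ∀ i, ContinuousOn (γ i) (Icc (a i) (b i)))
    (hφ : ∀ i, IntervalIntegrable (φ i) volume (a i) (b i))
    (hγK : ∀ i, ∀ t ∈ Icc (a i) (b i), γ i t ∈ K)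
    (hw : ∀ z ∉ K, ∑ i, ∫ t in a i..b i, φ i t / (γ i t - z) = 0) :
    ∑ i, ∫ t in a i..b i, φ i t • f (γ i t) = 0 := by
  obtain ⟨δ, hδ, S, -, h1, h2, -⟩ := exists_brickwork hK hΩ hKΩ
  have hδ' : (δ : ℂ) ≠ 0 := by exact_mod_cast hδ.ne'
  have hmul : ∀ z : ℂ, (δ : ℂ) * ((δ : ℂ)⁻¹ * z) = z := fun z => by
    rw [← mul_assoc, mul_inv_cancel₀ hδ', one_mul]
  have key := sum_integral_eq_zero_of_carrier (f := fun z => f (δ * z))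
    (Ω := {z : ℂ | (δ : ℂ) * z ∈ Ω}) (γ := fun i t => (δ : ℂ)⁻¹ * γ i t)
    (hΩ.preimage (by fun_prop : Continuous fun z : ℂ => (δ : ℂ) * z)) h2 h1
    (hf.comp (by fun_prop) fun z hz => hz) hab (fun i => continuousOn_const.mul (hγ i)) hφ
    (fun i t ht => by simpa only [mem_ofPred_eq, hmul] using hγK i t ht) (by
      intro z hz
      have := hw _ hz
      have h3 : ∀ i, ∫ t in a i..b i, φ i t / ((δ : ℂ)⁻¹ * γ i t - z) =
          δ * ∫ t in a i..b i, φ i t / (γ i t - δ * z) := by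
        intro i
        rw [← intervalIntegral.integral_const_mul]
        refine intervalIntegral.integral_congr fun t _ => ?_
        have : (δ : ℂ)⁻¹ * γ i t - z = (δ : ℂ)⁻¹ * (γ i t - δ * z) := by
          field_simp
        simp only [this]
        rw [div_mul_eq_div_div_swap, div_inv_eq_mul, mul_comm]
      simp only [h3]
      rw [← Finset.mul_sum, this, mul_zero])
  simpa only [hmul] using key

end Covering

/-! ### Cycles around unbounded open sets -/

/-- `∫_Γ Φ(z) dz`. -/
def cInt {E : Type*} [NormedAddCommGroup E] [NormedSpace ℂ E] {m : ℕ} (Γ : Fin m → ℝ → ℂ)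
    (Φ : ℂ → E) : E := ∑ ℓ, ∫ t in (0 : ℝ)..1, deriv (Γ ℓ) t • Φ (Γ ℓ t)

/-- The properties of the positively oriented boundary `Γ` of the unbounded open set `W` that enter
into Cauchy's theorem. -/
structure IsCycleAround (W : Set ℂ) {m : ℕ} (Γ : Fin m → ℝ → ℂ) : Prop where
  continuousOn : ∀ ℓ, ContinuousOn (Γ ℓ) (Icc 0 1)
  integrable : ∀ ℓ, IntervalIntegrable (deriv (Γ ℓ)) volume 0 1
  mem_frontier : ∀ ℓ, ∀ t ∈ Icc (0 : ℝ) 1, Γ ℓ t ∈ frontier W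
  inside : ∀ z ∈ W, ∑ ℓ, windingNumber (Γ ℓ) z = 0
  outside : ∀ z ∉ closure W, ∑ ℓ, windingNumber (Γ ℓ) z = -1

/-- The derivative of a piecewise `C¹` curve is integrable although it may not exist at the nodes.
-/
lemma IsPiecewiseC1Jordan.continuousOn_and_integrable {γ : ℝ → ℂ} (h : IsPiecewiseC1Jordan γ) :
    ContinuousOn γ (Icc 0 1) ∧ IntervalIntegrable (deriv γ) volume 0 1 := by
  obtain ⟨-, -, k, t, ht, h0, h1, hd⟩ := h
  suffices H : ∀ j : Fin (k + 1), ContinuousOn γ (Icc 0 (t j)) ∧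
      IntervalIntegrable (deriv γ) volume 0 (t j) by simpa [h1] using H (Fin.last k)
  intro j
  induction j using Fin.induction with
  | zero => simp [h0]
  | succ j ih =>
    have hlt : t j.castSucc < t j.succ := ht Fin.castSucc_lt_succ
    have h0j : 0 ≤ t j.castSucc := h0 ▸ ht.monotone (Fin.zero_le _)
    refine ⟨?_, ih.2.trans ?_⟩
    · rw [← Icc_union_Icc_eq_Icc h0j hlt.le]
      exact ih.1.union_of_isClosed (hd j).continuousOn isClosed_Icc isClosed_Icc
    · have hc : IntervalIntegrable (derivWithin γ (Icc (t j.castSucc) (t j.succ))) volume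
          (t j.castSucc) (t j.succ) := by
        refine ContinuousOn.intervalIntegrable ?_
        rw [uIcc_of_le hlt.le]
        exact (hd j).continuousOn_derivWithin (uniqueDiffOn_Icc hlt) le_rfl
      refine (intervalIntegrable_congr_uIoo ?_).1 hc
      rw [uIoo_of_le hlt.le]
      exact fun x hx => derivWithin_of_mem_nhds (Icc_mem_nhds hx.1 hx.2)

lemma IsOrientedBoundary.isCycleAround {W : Set ℂ} {m : ℕ} {Γ : Fin m → ℝ → ℂ}
    (h : IsOrientedBoundary W Γ) : IsCycleAround W Γ where
  continuousOn ℓ := (h.jordan ℓ).continuousOn_and_integrable.1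
  integrable ℓ := (h.jordan ℓ).continuousOn_and_integrable.2
  mem_frontier ℓ t ht := by
    rw [h.frontier_eq]; exact mem_iUnion.2 ⟨ℓ, t, ht, rfl⟩
  inside := h.winding_inside
  outside := h.winding_outside

section Cycle

variable {E : Type*} [NormedAddCommGroup E] [NormedSpace ℂ E]
variable {W : Set ℂ} {m : ℕ} {Γ : Fin m → ℝ → ℂ}

lemma sum_integral_div_eq (Γ : Fin m → ℝ → ℂ) (z : ℂ) :
    ∑ ℓ, ∫ t in (0 : ℝ)..1, deriv (Γ ℓ) t / (Γ ℓ t - z) =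
      2 * Real.pi * I * ∑ ℓ, windingNumber (Γ ℓ) z := by
  rw [Finset.mul_sum]
  refine Finset.sum_congr rfl fun ℓ _ => ?_
  rw [windingNumber, ← mul_assoc, mul_inv_cancel₀ two_pi_I_ne_zero, one_mul]

lemma IsCycleAround.notMem (h : IsCycleAround W Γ) (hW : IsOpen W) {ℓ : Fin m} {t : ℝ}
    (ht : t ∈ Icc (0 : ℝ) 1) : Γ ℓ t ∉ W := by
  have := h.mem_frontier ℓ t ht
  rw [hW.frontier_eq] at this
  exact this.2

lemma IsCycleAround.mem_closure (h : IsCycleAround W Γ) {ℓ : Fin m} {t : ℝ}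
    (ht : t ∈ Icc (0 : ℝ) 1) : Γ ℓ t ∈ closure W :=
  frontier_subset_closure (h.mem_frontier ℓ t ht)

lemma IsCycleAround.intervalIntegrable (h : IsCycleAround W Γ) {Φ : ℂ → E} {s : Set ℂ}
    (hs : frontier W ⊆ s) (hΦ : ContinuousOn Φ s) (ℓ : Fin m) :
    IntervalIntegrable (fun t => deriv (Γ ℓ) t • Φ (Γ ℓ t)) volume 0 1 :=
  intervalIntegrable_smul_continuousOn zero_le_one (h.integrable ℓ)
    (hΦ.comp (h.continuousOn ℓ) fun t ht => hs (h.mem_frontier ℓ t ht))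

variable [CompleteSpace E]

/-- Two cycles around unbounded open sets `W₁` and `W₂` are homologous in every open set that
contains `closure W₁ ∪ closure W₂` outside `W₁ ∩ W₂`. -/
lemma cInt_eq_cInt {W₁ W₂ : Set ℂ} {m₁ m₂ : ℕ} {Γ₁ : Fin m₁ → ℝ → ℂ} {Γ₂ : Fin m₂ → ℝ → ℂ}
    (h₁ : IsCycleAround W₁ Γ₁) (h₂ : IsCycleAround W₂ Γ₂) (hW₁ : IsOpen W₁) (hW₂ : IsOpen W₂)
    (hb₁ : Bornology.IsBounded W₁ᶜ) (hb₂ : Bornology.IsBounded W₂ᶜ) {Ω : Set ℂ} (hΩ : IsOpen Ω)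
    (hsub : ∀ z ∈ closure W₁ ∪ closure W₂, z ∉ W₁ ∩ W₂ → z ∈ Ω)
    {f : ℂ → E} (hf : DifferentiableOn ℂ f Ω) : cInt Γ₁ f = cInt Γ₂ f := by
  set K := (closure W₁ ∪ closure W₂) ∩ (W₁ ∩ W₂)ᶜ with hK
  have hKc : IsCompact K := by
    refine Metric.isCompact_of_isClosed_isBounded
      ((isClosed_closure.union isClosed_closure).inter (hW₁.inter hW₂).isClosed_compl) ?_
    refine (hb₁.union hb₂).subset fun z hz => ?_
    rw [← compl_inter]; exact hz.2
  have key := sum_integral_eq_zero (ι := Fin m₁ ⊕ Fin m₂) hΩ hKc (fun z hz => hsub z hz.1 hz.2) hf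
    (a := fun _ => 0) (b := fun _ => 1) (fun _ => zero_le_one) (γ := Sum.elim Γ₁ Γ₂)
    (φ := Sum.elim (fun ℓ => deriv (Γ₁ ℓ)) fun ℓ t => -deriv (Γ₂ ℓ) t)
    (by rintro (ℓ | ℓ); exacts [h₁.continuousOn ℓ, h₂.continuousOn ℓ])
    (by rintro (ℓ | ℓ); exacts [h₁.integrable ℓ, (h₂.integrable ℓ).neg])
    (by
      rintro (ℓ | ℓ) t ht
      · exact ⟨Or.inl (h₁.mem_closure ht), fun h => h₁.notMem hW₁ ht h.1⟩
      · exact ⟨Or.inr (h₂.mem_closure ht), fun h => h₂.notMem hW₂ ht h.2⟩)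
    (by
      intro z hz
      simp only [Fintype.sum_sum_type, Sum.elim_inl, Sum.elim_inr, neg_div,
        intervalIntegral.integral_neg, Finset.sum_neg_distrib, sum_integral_div_eq]
      have : z ∉ closure W₁ ∪ closure W₂ ∨ z ∈ W₁ ∩ W₂ := by
        by_contra! hcon
        exact hz hcon
      rcases this with h | h
      · rw [h₁.outside z fun h' => h (Or.inl h'), h₂.outside z fun h' => h (Or.inr h')]; ring
      · rw [h₁.inside z h.1, h₂.inside z h.2]; ring)
  simp only [Fintype.sum_sum_type, Sum.elim_inl, Sum.elim_inr, neg_smul,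
    intervalIntegral.integral_neg, Finset.sum_neg_distrib] at key
  exact add_neg_eq_zero.1 key

/-- The cycle `Γ`, together with a large circle, is the boundary of a bounded region. -/
lemma cInt_add_circleIntegral (h : IsCycleAround W Γ) (hW : IsOpen W) {r : ℝ} (hr : 0 < r)
    (hb : Wᶜ ⊆ Metric.ball 0 r) {Ω : Set ℂ} (hΩ : IsOpen Ω) (hsub : closure W ⊆ Ω) {f : ℂ → E}
    (hf : DifferentiableOn ℂ f Ω) : cInt Γ f + ∮ z in C(0, r), f z = 0 := by
  set K := closure W ∩ Metric.closedBall 0 r with hK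
  have hKc : IsCompact K := (isCompact_closedBall (0 : ℂ) r).inter_left isClosed_closure
  have hbW : ∀ z : ℂ, z ∉ Metric.ball 0 r → z ∈ W := fun z hz => by
    by_contra h'; exact hz (hb h')
  have key := sum_integral_eq_zero (ι := Fin m ⊕ Unit) hΩ hKc (fun z hz => hsub hz.1) hf
    (a := fun _ => 0) (b := Sum.elim (fun _ => 1) fun _ => 2 * Real.pi)
    (by rintro (ℓ | ℓ); exacts [zero_le_one, by simp; positivity])
    (γ := Sum.elim Γ fun _ => circleMap 0 r)
    (φ := Sum.elim (fun ℓ => deriv (Γ ℓ)) fun _ => deriv (circleMap 0 r))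
    (by rintro (ℓ | ℓ); exacts [h.continuousOn ℓ, (continuous_circleMap 0 r).continuousOn])
    (by
      rintro (ℓ | ℓ)
      · exact h.integrable ℓ
      · refine Continuous.intervalIntegrable ?_ _ _
        simp only [Sum.elim_inr]
        rw [show deriv (circleMap 0 r) = fun θ => circleMap 0 r θ * I from
          funext fun θ => deriv_circleMap 0 r θ]
        fun_prop)
    (by
      rintro (ℓ | ℓ) t ht
      · refine ⟨h.mem_closure ht, Metric.ball_subset_closedBall (hb (h.notMem hW ht))⟩
      · have : circleMap 0 r t ∈ Metric.sphere (0 : ℂ) r := circleMap_mem_sphere 0 hr.le t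
        refine ⟨subset_closure (hbW _ ?_), Metric.sphere_subset_closedBall this⟩
        simp only [Sum.elim_inr, Metric.mem_ball, not_lt]
        exact (Metric.mem_sphere.1 this).ge)
    (by
      intro z hz
      have hcirc : ∫ t in (0 : ℝ)..2 * Real.pi, deriv (circleMap 0 r) t / (circleMap 0 r t - z) =
          ∮ w in C(0, r), (w - z)⁻¹ := by
        simp only [circleIntegral, div_eq_mul_inv, smul_eq_mul]
      simp only [Fintype.sum_sum_type, Sum.elim_inl, Sum.elim_inr, sum_integral_div_eq,
        Finset.univ_unique, Finset.sum_singleton, hcirc]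
      have : z ∉ closure W ∨ z ∉ Metric.closedBall 0 r := by
        by_contra! hcon
        exact hz hcon
      rcases this with h' | h'
      · have hzb : z ∈ Metric.ball (0 : ℂ) r := hb fun h'' => h' (subset_closure h'')
        rw [h.outside z h', circleIntegral.integral_sub_inv_of_mem_ball hzb]; ring
      · have hzW : z ∈ W := hbW z fun h'' => h' (Metric.ball_subset_closedBall h'')
        rw [h.inside z hzW, mul_zero, zero_add]
        have hd : ∀ w ∈ Metric.closedBall (0 : ℂ) r, w - z ≠ 0 := fun w hw h0 =>
          h' (by rwa [← sub_eq_zero.1 h0])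
        refine circleIntegral_eq_zero_of_differentiable_on_off_countable hr.le countable_empty ?_ ?_
        · exact ContinuousOn.inv₀ (by fun_prop) hd
        · intro w hw
          exact DifferentiableAt.inv (by fun_prop) (hd w (Metric.ball_subset_closedBall hw.1)))
  simpa only [Fintype.sum_sum_type, Sum.elim_inl, Sum.elim_inr, Finset.univ_unique,
    Finset.sum_singleton, cInt, circleIntegral] using key

lemma tendsto_circleIntegral_cauchy {g : ℂ → E} {r₀ : ℝ} (hg : ∀ r, r₀ ≤ r →
    ContinuousOn g (Metric.sphere 0 r)) {g₀ : E}
    (hlim : Tendsto g (Bornology.cobounded ℂ) (𝓝 g₀)) (z : ℂ) :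
    Tendsto (fun r : ℝ => ∮ w in C(0, r), (w - z)⁻¹ • g w) atTop (𝓝 ((2 * Real.pi * I) • g₀)) := by
  rw [Metric.tendsto_atTop]
  intro ε hε
  have hε' : 0 < ε / (8 * Real.pi) := by positivity
  have h1 := (Metric.tendsto_nhds.1 hlim) _ hε'
  rw [← comap_norm_atTop, eventually_comap,
    eventually_atTop] at h1
  obtain ⟨R, hR⟩ := h1
  refine ⟨max (max R r₀) (2 * ‖z‖ + 1), fun r hr => ?_⟩
  have hrR : R ≤ r := (le_max_left _ _).trans ((le_max_left _ _).trans hr)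
  have hrr : r₀ ≤ r := (le_max_right _ _).trans ((le_max_left _ _).trans hr)
  have hrz : 2 * ‖z‖ + 1 ≤ r := (le_max_right _ _).trans hr
  have hr0 : 0 < r := by linarith [norm_nonneg z]
  have hne : ∀ w ∈ Metric.sphere (0 : ℂ) r, w - z ≠ 0 := fun w hw h0 => by
    rw [sub_eq_zero.1 h0, mem_sphere_zero_iff_norm] at hw
    linarith [norm_nonneg z]
  have hinv : ContinuousOn (fun w : ℂ => (w - z)⁻¹) (Metric.sphere 0 r) :=
    ContinuousOn.inv₀ (by fun_prop) hne
  have hzb : z ∈ Metric.ball (0 : ℂ) r := by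
    rw [mem_ball_zero_iff]; linarith [norm_nonneg z]
  have e1 : (∮ w in C(0, r), (w - z)⁻¹ • g w) - (2 * Real.pi * I) • g₀ =
      ∮ w in C(0, r), (w - z)⁻¹ • (g w - g₀) := by
    rw [← circleIntegral.integral_sub_inv_of_mem_ball hzb,
      ← circleIntegral.integral_smul_const, ← circleIntegral.integral_sub]
    · simp only [smul_sub]
    · exact (hinv.smul (hg r hrr)).circleIntegrable hr0.le
    · exact (hinv.smul continuousOn_const).circleIntegrable hr0.le
  rw [dist_eq_norm, e1]
  refine (circleIntegral.norm_integral_le_of_norm_le_const hr0.le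
    (C := (2 / r) * (ε / (8 * Real.pi))) fun w hw => ?_).trans_lt ?_
  · rw [norm_smul, norm_inv]
    rw [mem_sphere_zero_iff_norm] at hw
    have h2 := hR r hrR w hw
    rw [dist_eq_norm] at h2
    refine mul_le_mul ?_ h2.le (norm_nonneg _) (by positivity)
    rw [← inv_div]
    refine inv_anti₀ (by positivity) ?_
    have := norm_sub_norm_le w z
    linarith
  · have : 2 * Real.pi * r * (2 / r * (ε / (8 * Real.pi))) = ε / 2 := by
      field_simp; norm_num
    rw [this]; linarith

variable (h : IsCycleAround W Γ) (hW : IsOpen W) (hb : Bornology.IsBounded Wᶜ)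
include h hW hb

/-- Cauchy's integral formula for an unbounded domain, at a point of the exterior. The value comes
from the large circle. -/
lemma cInt_cauchy_of_notMem {D : Set ℂ} (hD : IsOpen D) (hsub : closure W ⊆ D) {g : ℂ → E}
    (hg : DifferentiableOn ℂ g D) {g₀ : E} (hlim : Tendsto g (Bornology.cobounded ℂ) (𝓝 g₀))
    {z : ℂ} (hz : z ∉ closure W) :
    cInt Γ (fun w => (w - z)⁻¹ • g w) = -((2 * Real.pi * I) • g₀) := by
  obtain ⟨r₀, hr₀, hbr⟩ := hb.subset_ball_lt 0 0
  have h1 := tendsto_circleIntegral_cauchy (r₀ := r₀) (g := g) (fun r hr => by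
    refine hg.continuousOn.mono fun w hw => hsub (subset_closure ?_)
    by_contra hw'
    have := hbr hw'
    rw [mem_ball_zero_iff] at this
    rw [mem_sphere_zero_iff_norm] at hw
    linarith) hlim z
  have h2 : ∀ᶠ r in atTop, (∮ w in C(0, r), (w - z)⁻¹ • g w) =
      -cInt Γ (fun w => (w - z)⁻¹ • g w) := by
    filter_upwards [eventually_ge_atTop r₀] with r hr
    have := cInt_add_circleIntegral h hW (hr₀.trans_le hr)
      (hbr.trans (Metric.ball_subset_ball hr)) (Ω := D \ {z}) (hD.sdiff isClosed_singleton)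
      (fun w hw => ⟨hsub hw, fun h' => hz (by rwa [← mem_singleton_iff.1 h'])⟩)
      (f := fun w => (w - z)⁻¹ • g w) (by
        refine DifferentiableOn.smul (DifferentiableOn.inv (by fun_prop) ?_)
          (hg.mono sdiff_subset)
        exact fun w hw h0 => hw.2 (sub_eq_zero.1 h0))
    rw [eq_neg_iff_add_eq_zero, add_comm]; exact this
  have h3 := tendsto_nhds_unique (h1.congr' h2) tendsto_const_nhds
  rw [h3, neg_neg]

/-- Cauchy's integral formula for an unbounded domain, at a point of the domain. -/
lemma cInt_cauchy_of_mem {D : Set ℂ} (hD : IsOpen D) (hsub : closure W ⊆ D) {g : ℂ → E}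
    (hg : DifferentiableOn ℂ g D) {g₀ : E} (hlim : Tendsto g (Bornology.cobounded ℂ) (𝓝 g₀))
    {z : ℂ} (hz : z ∈ W) :
    cInt Γ (fun w => (w - z)⁻¹ • g w) = (2 * Real.pi * I) • (g z - g₀) := by
  obtain ⟨r₀, hr₀, hbr⟩ := hb.subset_ball_lt 0 0
  have hgs : ∀ r, r₀ ≤ r → ContinuousOn g (Metric.sphere 0 r) := fun r hr => by
    refine hg.continuousOn.mono fun w hw => hsub (subset_closure ?_)
    by_contra hw'
    have := hbr hw'
    rw [mem_ball_zero_iff] at this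
    rw [mem_sphere_zero_iff_norm] at hw
    linarith
  have h1 := tendsto_circleIntegral_cauchy (r₀ := r₀) (g := g) hgs hlim z
  have hne : ∀ w ∈ frontier W, w ≠ z := fun w hw h0 => by
    rw [hW.frontier_eq] at hw
    exact hw.2 (h0 ▸ hz)
  have hinv : ContinuousOn (fun w : ℂ => (w - z)⁻¹) (frontier W) :=
    ContinuousOn.inv₀ (by fun_prop) fun w hw => sub_ne_zero.2 (hne w hw)
  have hgf : ContinuousOn g (frontier W) :=
    hg.continuousOn.mono (frontier_subset_closure.trans hsub)
  have e1 : cInt Γ (dslope g z) = cInt Γ (fun w => (w - z)⁻¹ • g w) := by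
    have : cInt Γ (dslope g z) = cInt Γ (fun w => (w - z)⁻¹ • g w) -
        (∑ ℓ, ∫ t in (0 : ℝ)..1, deriv (Γ ℓ) t / (Γ ℓ t - z)) • g z := by
      rw [cInt, cInt, Finset.sum_smul, ← Finset.sum_sub_distrib]
      refine Finset.sum_congr rfl fun ℓ _ => ?_
      rw [← intervalIntegral.integral_smul_const, ← intervalIntegral.integral_sub]
      · refine intervalIntegral.integral_congr fun t ht => ?_
        rw [uIcc_of_le zero_le_one] at ht
        simp only [dslope_of_ne g (hne _ (h.mem_frontier ℓ t ht)), slope_def_module, smul_sub,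
          smul_smul, div_eq_mul_inv]
      · exact h.intervalIntegrable subset_rfl (hinv.smul hgf) ℓ
      · have := h.intervalIntegrable subset_rfl (hinv.smul (continuousOn_const (c := g z))) ℓ
        simpa only [smul_smul, div_eq_mul_inv, Pi.smul_apply'] using this
    rw [this, sum_integral_div_eq, h.inside z hz, mul_zero, zero_smul, sub_zero]
  have h2 : ∀ᶠ r in atTop, (∮ w in C(0, r), (w - z)⁻¹ • g w) =
      (2 * Real.pi * I) • g z - cInt Γ (fun w => (w - z)⁻¹ • g w) := by
    filter_upwards [eventually_ge_atTop r₀, eventually_gt_atTop ‖z‖] with r hr hrz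
    have hr0 := hr₀.trans_le hr
    have := cInt_add_circleIntegral h hW hr0
      (hbr.trans (Metric.ball_subset_ball hr)) hD hsub
      ((Complex.differentiableOn_dslope (hD.mem_nhds (hsub (subset_closure hz)))).2 hg)
    have hzb : z ∈ Metric.ball (0 : ℂ) r := by rwa [mem_ball_zero_iff]
    have hne' : ∀ w ∈ Metric.sphere (0 : ℂ) r, w ≠ z := fun w hw h0 => by
      rw [h0, mem_sphere_zero_iff_norm] at hw
      linarith
    have hinv' : ContinuousOn (fun w : ℂ => (w - z)⁻¹) (Metric.sphere 0 r) :=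
      ContinuousOn.inv₀ (by fun_prop) fun w hw => sub_ne_zero.2 (hne' w hw)
    have e2 : ∮ w in C(0, r), dslope g z w =
        (∮ w in C(0, r), (w - z)⁻¹ • g w) - (2 * Real.pi * I) • g z := by
      rw [← circleIntegral.integral_sub_inv_of_mem_ball hzb,
        ← circleIntegral.integral_smul_const, ← circleIntegral.integral_sub]
      · refine circleIntegral.integral_congr hr0.le fun w hw => ?_
        simp only [dslope_of_ne g (hne' w hw), slope_def_module, smul_sub]
      · exact (hinv'.smul (hgs r hr)).circleIntegrable hr0.le
      · exact (hinv'.smul continuousOn_const).circleIntegrable hr0.le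
    rw [e1, e2] at this
    rw [← sub_eq_zero, ← this]
    abel
  have h3 := tendsto_nhds_unique (h1.congr' h2) tendsto_const_nhds
  rw [smul_sub, h3, sub_sub_cancel]

end Cycle

/-! ### Boundary polygons of a union of squares -/

section Boundary

open GaussianInt

lemma coe_star_mul_self {d : GaussianInt} (hd : d ∈ dirs) : star d * d = 1 := by
  rw [mem_dirs] at hd
  rcases hd with rfl | rfl | rfl | rfl <;> decide

lemma dirs_ne_zero {d : GaussianInt} (hd : d ∈ dirs) : (d : ℂ) ≠ 0 := by
  rw [mem_dirs] at hd
  rcases hd with rfl | rfl | rfl | rfl <;> simp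

lemma star_mem_dirs {d : GaussianInt} (hd : d ∈ dirs) : star d ∈ dirs := by
  rw [mem_dirs] at *
  rcases hd with rfl | rfl | rfl | rfl <;> decide

lemma mul_mem_dirs {d d' : GaussianInt} (hd : d ∈ dirs) (hd' : d' ∈ dirs) : d * d' ∈ dirs := by
  rw [mem_dirs] at *
  rcases hd with rfl | rfl | rfl | rfl <;> rcases hd' with rfl | rfl | rfl | rfl <;> decide

/-- Four squares around a vertex of a brickwork are not coloured like a checkerboard. -/
lemma IsBrickwork.no_checkerboard {S : Finset GaussianInt} (hS : IsBrickwork S)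
    {g d : GaussianInt} (hd : d ∈ dirs) (h1 : g ∈ S) (h2 : g + d + gI * d ∈ S) (h3 : g + d ∉ S)
    (h4 : g + gI * d ∉ S) : False := by
  have hodd : ∀ a b : GaussianInt, a.im = b.im → (a.re = b.re + 1 ∨ b.re = a.re + 1) →
      ∀ a' b' : GaussianInt, a'.im = b'.im → (a'.re = a.re ∧ b'.re = b.re) →
      (a'.im = a.im + 1 ∨ a.im = a'.im + 1) → SameBrick a b ∨ SameBrick a' b' := by
    intro a b h1 h2 a' b' h3 h4 h5
    unfold SameBrick
    omega
  rw [mem_dirs] at hd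
  rcases hd with rfl | rfl | rfl | rfl
  · rcases hodd g (g + 1) (by simp) (by simp) (g + gI * 1) (g + 1 + gI * 1) (by simp) (by simp [gI])
      (by simp [gI]) with h | h
    · exact h3 (hS _ _ h h1)
    · exact h4 (hS _ _ ⟨h.1.symm, h.2.symm⟩ h2)
  · rcases hodd g (g + gI * gI) (by simp [gI]) (by simp [gI]) (g + gI) (g + gI + gI * gI)
      (by simp [gI]) (by simp [gI]) (by simp [gI]) with h | h
    · exact h4 (hS _ _ h h1)
    · exact h3 (hS _ _ ⟨h.1.symm, h.2.symm⟩ h2)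
  · rcases hodd g (g + -1) (by simp) (by simp) (g + gI * -1) (g + -1 + gI * -1) (by simp)
      (by simp [gI]) (by simp [gI]) with h | h
    · exact h3 (hS _ _ h h1)
    · exact h4 (hS _ _ ⟨h.1.symm, h.2.symm⟩ h2)
  · rcases hodd g (g + gI * -gI) (by simp [gI]) (by simp [gI]) (g + -gI) (g + -gI + gI * -gI)
      (by simp [gI]) (by simp [gI]) (by simp [gI]) with h | h
    · exact h4 (hS _ _ h h1)
    · exact h3 (hS _ _ ⟨h.1.symm, h.2.symm⟩ h2)

/-- The boundary edge that follows `e`: turn right if possible, otherwise go straight on if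
possible, otherwise turn left. -/
def nextEdge (S : Finset GaussianInt) (e : GaussianInt × GaussianInt) : GaussianInt × GaussianInt :=
  if e.1 + e.2 ∈ S then
    if e.1 + e.2 + gI * e.2 ∈ S then (e.1 + e.2 + gI * e.2, gI * e.2) else (e.1 + e.2, e.2)
  else (e.1, -(gI * e.2))

lemma gI_mul_gI_mul (d : GaussianInt) : gI * (gI * d) = -d := by
  rw [← mul_assoc, gI_mul_gI, neg_one_mul]

lemma nextEdge_mem {S : Finset GaussianInt} {e : GaussianInt × GaussianInt} (he : e ∈ bdry S) :
    nextEdge S e ∈ bdry S := by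
  obtain ⟨h1, h2, h3⟩ := mem_bdry.1 he
  unfold nextEdge
  split_ifs with h h'
  · refine mem_bdry.2 ⟨h', gI_mul_mem_dirs h2, ?_⟩
    simp only [gI_mul_gI_mul]
    rwa [add_right_comm, add_neg_cancel_right]
  · exact mem_bdry.2 ⟨h, h2, h'⟩
  · refine mem_bdry.2 ⟨h1, neg_mem_dirs (gI_mul_mem_dirs h2), ?_⟩
    simpa only [mul_neg, gI_mul_gI_mul, neg_neg] using h

lemma gI_mul_injective {d d' : GaussianInt} (h : gI * d = gI * d') : d = d' := by
  have := congrArg (gI * ·) h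
  simpa only [gI_mul_gI_mul, neg_inj] using this

/-- The edges that arrive at a vertex have different successors: this holds even at a vertex with a
checkerboard pattern, where both arriving edges turn right. -/
lemma nextEdge_injOn (S : Finset GaussianInt) : InjOn (nextEdge S) (bdry S : Set _) := by
  have key : ∀ e ∈ bdry S, ∀ e' ∈ bdry S, nextEdge S e = nextEdge S e' →
      (e.1 + e.2 ∉ S → e = e') ∧ (e.1 + e.2 + gI * e.2 ∉ S → e'.1 + e'.2 ∈ S → e = e') ∧
      (e.1 + e.2 ∈ S → e.1 + e.2 + gI * e.2 ∈ S → e'.1 + e'.2 ∈ S →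
        e'.1 + e'.2 + gI * e'.2 ∈ S → e = e') := by
    rintro ⟨g, d⟩ he ⟨g', d'⟩ he' h
    obtain ⟨h1, -, h3⟩ := mem_bdry.1 he
    obtain ⟨h1', -, h3'⟩ := mem_bdry.1 he'
    simp only [nextEdge] at h h1 h3 h1' h3' ⊢
    refine ⟨fun hR => ?_, fun hSt hR' => ?_, fun hR hL hR' hL' => ?_⟩
    · rw [if_neg hR] at h
      split_ifs at h with hR' hS' <;> rw [Prod.mk.injEq] at h
      · refine absurd ?_ h3
        rw [h.1, ← neg_neg (gI * d), h.2, add_neg_cancel_right]; exact hR'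
      · refine absurd ?_ h3
        rw [h.1, ← neg_neg (gI * d), h.2, add_neg_cancel_right]; exact h1'
      · rw [neg_inj] at h
        rw [h.1, gI_mul_injective h.2]
    · by_cases hR : g + d ∈ S
      · rw [if_pos hR, if_neg hSt, if_pos hR'] at h
        split_ifs at h with hS' <;> rw [Prod.mk.injEq] at h
        · obtain ⟨ha, rfl⟩ := h
          rw [add_left_inj] at ha
          refine absurd ?_ h3
          rw [ha, gI_mul_gI_mul, add_neg_cancel_right]; exact h1'
        · obtain ⟨ha, rfl⟩ := h
          rw [add_right_cancel ha]
      · rw [if_neg hR, if_pos hR'] at h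
        split_ifs at h with hS' <;> rw [Prod.mk.injEq] at h
        · refine absurd ?_ h3
          rw [h.1, ← neg_neg (gI * d), h.2, add_neg_cancel_right]; exact hR'
        · refine absurd ?_ h3
          rw [h.1, ← neg_neg (gI * d), h.2, add_neg_cancel_right]; exact h1'
    · rw [if_pos hR, if_pos hL, if_pos hR', if_pos hL', Prod.mk.injEq] at h
      obtain ⟨ha, hb⟩ := h
      obtain rfl := gI_mul_injective hb
      rw [add_left_inj, add_left_inj] at ha
      rw [ha]
  intro e he e' he' h
  have k1 := key e he e' he' h
  have k2 := key e' he' e he h.symm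
  by_cases a1 : e.1 + e.2 ∈ S
  swap
  · exact k1.1 a1
  by_cases a2 : e'.1 + e'.2 ∈ S
  swap
  · exact (k2.1 a2).symm
  by_cases a3 : e.1 + e.2 + gI * e.2 ∈ S
  swap
  · exact k1.2.1 a3 a2
  by_cases a4 : e'.1 + e'.2 + gI * e'.2 ∈ S
  swap
  · exact (k2.2.1 a4 a1).symm
  exact k1.2.2 a1 a3 a2 a4

lemma edgePt_nextEdge (S : Finset GaussianInt) (e : GaussianInt × GaussianInt) :
    edgePt (nextEdge S e) 0 = edgePt e 1 := by
  unfold nextEdge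
  split_ifs <;> simp only [edgePt, toComplex_add, toComplex_mul, coe_gI, toComplex_neg] <;>
    push_cast
  · linear_combination ((e.2 : ℂ) / 2) * I_sq
  · ring
  · linear_combination (-(e.2 : ℂ) / 2) * I_sq

/-- The half-open boundary edges of a brickwork are pairwise disjoint. -/
lemma edgePt_inj {S : Finset GaussianInt} (hS : IsBrickwork S) {e e' : GaussianInt × GaussianInt}
    (he : e ∈ bdry S) (he' : e' ∈ bdry S) {t t' : ℝ} (ht : t ∈ Ico (0 : ℝ) 1)
    (ht' : t' ∈ Ico (0 : ℝ) 1) (h : edgePt e t = edgePt e' t') : e = e' ∧ t = t' := by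
  obtain ⟨g, d⟩ := e
  obtain ⟨g', d'⟩ := e'
  obtain ⟨h1, h2, h3⟩ := mem_bdry.1 he
  obtain ⟨h1', h2', h3'⟩ := mem_bdry.1 he'
  simp only at h1 h2 h3 h1' h2' h3'
  obtain ⟨t0, t1⟩ := ht
  obtain ⟨t0', t1'⟩ := ht'
  have hsd := coe_star_mul_self h2
  -- rotate so that the first edge has direction `1`, and translate its square to the origin
  set u := star d * d' with hu
  set k := star d * (g' - g) with hk
  have hd' : d' = d * u := by rw [hu, ← mul_assoc, mul_comm d, hsd, one_mul]
  have hg' : g' = g + d * k := by rw [hk, ← mul_assoc, mul_comm d, hsd, one_mul]; ring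
  have hkc : (k : ℂ) = (I - 1) / 2 * (1 - u) + t - t' * u := by
    have hsd' : ((star d : GaussianInt) : ℂ) * d = 1 := by
      rw [← toComplex_mul, hsd, toComplex_one]
    have e1 : (u : ℂ) = (star d : GaussianInt) * d' := by rw [hu, toComplex_mul]
    have e2 : (k : ℂ) = (star d : GaussianInt) * (g' - g) := by
      rw [hk, toComplex_mul, toComplex_sub]
    simp only [edgePt] at h
    rw [e1, e2]
    linear_combination (-((star d : GaussianInt) : ℂ)) * h + ((I - 1) / 2 + t) * hsd'
  have hre := congrArg Complex.re hkc
  have him := congrArg Complex.im hkc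
  have hudirs : u ∈ dirs := mul_mem_dirs (star_mem_dirs h2) h2'
  rw [mem_dirs] at hudirs
  rcases hudirs with hu1 | hu1 | hu1 | hu1 <;> rw [hu1] at hre him hd' <;> simp at hre him <;>
    rw [← GaussianInt.intCast_re] at hre <;> rw [← GaussianInt.intCast_im] at him
  · -- same direction
    have k1 : (k.re : ℝ) < 1 := by linarith
    have k2 : (-1 : ℝ) < k.re := by linarith
    have k1 : k.re < 1 := by exact_mod_cast k1
    have k2 : -1 < k.re := by exact_mod_cast k2
    have k3 : k = 0 := by
      ext
      · simp; omega
      · exact_mod_cast him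
    rw [k3] at hre hg'
    simp at hre hg' hd'
    exact ⟨by rw [hg', hd'], by linarith⟩
  · have k1 : (k.re : ℝ) < 1 := by linarith
    have k2 : (-1 : ℝ) < k.re := by linarith
    have k1 : k.re < 1 := by exact_mod_cast k1
    have k2 : -1 < k.re := by exact_mod_cast k2
    have k4 : (k.im : ℝ) ≤ 1 := by linarith
    have k5 : (0 : ℝ) < k.im := by linarith
    have k4 : k.im ≤ 1 := by exact_mod_cast k4
    have k5 : 0 < k.im := by exact_mod_cast k5
    have k3 : k = gI := by
      ext <;> simp [gI] <;> omega
    rw [k3, mul_comm] at hg'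
    exact absurd (hg' ▸ h1') h3
  · have k4 : k.im = 1 := by
      have : (k.im : ℝ) = 1 := by linarith
      exact_mod_cast this
    have k1 : (k.re : ℝ) < 1 := by linarith
    have k2 : (-1 : ℝ) ≤ k.re := by linarith
    have k1 : k.re < 1 := by exact_mod_cast k1
    have k2 : -1 ≤ k.re := by exact_mod_cast k2
    rcases (by omega : k.re = 0 ∨ k.re = -1) with k5 | k5
    · have k3 : k = gI := by
        ext <;> simp [gI, k4, k5]
      rw [k3, mul_comm] at hg'
      exact absurd (hg' ▸ h1') h3
    · exfalso
      have k3 : k = gI - 1 := by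
        ext <;> simp [gI, k4, k5]
      have e1 : g' = g + gI * d + gI * (gI * d) := by rw [hg', k3, gI_mul_gI_mul]; ring
      have e2 : g' + gI * d' = g + gI * (gI * d) := by rw [e1, hd']; ring
      exact hS.no_checkerboard (gI_mul_mem_dirs h2) h1 (e1 ▸ h1') h3 (e2 ▸ h3')
  · exfalso
    have k1 : (k.re : ℝ) < 0 := by linarith
    have k2 : (-1 : ℝ) ≤ k.re := by linarith
    have k1 : k.re < 0 := by exact_mod_cast k1
    have k2 : -1 ≤ k.re := by exact_mod_cast k2
    have k4 : (k.im : ℝ) < 1 := by linarith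
    have k5 : (0 : ℝ) ≤ k.im := by linarith
    have k4 : k.im < 1 := by exact_mod_cast k4
    have k5 : 0 ≤ k.im := by exact_mod_cast k5
    have k3 : k = -1 := by
      ext <;> simp <;> omega
    have e2 : g' + gI * d' = g := by
      rw [hg', hd', k3]
      have := gI_mul_gI_mul d
      linear_combination -this
    exact h3' (e2 ▸ h1)

/-- The successor map on the boundary edges. -/
def edgeSucc (S : Finset GaussianInt) (e : bdry S) : bdry S := ⟨nextEdge S e, nextEdge_mem e.2⟩

lemma edgeSucc_injective (S : Finset GaussianInt) : Function.Injective (edgeSucc S) :=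
  fun e e' h => Subtype.ext (nextEdge_injOn S e.2 e'.2 (congrArg Subtype.val h))

/-- The permutation of the boundary edges whose cycles are the boundary curves. -/
def edgePerm (S : Finset GaussianInt) : Equiv.Perm (bdry S) :=
  Equiv.ofBijective (edgeSucc S) (Finite.injective_iff_bijective.1 (edgeSucc_injective S))

lemma edgePt_edgePerm (S : Finset GaussianInt) (e : bdry S) :
    edgePt (edgePerm S e) 0 = edgePt e 1 := edgePt_nextEdge S e

/-- The number of edges of the boundary curve through `e`. -/
def loopLen {S : Finset GaussianInt} (e : bdry S) : ℕ := Function.minimalPeriod (edgePerm S) e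

lemma loopLen_pos {S : Finset GaussianInt} (e : bdry S) : 0 < loopLen e :=
  Function.minimalPeriod_pos_of_mem_periodicPts
    ((edgePerm S).injective.mem_periodicPts e)

/-- The closed polygon that runs through the boundary edges `e, σ e, σ² e, …`. -/
def loop {S : Finset GaussianInt} (e : bdry S) (t : ℝ) : ℂ :=
  edgePt ((edgePerm S)^[⌊loopLen e * t⌋₊] e) (loopLen e * t - ⌊loopLen e * t⌋₊)

lemma loop_eq {S : Finset GaussianInt} (e : bdry S) (j : ℕ) {t : ℝ} (h0 : j ≤ loopLen e * t)
    (h1 : loopLen e * t ≤ j + 1) :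
    loop e t = edgePt ((edgePerm S)^[j] e) (loopLen e * t - j) := by
  rcases h1.lt_or_eq with h1 | h1
  · have : ⌊loopLen e * t⌋₊ = j :=
      (Nat.floor_eq_iff (by linarith [j.cast_nonneg (α := ℝ)])).2 ⟨h0, h1⟩
    rw [loop, this]
  · have : ⌊loopLen e * t⌋₊ = j + 1 := by
      rw [h1]; exact_mod_cast Nat.floor_natCast (R := ℝ) (j + 1)
    rw [loop, this, h1, Function.iterate_succ_apply']
    have := edgePt_edgePerm S ((edgePerm S)^[j] e)
    push_cast
    rw [sub_self, this]
    congr 1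
    ring

lemma loop_zero {S : Finset GaussianInt} (e : bdry S) : loop e 0 = edgePt e 0 := by
  simp [loop]

lemma iterate_loopLen {S : Finset GaussianInt} (e : bdry S) : (edgePerm S)^[loopLen e] e = e :=
  Function.isPeriodicPt_minimalPeriod _ _

lemma loop_one {S : Finset GaussianInt} (e : bdry S) : loop e 1 = edgePt e 0 := by
  rw [loop_eq e (loopLen e) (by simp) (by simp), iterate_loopLen]
  simp

lemma floor_lt_loopLen {S : Finset GaussianInt} (e : bdry S) {t : ℝ} (ht : t ∈ Ico (0 : ℝ) 1) :
    ⌊loopLen e * t⌋₊ < loopLen e := by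
  have hL : (0 : ℝ) < loopLen e := by exact_mod_cast loopLen_pos e
  rw [Nat.floor_lt (mul_nonneg hL.le ht.1)]
  nlinarith [ht.2]

lemma sub_floor_mem {x : ℝ} (hx : 0 ≤ x) : x - ⌊x⌋₊ ∈ Ico (0 : ℝ) 1 :=
  ⟨by linarith [Nat.floor_le hx], by linarith [Nat.lt_floor_add_one x]⟩

/-- The polygon has no double points because the half-open edges of a brickwork are disjoint. -/
lemma loop_injOn {S : Finset GaussianInt} (hS : IsBrickwork S) (e : bdry S) :
    InjOn (loop e) (Ico 0 1) := by
  intro t ht t' ht' h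
  have hL : (0 : ℝ) < loopLen e := by exact_mod_cast loopLen_pos e
  have key := edgePt_inj hS (Subtype.coe_prop _) (Subtype.coe_prop _)
    (sub_floor_mem (mul_nonneg hL.le ht.1)) (sub_floor_mem (mul_nonneg hL.le ht'.1)) h
  have hn := Function.iterate_injOn_Iio_minimalPeriod (f := edgePerm S) (x := e)
    (floor_lt_loopLen e ht) (floor_lt_loopLen e ht') (Subtype.ext key.1)
  have h2 := key.2
  rw [hn, sub_left_inj] at h2
  exact mul_left_cancel₀ hL.ne' h2

lemma hasDerivAt_edgePt (e : GaussianInt × GaussianInt) (t : ℝ) :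
    HasDerivAt (edgePt e) e.2 t := by
  have h1 : HasDerivAt (fun t : ℝ => ((I - 1) / 2 + (t : ℂ))) 1 t :=
    (Complex.ofRealCLM.hasDerivAt (x := t)).const_add _
  have h2 := (h1.mul_const (e.2 : ℂ)).const_add (e.1 : ℂ)
  rw [one_mul] at h2
  exact h2

lemma isPiecewiseC1Jordan_loop {S : Finset GaussianInt} (hS : IsBrickwork S) (e : bdry S) :
    IsPiecewiseC1Jordan (loop e) := by
  have hL : (0 : ℝ) < loopLen e := by exact_mod_cast loopLen_pos e
  refine ⟨by rw [loop_zero, loop_one], loop_injOn hS e, loopLen e,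
    fun j => (j : ℝ) / loopLen e, ?_, by simp, by simp [hL.ne'], fun j => ?_⟩
  · intro i j hij
    have : ((i : ℕ) : ℝ) < (j : ℕ) := by exact_mod_cast hij
    simp only
    gcongr
  · have hcd : ContDiff ℝ 1 (fun t : ℝ =>
        edgePt ((edgePerm S)^[(j : ℕ)] e) (loopLen e * t - (j : ℕ))) := by
      have : ContDiff ℝ 1 (fun t : ℝ => (t : ℂ)) := Complex.ofRealCLM.contDiff
      unfold edgePt
      exact contDiff_const.add ((contDiff_const.add (this.comp
        ((contDiff_const.mul contDiff_id).sub contDiff_const))).mul contDiff_const)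
    refine hcd.contDiffOn.congr fun t ht => ?_
    have h0 := ht.1
    have h1 := ht.2
    simp only at h0 h1
    rw [Fin.val_castSucc, div_le_iff₀ hL, mul_comm] at h0
    rw [Fin.val_succ, le_div_iff₀ hL, mul_comm] at h1
    push_cast at h1
    exact loop_eq e j h0 h1

lemma image_loop {S : Finset GaussianInt} (e : bdry S) :
    loop e '' Icc 0 1 = ⋃ e' ∈ {e' | (edgePerm S).SameCycle e e'}, edgePt e' '' Icc 0 1 := by
  have hL : (0 : ℝ) < loopLen e := by exact_mod_cast loopLen_pos e
  ext x
  simp only [mem_image, mem_iUnion, mem_ofPred_eq, exists_prop]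
  constructor
  · rintro ⟨t, ht, rfl⟩
    refine ⟨(edgePerm S)^[⌊loopLen e * t⌋₊] e, ?_, _,
      Ico_subset_Icc_self (sub_floor_mem (mul_nonneg hL.le ht.1)), rfl⟩
    rw [Equiv.Perm.iterate_eq_pow]
    exact Equiv.Perm.sameCycle_pow_right.2 (Equiv.Perm.SameCycle.refl _ _)
  · rintro ⟨e', ⟨k, hk⟩, u, hu, rfl⟩
    obtain ⟨j, hj, hj'⟩ : ∃ j < loopLen e, (edgePerm S)^[j] e = e' := by
      have hper : Function.IsPeriodicPt (edgePerm S) (loopLen e) e :=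
        Function.isPeriodicPt_minimalPeriod _ _
      obtain ⟨n, hn⟩ : ∃ n : ℕ, ((edgePerm S) ^ n) e = e' :=
        Equiv.Perm.SameCycle.exists_nat_pow_eq ⟨k, hk⟩
      refine ⟨n % loopLen e, Nat.mod_lt _ (loopLen_pos e), ?_⟩
      rw [loopLen, Function.iterate_mod_minimalPeriod_eq, Equiv.Perm.iterate_eq_pow, hn]
    refine ⟨(j + u) / loopLen e, ⟨?_, ?_⟩, ?_⟩
    · have := hu.1; positivity
    · rw [div_le_one hL]
      have : ((j + 1 : ℕ) : ℝ) ≤ loopLen e := by exact_mod_cast hj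
      push_cast at this
      linarith [hu.2]
    · have : (loopLen e : ℝ) * ((j + u) / loopLen e) = j + u := by field_simp
      rw [loop_eq e j (by rw [this]; linarith [hu.1]) (by rw [this]; linarith [hu.2]), this, hj',
        add_sub_cancel_left]

/-- An integral over the polygon is the sum of the integrals over its edges. -/
lemma integral_loop {E : Type*} [NormedAddCommGroup E] [NormedSpace ℂ E] {S : Finset GaussianInt}
    (e : bdry S) {Φ : ℂ → E} (hΦ : ContinuousOn Φ (⋃ e ∈ bdry S, edgePt e '' Icc 0 1)) :
    ∫ t in (0 : ℝ)..1, deriv (loop e) t • Φ (loop e t) =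
      ∑ j ∈ Finset.range (loopLen e), edgeInt Φ ((edgePerm S)^[j] e) := by
  have hL : (0 : ℝ) < loopLen e := by exact_mod_cast loopLen_pos e
  set a : ℕ → ℝ := fun j => j / loopLen e with ha
  have hle : ∀ j, a j ≤ a (j + 1) := fun j => by
    simp only [ha]; push_cast; gcongr; linarith
  have hbd : ∀ j : ℕ, ∀ t ∈ Icc (a j) (a (j + 1)), (j : ℝ) ≤ loopLen e * t ∧
      loopLen e * t ≤ j + 1 := by
    rintro j t ⟨h0, h1⟩
    simp only [ha] at h0 h1
    rw [div_le_iff₀ hL, mul_comm] at h0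
    rw [le_div_iff₀ hL, mul_comm] at h1
    push_cast at h1
    exact ⟨h0, h1⟩
  set k : ℕ → ℝ → E := fun j t => ((loopLen e : ℂ) * ((edgePerm S)^[j] e).1.2) •
    Φ (edgePt ((edgePerm S)^[j] e) (loopLen e * t - j)) with hk
  have heq : ∀ j, EqOn (k j) (fun t => deriv (loop e) t • Φ (loop e t))
      (uIoo (a j) (a (j + 1))) := by
    intro j t ht
    rw [uIoo_of_le (hle j)] at ht
    have hev : loop e =ᶠ[𝓝 t] fun t => edgePt ((edgePerm S)^[j] e) (loopLen e * t - j) := by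
      filter_upwards [Ioo_mem_nhds ht.1 ht.2] with u hu
      exact loop_eq e j (hbd j u (Ioo_subset_Icc_self hu)).1 (hbd j u (Ioo_subset_Icc_self hu)).2
    have hder : HasDerivAt (fun t : ℝ => edgePt ((edgePerm S)^[j] e) (loopLen e * t - j))
        ((loopLen e : ℂ) * ((edgePerm S)^[j] e).1.2) t := by
      have h1 : HasDerivAt (fun t : ℝ => (loopLen e : ℝ) * t - j) (loopLen e) t := by
        simpa using ((hasDerivAt_id t).const_mul (loopLen e : ℝ)).sub_const (j : ℝ)
      have := (hasDerivAt_edgePt ((edgePerm S)^[j] e) (loopLen e * t - j)).scomp t h1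
      rw [real_smul, ofReal_natCast] at this
      exact this
    simp only [hk]
    rw [hev.deriv_eq, hder.deriv, hev.self_of_nhds]
  have hkc : ∀ j, ContinuousOn (k j) (uIcc (a j) (a (j + 1))) := by
    intro j
    rw [uIcc_of_le (hle j)]
    refine ContinuousOn.const_smul ?_ _
    refine hΦ.comp (((continuous_edgePt _).comp (by fun_prop)).continuousOn) fun t ht => ?_
    refine mem_biUnion (Subtype.coe_prop ((edgePerm S)^[j] e)) ⟨_, ?_, rfl⟩
    have := hbd j t ht
    exact ⟨by linarith, by linarith⟩
  have hint : ∀ j, IntervalIntegrable (fun t => deriv (loop e) t • Φ (loop e t)) volume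
      (a j) (a (j + 1)) := fun j =>
    (intervalIntegrable_congr_uIoo (heq j)).1 (hkc j).intervalIntegrable
  have h0 : a 0 = 0 := by simp [ha]
  have h1 : a (loopLen e) = 1 := by simp [ha, hL.ne']
  rw [← h0, ← h1, ← intervalIntegral.sum_integral_adjacent_intervals fun j _ => hint j]
  refine Finset.sum_congr rfl fun j _ => ?_
  rw [← intervalIntegral.integral_congr_uIoo (heq j)]
  simp only [hk]
  rw [intervalIntegral.integral_comp_mul_sub (fun u => ((loopLen e : ℂ) * ((edgePerm S)^[j] e).1.2) •
    Φ (edgePt ((edgePerm S)^[j] e) u)) hL.ne' (j : ℝ)]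
  have e1 : (loopLen e : ℝ) * a j - j = 0 := by simp only [ha]; field_simp; ring
  have e2 : (loopLen e : ℝ) * a (j + 1) - j = 1 := by simp only [ha]; push_cast; field_simp; ring
  rw [e1, e2, edgeInt, ← intervalIntegral.integral_smul]
  refine intervalIntegral.integral_congr fun u _ => ?_
  rw [mul_smul, ← Complex.coe_smul, smul_smul]
  push_cast
  rw [inv_mul_cancel₀ (by exact_mod_cast hL.ne'), one_smul]

end Boundary

/-! ### The oriented boundary of the complement of a brickwork -/

section Frontier

open GaussianInt

lemma exists_edgePt_eq {g d : GaussianInt} (hd : d ∈ dirs) {x : ℂ} (h : x ∈ sq g)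
    (h' : x ∈ sq (g + gI * d)) : ∃ t ∈ Icc (0 : ℝ) 1, edgePt (g, d) t = x := by
  rw [mem_sq, abs_le, abs_le] at h h'
  rw [mem_dirs] at hd
  rcases hd with rfl | rfl | rfl | rfl <;> simp at h h'
  · refine ⟨x.re - (g : ℂ).re + 1 / 2, ⟨by linarith, by linarith⟩, ?_⟩
    apply Complex.ext <;> simp [edgePt] <;> linarith
  · refine ⟨x.im - (g : ℂ).im + 1 / 2, ⟨by linarith, by linarith⟩, ?_⟩
    apply Complex.ext <;> simp [edgePt] <;> linarith
  · refine ⟨(g : ℂ).re - x.re + 1 / 2, ⟨by linarith, by linarith⟩, ?_⟩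
    apply Complex.ext <;> simp [edgePt] <;> linarith
  · refine ⟨(g : ℂ).im - x.im + 1 / 2, ⟨by linarith, by linarith⟩, ?_⟩
    apply Complex.ext <;> simp [edgePt] <;> linarith

lemma mem_sq_corner {g d : GaussianInt} (hd : d ∈ dirs) {x : ℂ} (h : x ∈ sq g)
    (h' : x ∈ sq (g + d + gI * d)) : x ∈ sq (g + d) := by
  rw [mem_sq, abs_le, abs_le] at *
  rw [mem_dirs] at hd
  rcases hd with rfl | rfl | rfl | rfl <;> simp at h h' ⊢ <;>
    exact ⟨⟨by linarith, by linarith⟩, by linarith, by linarith⟩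

lemma exists_dir_of_mem_sq {g g' : GaussianInt} {x : ℂ} (h : x ∈ sq g) (h' : x ∈ sq g')
    (hne : g ≠ g') : ∃ d ∈ dirs, g' = g + gI * d ∨ g' = g + d + gI * d := by
  rw [mem_sq, abs_le, abs_le] at h h'
  simp only [← GaussianInt.intCast_re, ← GaussianInt.intCast_im] at h h'
  have h1 : ((g'.re - g.re : ℤ) : ℝ) ≤ 1 := by push_cast; linarith [h.1.2, h'.1.1]
  have h2 : (-1 : ℝ) ≤ ((g'.re - g.re : ℤ) : ℝ) := by push_cast; linarith [h.1.1, h'.1.2]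
  have h3 : ((g'.im - g.im : ℤ) : ℝ) ≤ 1 := by push_cast; linarith [h.2.2, h'.2.1]
  have h4 : (-1 : ℝ) ≤ ((g'.im - g.im : ℤ) : ℝ) := by push_cast; linarith [h.2.1, h'.2.2]
  norm_cast at h1 h2 h3 h4
  obtain ⟨a, ha⟩ : ∃ a, a = g'.re - g.re := ⟨_, rfl⟩
  obtain ⟨b, hb⟩ : ∃ b, b = g'.im - g.im := ⟨_, rfl⟩
  rw [← ha] at h1 h2
  rw [← hb] at h3 h4
  obtain rfl : g' = g + ⟨a, b⟩ := by ext <;> simp [ha, hb]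
  have hne' : (⟨a, b⟩ : GaussianInt) ≠ 0 := fun h => hne (by rw [h, add_zero])
  simp only [add_assoc, add_right_inj]
  clear ha hb h h' hne
  have hd : ∀ a ∈ Finset.Icc (-1 : ℤ) 1, ∀ b ∈ Finset.Icc (-1 : ℤ) 1, (⟨a, b⟩ : GaussianInt) ≠ 0 →
      ∃ d ∈ dirs, (⟨a, b⟩ : GaussianInt) = gI * d ∨ (⟨a, b⟩ : GaussianInt) = d + gI * d := by decide
  exact hd a (Finset.mem_Icc.2 ⟨h2, h1⟩) b (Finset.mem_Icc.2 ⟨h4, h3⟩) hne'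

lemma mem_interior_carrier {S : Finset GaussianInt} {x : ℂ} (h : ∀ g, x ∈ sq g → g ∈ S) :
    x ∈ interior (carrier S) := by
  rw [mem_interior_iff_mem_nhds]
  set G := {g : GaussianInt | ‖(g : ℂ)‖ ≤ ‖x‖ + 2 ∧ x ∉ sq g} with hG
  have hGf : G.Finite := (finite_gaussianInt_norm_le (‖x‖ + 2)).subset fun g hg => hg.1
  have hcl : IsClosed (⋃ g ∈ G, sq g) := hGf.isClosed_biUnion fun g _ => isClosed_sq g
  have hx : x ∉ ⋃ g ∈ G, sq g := by
    simp only [mem_iUnion, not_exists]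
    exact fun g hg hxg => hg.2 hxg
  filter_upwards [hcl.isOpen_compl.mem_nhds hx, Metric.ball_mem_nhds x one_pos] with w hw hwx
  obtain ⟨g, hg⟩ := exists_mem_sq_round w
  refine mem_carrier.2 ⟨g, h g ?_, hg⟩
  by_contra hxg
  refine hw (mem_biUnion (x := g) ⟨?_, hxg⟩ hg)
  have h1 := norm_sub_le_of_mem_sq hg
  rw [Metric.mem_ball, dist_eq_norm] at hwx
  have h2 : (g : ℂ) = x + (w - x) - (w - g) := by ring
  rw [h2]
  have h3 := norm_sub_le (x + (w - x)) (w - g)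
  have h4 := norm_add_le x (w - x)
  linarith

/-- Every frontier point lies on an edge between a square of `S` and a square outside `S`: otherwise
all the squares around it would belong to `S`. -/
lemma frontier_carrier (S : Finset GaussianInt) :
    frontier (carrier S) = ⋃ e ∈ bdry S, edgePt e '' Icc 0 1 := by
  rw [(isClosed_carrier S).frontier_eq]
  ext x
  simp only [Set.mem_sdiff, mem_iUnion, mem_image, exists_prop]
  constructor
  · rintro ⟨h1, h2⟩
    obtain ⟨g, hg, hxg⟩ := mem_carrier.1 h1
    obtain ⟨g', hxg', hg'⟩ : ∃ g', x ∈ sq g' ∧ g' ∉ S := by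
      by_contra! hcon
      exact h2 (mem_interior_carrier hcon)
    have key : ∀ g d, d ∈ dirs → g ∈ S → g + gI * d ∉ S → x ∈ sq g → x ∈ sq (g + gI * d) →
        ∃ e ∈ bdry S, ∃ t ∈ Icc (0 : ℝ) 1, edgePt e t = x := by
      intro g d hd h1 h2 h3 h4
      exact ⟨(g, d), mem_bdry.2 ⟨h1, hd, h2⟩, exists_edgePt_eq hd h3 h4⟩
    obtain ⟨d, hd, rfl | rfl⟩ := exists_dir_of_mem_sq hxg hxg' (fun h => hg' (h ▸ hg))
    · exact key g d hd hg hg' hxg hxg'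
    · have hc := mem_sq_corner hd hxg hxg'
      by_cases hgd : g + d ∈ S
      · exact key (g + d) d hd hgd hg' hc hxg'
      · have e1 : g + d = g + gI * -(gI * d) := by rw [mul_neg, gI_mul_gI_mul, neg_neg]
        exact key g (-(gI * d)) (neg_mem_dirs (gI_mul_mem_dirs hd)) hg (e1 ▸ hgd) hxg (e1 ▸ hc)
  · rintro ⟨e, he, t, ht, rfl⟩
    exact ⟨edgePt_mem_carrier he ht, edgePt_notMem_interior he ht⟩

lemma bdry_nonempty {S : Finset GaussianInt} (hS : S.Nonempty) : (bdry S).Nonempty := by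
  obtain ⟨g, hg, hmax⟩ := S.exists_max_image (fun g => g.im) hS
  refine ⟨(g, 1), mem_bdry.2 ⟨hg, mem_dirs.2 (Or.inl rfl), fun h => ?_⟩⟩
  have := hmax _ h
  simp [gI] at this

/-- The boundary curves of the complement of a brickwork: one polygon for each cycle of the
successor permutation. -/
def bdryCurves (S : Finset GaussianInt)
    (ℓ : Fin (Nat.card (Quotient (Equiv.Perm.SameCycle.setoid (edgePerm S))))) : ℝ → ℂ :=
  loop ((Finite.equivFin (Quotient (Equiv.Perm.SameCycle.setoid (edgePerm S)))).symm ℓ).out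

/-- Each boundary edge lies on exactly one of the polygons. -/
lemma sum_range_loopLen {M : Type*} [AddCommMonoid M] {S : Finset GaussianInt} (H : bdry S → M) :
    ∑ ℓ, ∑ j ∈ Finset.range (loopLen ((Finite.equivFin
      (Quotient (Equiv.Perm.SameCycle.setoid (edgePerm S)))).symm ℓ).out),
        H ((edgePerm S)^[j] ((Finite.equivFin
          (Quotient (Equiv.Perm.SameCycle.setoid (edgePerm S)))).symm ℓ).out) = ∑ e, H e := by
  classical
  set Q := Quotient (Equiv.Perm.SameCycle.setoid (edgePerm S)) with hQ
  have : Fintype Q := Fintype.ofFinite Q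
  rw [Equiv.sum_comp (Finite.equivFin Q).symm
    (fun q : Q => ∑ j ∈ Finset.range (loopLen q.out), H ((edgePerm S)^[j] q.out))]
  rw [← Finset.sum_fiberwise Finset.univ (fun e : bdry S => (Quotient.mk _ e : Q)) H]
  refine Finset.sum_congr rfl fun q _ => ?_
  refine Finset.sum_nbij (fun j => (edgePerm S)^[j] q.out) ?_ ?_ ?_ fun _ _ => rfl
  · intro j _
    simp only [Finset.mem_filter, Finset.mem_univ, true_and]
    conv_rhs => rw [← Quotient.out_eq q]
    refine Quotient.sound ?_
    change (edgePerm S).SameCycle _ _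
    rw [Equiv.Perm.iterate_eq_pow]
    exact Equiv.Perm.sameCycle_pow_left.2 (Equiv.Perm.SameCycle.refl _ _)
  · intro i hi j hj hij
    exact Function.iterate_injOn_Iio_minimalPeriod (f := edgePerm S) (x := q.out)
      (by simpa [loopLen] using hi) (by simpa [loopLen] using hj) hij
  · intro e he
    simp only [Finset.coe_filter, Finset.mem_univ, true_and, mem_ofPred_eq] at he
    rw [← Quotient.out_eq q] at he
    have hsc : (edgePerm S).SameCycle q.out e := (Quotient.exact he).symm
    obtain ⟨n, hn⟩ := hsc.exists_nat_pow_eq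
    refine ⟨n % loopLen q.out, ?_, ?_⟩
    · simpa using Nat.mod_lt _ (loopLen_pos q.out)
    · simp only
      rw [loopLen, Function.iterate_mod_minimalPeriod_eq, Equiv.Perm.iterate_eq_pow, hn]

lemma frontier_compl_carrier (S : Finset GaussianInt) :
    frontier (carrier S)ᶜ = ⋃ e ∈ bdry S, edgePt e '' Icc 0 1 := by
  rw [frontier_compl, frontier_carrier]

lemma isBoundary_bdryCurves {S : Finset GaussianInt} (hS : IsBrickwork S) (hne : S.Nonempty) :
    IsBoundary (carrier S)ᶜ (bdryCurves S) where
  pos := by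
    obtain ⟨e, he⟩ := bdry_nonempty hne
    have : Nonempty (Quotient (Equiv.Perm.SameCycle.setoid (edgePerm S))) :=
      ⟨Quotient.mk _ ⟨e, he⟩⟩
    exact Nat.card_pos
  jordan ℓ := isPiecewiseC1Jordan_loop hS _
  disjoint ℓ k hlk := by
    rw [bdryCurves, bdryCurves, Set.disjoint_left]
    set q := (Finite.equivFin (Quotient (Equiv.Perm.SameCycle.setoid (edgePerm S)))).symm ℓ with hq
    set q' := (Finite.equivFin (Quotient (Equiv.Perm.SameCycle.setoid (edgePerm S)))).symm k with hq'
    have key : ∀ e : bdry S, ∀ x ∈ loop e '' Icc 0 1, ∃ e' : bdry S, (edgePerm S).SameCycle e e' ∧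
        ∃ t ∈ Ico (0 : ℝ) 1, edgePt e' t = x := by
      intro e x hx
      rw [image_loop] at hx
      simp only [mem_iUnion, mem_ofPred_eq, exists_prop] at hx
      obtain ⟨e', he', t, ht, rfl⟩ := hx
      rcases ht.2.lt_or_eq with h1 | h1
      · exact ⟨e', he', t, ⟨ht.1, h1⟩, rfl⟩
      · refine ⟨edgePerm S e', Equiv.Perm.sameCycle_apply_right.2 he', 0, by simp, ?_⟩
        rw [edgePt_edgePerm, h1]
    intro x hx hx'
    obtain ⟨e, he, t, ht, hxe⟩ := key _ x hx
    obtain ⟨e', he', t', ht', hxe'⟩ := key _ x hx'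
    have hee := Subtype.ext (edgePt_inj hS e.2 e'.2 ht ht' (hxe.trans hxe'.symm)).1
    rw [← hee] at he'
    have : q = q' := by
      rw [← Quotient.out_eq q, ← Quotient.out_eq q']
      exact Quotient.sound (he.trans he'.symm)
    exact hlk ((Finite.equivFin _).symm.injective this)
  frontier_eq := by
    rw [frontier_compl_carrier]
    ext x
    simp only [bdryCurves, image_loop, mem_iUnion, mem_ofPred_eq, exists_prop]
    constructor
    · rintro ⟨e, he, hx⟩
      refine ⟨Finite.equivFin _ (Quotient.mk _ ⟨e, he⟩), ⟨e, he⟩, ?_, hx⟩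
      rw [Equiv.symm_apply_apply]
      exact Quotient.exact (Quotient.out_eq (Quotient.mk
        (Equiv.Perm.SameCycle.setoid (edgePerm S)) ⟨e, he⟩))
    · rintro ⟨ℓ, e, -, hx⟩
      exact ⟨e, e.2, hx⟩

lemma sum_windingNumber_bdryCurves {S : Finset GaussianInt} {z : ℂ}
    (hz : z ∉ frontier (carrier S)ᶜ) : ∑ ℓ, windingNumber (bdryCurves S ℓ) z =
      (2 * Real.pi * I)⁻¹ * ∑ e ∈ bdry S, edgeInt (fun w => (w - z)⁻¹) e := by
  rw [← Finset.sum_coe_sort (bdry S) (edgeInt fun w => (w - z)⁻¹),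
    ← sum_range_loopLen (fun e : bdry S => edgeInt (fun w => (w - z)⁻¹) e), Finset.mul_sum]
  refine Finset.sum_congr rfl fun ℓ _ => ?_
  rw [windingNumber, bdryCurves]
  congr 1
  rw [← integral_loop]
  · simp only [smul_eq_mul, div_eq_mul_inv]
  · refine ContinuousOn.inv₀ (by fun_prop) fun w hw h0 => hz ?_
    rw [frontier_compl_carrier, ← sub_eq_zero.1 h0]
    exact hw

/-- The winding numbers are those of the edge cycle: `0` by Cauchy's theorem at the points of the
complement, and `-1` by Cauchy's formula for the constant `1` at the interior points. -/
lemma isOrientedBoundary_bdryCurves {S : Finset GaussianInt} (hS : IsBrickwork S)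
    (hne : S.Nonempty) : IsOrientedBoundary (carrier S)ᶜ (bdryCurves S) where
  toIsBoundary := isBoundary_bdryCurves hS hne
  winding_inside z hz := by
    rw [sum_windingNumber_bdryCurves, sum_edgeInt_inv_of_notMem hz, mul_zero]
    rw [(isClosed_carrier S).isOpen_compl.frontier_eq]
    exact fun h => h.2 hz
  winding_outside z hz := by
    have hzi : z ∈ interior (carrier S) := by
      rwa [closure_compl, notMem_compl_iff] at hz
    rw [sum_windingNumber_bdryCurves fun h => hz (frontier_subset_closure h)]
    have := sum_edgeInt_cauchy (E := ℂ) isOpen_univ (subset_univ (carrier S))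
      (differentiableOn_const (c := (1 : ℂ))) hzi
    simp only [smul_eq_mul, mul_one] at this
    rw [this, mul_neg, inv_mul_cancel₀ two_pi_I_ne_zero]

end Frontier

/-! ### Components of plane domains -/

/-- Every boundary point of `W` has a neighborhood whose intersection with `W` is connected. -/
def LocallyConnectedAtFrontier (W : Set ℂ) : Prop :=
  ∀ p ∈ frontier W, ∃ N ∈ 𝓝 p, IsPreconnected (N ∩ W)

lemma mem_frontier_of_mem_closure_component {W : Set ℂ} (hW : IsOpen W) {z p : ℂ}
    (hp : p ∈ closure (connectedComponentIn W z)) (hpC : p ∉ connectedComponentIn W z) :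
    p ∈ frontier W := by
  rw [hW.frontier_eq]
  refine ⟨closure_mono (connectedComponentIn_subset W z) hp, fun hpW => hpC ?_⟩
  obtain ⟨x, hx, hx'⟩ := mem_closure_iff.1 hp _ hW.connectedComponentIn
    (mem_connectedComponentIn hpW)
  rw [connectedComponentIn_eq hx', ← connectedComponentIn_eq hx]
  exact mem_connectedComponentIn hpW

lemma connectedComponentIn_eq_of_preconnected {W N : Set ℂ} (hN : IsPreconnected (N ∩ W))
    {x y z w : ℂ} (hx : x ∈ connectedComponentIn W z) (hxN : x ∈ N)
    (hy : y ∈ connectedComponentIn W w) (hyN : y ∈ N) :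
    connectedComponentIn W z = connectedComponentIn W w := by
  have hxW := connectedComponentIn_subset W z hx
  have hyW := connectedComponentIn_subset W w hy
  rw [connectedComponentIn_eq hx, connectedComponentIn_eq hy]
  exact connectedComponentIn_eq (hN.subset_connectedComponentIn ⟨hxN, hxW⟩ inter_subset_right
    ⟨hyN, hyW⟩)

/-- If `W` is connected near each of its boundary points, then each boundary point is adherent to
only one component, and by compactness of the boundary there are finitely many components. -/
lemma isCauchyDomain_of_locallyConnected {W : Set ℂ} (hW : IsOpen W)
    (hloc : LocallyConnectedAtFrontier W) {m : ℕ} {Γ : Fin m → ℝ → ℂ} (hΓ : IsBoundary W Γ) :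
    IsCauchyDomain W where
  isOpen := hW
  boundary := ⟨m, Γ, hΓ⟩
  finite_components := by
    have hcpt : IsCompact (frontier W) := by
      rw [hΓ.frontier_eq]
      exact isCompact_iUnion fun ℓ =>
        isCompact_Icc.image_of_continuousOn (hΓ.jordan ℓ).continuousOn_and_integrable.1
    have hfne : (frontier W).Nonempty := by
      rw [hΓ.frontier_eq]
      exact ⟨Γ ⟨0, hΓ.pos⟩ 0, mem_iUnion.2 ⟨_, 0, by simp, rfl⟩⟩
    have hWuniv : W ≠ univ := by
      rintro rfl
      rw [frontier_univ] at hfne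
      exact hfne.ne_empty rfl
    choose! N hN hNc using hloc
    obtain ⟨t, ht, hcov⟩ := hcpt.elim_nhds_subcover (fun p => interior (N p))
      fun p hp => interior_mem_nhds.2 (hN p hp)
    classical
    refine ((t.finite_toSet).image fun p =>
      if h : (N p ∩ W).Nonempty then connectedComponentIn W h.some else ∅).subset ?_
    rintro C ⟨z, hz, rfl⟩
    obtain ⟨p, hp, hpC⟩ : ∃ p ∈ closure (connectedComponentIn W z),
        p ∉ connectedComponentIn W z := by
      by_contra! hcon
      have hcl : IsClosed (connectedComponentIn W z) := isClosed_of_closure_subset hcon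
      have huniv := IsClopen.eq_univ ⟨hcl, hW.connectedComponentIn⟩
        ⟨z, mem_connectedComponentIn hz⟩
      exact hWuniv (univ_subset_iff.1 (huniv ▸ connectedComponentIn_subset W z))
    have hpf := mem_frontier_of_mem_closure_component hW hp hpC
    have hp' := hcov hpf
    simp only [mem_iUnion, exists_prop] at hp'
    obtain ⟨q, hq, hpq⟩ := hp'
    obtain ⟨x, hx, hxC⟩ := mem_closure_iff.1 hp _ isOpen_interior hpq
    have hne : (N q ∩ W).Nonempty :=
      ⟨x, interior_subset hx, connectedComponentIn_subset W z hxC⟩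
    refine ⟨q, hq, ?_⟩
    simp only [dif_pos hne]
    exact connectedComponentIn_eq_of_preconnected (hNc q (ht q hq))
      (mem_connectedComponentIn hne.some_mem.2) hne.some_mem.1 hxC (interior_subset hx)
  disjoint_closures := by
    intro z hz w hw hne
    rw [Set.disjoint_left]
    intro p hpz hpw
    by_cases hp : p ∈ frontier W
    · obtain ⟨N, hN, hNc⟩ := hloc p hp
      obtain ⟨x, hxN, hx⟩ := mem_closure_iff_nhds.1 hpz N hN
      obtain ⟨y, hyN, hy⟩ := mem_closure_iff_nhds.1 hpw N hN
      exact hne (connectedComponentIn_eq_of_preconnected hNc hx hxN hy hyN)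
    · have h1 : p ∈ connectedComponentIn W z := by
        by_contra h
        exact hp (mem_frontier_of_mem_closure_component hW hpz h)
      have h2 : p ∈ connectedComponentIn W w := by
        by_contra h
        exact hp (mem_frontier_of_mem_closure_component hW hpw h)
      exact hne ((connectedComponentIn_eq h1).trans (connectedComponentIn_eq h2).symm)

section LocallyConnected

open GaussianInt

lemma add_mul_mem_sq {g d h : GaussianInt} (hd : d ∈ dirs) {y : ℂ} :
    (g + d * y : ℂ) ∈ sq (g + d * h) ↔
      |y.re - (h : ℂ).re| ≤ 1 / 2 ∧ |y.im - (h : ℂ).im| ≤ 1 / 2 := by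
  rw [mem_sq, abs_le, abs_le, abs_le, abs_le]
  rw [mem_dirs] at hd
  rcases hd with rfl | rfl | rfl | rfl <;> simp <;> constructor <;> rintro ⟨⟨_, _⟩, _, _⟩ <;>
    exact ⟨⟨by linarith, by linarith⟩, by linarith, by linarith⟩

lemma exists_add_mul_eq {g d : GaussianInt} (hd : d ∈ dirs) (g' : GaussianInt) :
    ∃ h, g' = g + d * h := by
  refine ⟨star d * (g' - g), ?_⟩
  have : d * star d = 1 := by
    rw [mem_dirs] at hd
    rcases hd with rfl | rfl | rfl | rfl <;> decide
  rw [← mul_assoc, this]; ring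

lemma exists_nhds_isPreconnected {W : Set ℂ} {g d : GaussianInt} (hd : d ∈ dirs) {B : Set ℂ}
    (hB : IsOpen B) {y : ℂ} (hy : y ∈ B) (h : IsPreconnected (B ∩ {y | (g + d * y : ℂ) ∈ W})) :
    ∃ N ∈ 𝓝 (g + d * y : ℂ), IsPreconnected (N ∩ W) := by
  have hd0 : (d : ℂ) ≠ 0 := dirs_ne_zero hd
  let φ : ℂ ≃ₜ ℂ := (Homeomorph.mulLeft₀ (d : ℂ) hd0).trans (Homeomorph.addLeft (g : ℂ))
  refine ⟨φ '' B, (φ.isOpenMap B hB).mem_nhds ⟨y, hy, rfl⟩, ?_⟩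
  rw [← image_inter_preimage]
  exact h.image φ φ.continuous.continuousOn

/-- The squares that meet a box, in the coordinates `x = g + d y`. -/
lemma add_mul_mem_carrier {S : Finset GaussianInt} {g d : GaussianInt} (hd : d ∈ dirs) {y : ℂ}
    (h₁ : -3 / 2 < y.re) (h₂ : y.re < 1 / 2) (h₃ : -1 / 2 < y.im) (h₄ : y.im < 3 / 2) :
    (g + d * y : ℂ) ∈ carrier S ↔
      (g ∈ S ∧ -1 / 2 ≤ y.re ∧ y.im ≤ 1 / 2) ∨
      (g + gI * d ∈ S ∧ -1 / 2 ≤ y.re ∧ 1 / 2 ≤ y.im) ∨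
      (g - d ∈ S ∧ y.re ≤ -1 / 2 ∧ y.im ≤ 1 / 2) ∨
      (g - d + gI * d ∈ S ∧ y.re ≤ -1 / 2 ∧ 1 / 2 ≤ y.im) := by
  have e0 : g + d * 0 = g := by ring
  have e1 : g + d * gI = g + gI * d := by ring
  have e2 : g + d * -1 = g - d := by ring
  have e3 : g + d * (-1 + gI) = g - d + gI * d := by ring
  rw [mem_carrier, ← e1, ← e3, ← e2, show (g ∈ S) = (g + d * 0 ∈ S) by rw [e0]]
  have hsq : ∀ h : GaussianInt, (g + d * y : ℂ) ∈ sq (g + d * h) ↔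
      |y.re - h.re| ≤ 1 / 2 ∧ |y.im - h.im| ≤ 1 / 2 := fun h => by
    rw [add_mul_mem_sq hd, ← GaussianInt.intCast_re, ← GaussianInt.intCast_im]
  simp only [abs_le] at hsq
  constructor
  · rintro ⟨g', hg', hx⟩
    obtain ⟨h, rfl⟩ := exists_add_mul_eq (g := g) hd g'
    obtain ⟨⟨ha, hb⟩, hc, he⟩ := (hsq h).1 hx
    have h5 : ((h.re : ℤ) : ℝ) < 1 := by linarith
    have h6 : (-2 : ℝ) < ((h.re : ℤ) : ℝ) := by linarith
    have h7 : ((h.im : ℤ) : ℝ) < 2 := by linarith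
    have h8 : (-1 : ℝ) < ((h.im : ℤ) : ℝ) := by linarith
    norm_cast at h5 h6 h7 h8
    have hr : h.re = 0 ∨ h.re = -1 := by omega
    have hi : h.im = 0 ∨ h.im = 1 := by omega
    rcases hr with hr | hr <;> rcases hi with hi | hi <;> rw [hr] at ha hb <;> rw [hi] at hc he <;>
      push_cast at ha hb hc he
    · obtain rfl : h = 0 := by ext <;> simp [hr, hi]
      exact Or.inl ⟨hg', by linarith, by linarith⟩
    · obtain rfl : h = gI := by ext <;> simp [hr, hi, gI]
      exact Or.inr (Or.inl ⟨hg', by linarith, by linarith⟩)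
    · obtain rfl : h = -1 := by ext <;> simp [hr, hi]
      exact Or.inr (Or.inr (Or.inl ⟨hg', by linarith, by linarith⟩))
    · obtain rfl : h = -1 + gI := by ext <;> simp [hr, hi, gI]
      exact Or.inr (Or.inr (Or.inr ⟨hg', by linarith, by linarith⟩))
  · rintro (h | h | h | h) <;> refine ⟨_, h.1, (hsq _).2 ?_⟩ <;> simp [gI] <;>
      exact ⟨⟨by linarith, by linarith⟩, by linarith, by linarith⟩

lemma edgePt_eq_add_mul (g d : GaussianInt) (t : ℝ) :
    edgePt (g, d) t = g + d * ((I - 1) / 2 + t) := by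
  simp only [edgePt]; ring

/-- An open box with sides parallel to the axes. -/
def box (a b a' b' : ℝ) : Set ℂ := {y | (a < y.re ∧ y.re < b) ∧ a' < y.im ∧ y.im < b'}

lemma isOpen_box (a b a' b' : ℝ) : IsOpen (box a b a' b') :=
  ((isOpen_lt continuous_const continuous_re).inter
    (isOpen_lt continuous_re continuous_const)).inter
    ((isOpen_lt continuous_const continuous_im).inter (isOpen_lt continuous_im continuous_const))

lemma convex_box (a b a' b' : ℝ) : Convex ℝ (box a b a' b') :=
  ((convex_halfSpace_re_gt a).inter (convex_halfSpace_re_lt b)).inter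
    ((convex_halfSpace_im_gt a').inter (convex_halfSpace_im_lt b'))

/-- Near an inner point of a boundary edge, the complement of the squares is half of a box. -/
lemma exists_nhds_edgePt {S : Finset GaussianInt} {g d : GaussianInt} (he : (g, d) ∈ bdry S)
    {t : ℝ} (ht : t ∈ Ioo (0 : ℝ) 1) :
    ∃ N ∈ 𝓝 (edgePt (g, d) t), IsPreconnected (N ∩ (carrier S)ᶜ) := by
  obtain ⟨hg, hd, hg'⟩ := mem_bdry.1 he
  rw [edgePt_eq_add_mul]
  refine exists_nhds_isPreconnected hd (isOpen_box (-1 / 2) (1 / 2) (-1 / 2) (3 / 2)) ?_ ?_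
  · simp only [box, mem_ofPred_eq]
    simp
    exact ⟨⟨by linarith [ht.1], by linarith [ht.2]⟩, by norm_num, by norm_num⟩
  · have : box (-1 / 2) (1 / 2) (-1 / 2) (3 / 2) ∩ {y | (g + d * y : ℂ) ∈ (carrier S)ᶜ} =
        box (-1 / 2) (1 / 2) (1 / 2) (3 / 2) := by
      ext y
      simp only [box, mem_inter_iff, mem_ofPred_eq, mem_compl_iff]
      constructor
      · rintro ⟨⟨⟨h1, h2⟩, h3, h4⟩, h5⟩
        rw [add_mul_mem_carrier hd (by linarith) h2 h3 h4] at h5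
        refine ⟨⟨h1, h2⟩, ?_, h4⟩
        by_contra! h
        exact h5 (Or.inl ⟨hg, h1.le, h⟩)
      · rintro ⟨⟨h1, h2⟩, h3, h4⟩
        refine ⟨⟨⟨h1, h2⟩, by linarith, h4⟩, ?_⟩
        rw [add_mul_mem_carrier hd (by linarith) h2 (by linarith) h4]
        rintro (h | h | h | h)
        · linarith [h.2.2]
        · exact hg' h.1
        · linarith [h.2.1]
        · linarith [h.2.1]
    rw [this]
    exact (convex_box _ _ _ _).isPreconnected

/-- At a vertex, the absence of checkerboard patterns makes the squares outside `S` adjacent. -/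
lemma exists_nhds_vertex {S : Finset GaussianInt} (hS : IsBrickwork S) {g d : GaussianInt}
    (he : (g, d) ∈ bdry S) :
    ∃ N ∈ 𝓝 (edgePt (g, d) 0), IsPreconnected (N ∩ (carrier S)ᶜ) := by
  obtain ⟨hg, hd, hg'⟩ := mem_bdry.1 he
  have hcb : g - d + gI * d ∈ S → g - d ∈ S := by
    intro hc
    by_contra hb
    have e1 : g + gI * d + gI * (gI * d) = g - d + gI * d := by rw [gI_mul_gI_mul]; ring
    have e2 : g + gI * (gI * d) = g - d := by rw [gI_mul_gI_mul]; ring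
    exact hS.no_checkerboard (gI_mul_mem_dirs hd) hg (e1 ▸ hc) hg' (e2 ▸ hb)
  rw [edgePt_eq_add_mul]
  refine exists_nhds_isPreconnected hd (isOpen_box (-3 / 2) (1 / 2) (-1 / 2) (3 / 2)) ?_ ?_
  · simp only [box, mem_ofPred_eq]
    simp
    norm_num
  have key : ∀ y ∈ box (-3 / 2) (1 / 2) (-1 / 2) (3 / 2), (g + d * y : ℂ) ∈ (carrier S)ᶜ ↔
      ¬(-1 / 2 ≤ y.re ∧ y.im ≤ 1 / 2) ∧ ¬(g - d ∈ S ∧ y.re ≤ -1 / 2 ∧ y.im ≤ 1 / 2) ∧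
      ¬(g - d + gI * d ∈ S ∧ y.re ≤ -1 / 2 ∧ 1 / 2 ≤ y.im) := by
    rintro y ⟨⟨h1, h2⟩, h3, h4⟩
    rw [mem_compl_iff, add_mul_mem_carrier hd h1 h2 h3 h4]
    simp only [hg, hg', true_and, false_and, false_or, not_or]
  by_cases hb : g - d ∈ S
  · by_cases hc : g - d + gI * d ∈ S
    · have : box (-3 / 2) (1 / 2) (-1 / 2) (3 / 2) ∩ {y | (g + d * y : ℂ) ∈ (carrier S)ᶜ} =
          box (-1 / 2) (1 / 2) (1 / 2) (3 / 2) := by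
        ext y
        constructor
        · rintro ⟨h1, h2⟩
          have h3 := (key y h1).1 h2
          simp only [hb, hc, true_and, not_and_or, not_le] at h3
          obtain ⟨⟨h4, h5⟩, h6, h7⟩ := h1
          refine ⟨⟨?_, h5⟩, ?_, h7⟩ <;> grind
        · rintro ⟨⟨h1, h2⟩, h3, h4⟩
          have h5 : y ∈ box (-3 / 2) (1 / 2) (-1 / 2) (3 / 2) :=
            ⟨⟨by linarith, h2⟩, by linarith, h4⟩
          refine ⟨h5, (key y h5).2 ⟨?_, ?_, ?_⟩⟩ <;> grind
      rw [this]
      exact (convex_box _ _ _ _).isPreconnected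
    · have : box (-3 / 2) (1 / 2) (-1 / 2) (3 / 2) ∩ {y | (g + d * y : ℂ) ∈ (carrier S)ᶜ} =
          box (-3 / 2) (1 / 2) (1 / 2) (3 / 2) := by
        ext y
        constructor
        · rintro ⟨h1, h2⟩
          have h3 := (key y h1).1 h2
          simp only [hb, hc, true_and, not_and_or, not_le] at h3
          obtain ⟨⟨h4, h5⟩, h6, h7⟩ := h1
          refine ⟨⟨h4, h5⟩, ?_, h7⟩
          grind
        · rintro ⟨⟨h1, h2⟩, h3, h4⟩
          have h5 : y ∈ box (-3 / 2) (1 / 2) (-1 / 2) (3 / 2) :=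
            ⟨⟨h1, h2⟩, by linarith, h4⟩
          refine ⟨h5, (key y h5).2 ⟨?_, ?_, ?_⟩⟩ <;> grind
      rw [this]
      exact (convex_box _ _ _ _).isPreconnected
  · have hc : g - d + gI * d ∉ S := fun h => hb (hcb h)
    have : box (-3 / 2) (1 / 2) (-1 / 2) (3 / 2) ∩ {y | (g + d * y : ℂ) ∈ (carrier S)ᶜ} =
        box (-3 / 2) (1 / 2) (1 / 2) (3 / 2) ∪ box (-3 / 2) (-1 / 2) (-1 / 2) (3 / 2) := by
      ext y
      constructor
      · rintro ⟨h1, h2⟩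
        have h3 := (key y h1).1 h2
        simp only [hb, hc, not_and_or, not_le] at h3
        obtain ⟨⟨h4, h5⟩, h6, h7⟩ := h1
        rcases h3.1 with h | h
        · exact Or.inr ⟨⟨h4, h⟩, h6, h7⟩
        · exact Or.inl ⟨⟨h4, h5⟩, h, h7⟩
      · rintro (⟨⟨h1, h2⟩, h3, h4⟩ | ⟨⟨h1, h2⟩, h3, h4⟩)
        · have h5 : y ∈ box (-3 / 2) (1 / 2) (-1 / 2) (3 / 2) :=
            ⟨⟨h1, h2⟩, by linarith, h4⟩
          refine ⟨h5, (key y h5).2 ⟨?_, ?_, ?_⟩⟩ <;> grind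
        · have h5 : y ∈ box (-3 / 2) (1 / 2) (-1 / 2) (3 / 2) :=
            ⟨⟨h1, by linarith⟩, by linarith, h4⟩
          refine ⟨h5, (key y h5).2 ⟨?_, ?_, ?_⟩⟩ <;> grind
    rw [this]
    refine IsPreconnected.union (-1 + I) ?_ ?_ (convex_box _ _ _ _).isPreconnected
      (convex_box _ _ _ _).isPreconnected <;>
    · simp only [box, mem_ofPred_eq]
      norm_num

lemma locallyConnectedAtFrontier_compl_carrier {S : Finset GaussianInt} (hS : IsBrickwork S) :
    LocallyConnectedAtFrontier (carrier S)ᶜ := by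
  intro p hp
  rw [frontier_compl_carrier] at hp
  simp only [mem_iUnion, exists_prop] at hp
  obtain ⟨⟨g, d⟩, he, t, ht, rfl⟩ := hp
  rcases ht.1.eq_or_lt with h0 | h0
  · rw [← h0]
    exact exists_nhds_vertex hS he
  · rcases ht.2.eq_or_lt with h1 | h1
    · have := edgePt_edgePerm S ⟨(g, d), he⟩
      rw [h1, ← this]
      exact exists_nhds_vertex hS (edgePerm S ⟨(g, d), he⟩).2
    · exact exists_nhds_edgePt he ⟨h0, h1⟩

end LocallyConnected

/-! ### Existence of Cauchy domains -/

section Existence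

lemma IsPiecewiseC1Jordan.const_mul {γ : ℝ → ℂ} (h : IsPiecewiseC1Jordan γ) {c : ℂ} (hc : c ≠ 0) :
    IsPiecewiseC1Jordan fun t => c * γ t := by
  obtain ⟨h0, hinj, k, t, ht, ht0, ht1, hd⟩ := h
  refine ⟨by simp only [h0], fun x hx y hy hxy => hinj hx hy (mul_left_cancel₀ hc hxy), k, t, ht,
    ht0, ht1, fun j => contDiffOn_const.mul (hd j)⟩

lemma windingNumber_const_mul (γ : ℝ → ℂ) {c : ℂ} (hc : c ≠ 0) (z : ℂ) :
    windingNumber (fun t => c * γ t) (c * z) = windingNumber γ z := by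
  rw [windingNumber, windingNumber]
  congr 1
  refine intervalIntegral.integral_congr fun t _ => ?_
  rw [deriv_const_mul_field, ← mul_sub, mul_div_mul_left _ _ hc]

lemma IsOrientedBoundary.const_mul {W : Set ℂ} {m : ℕ} {Γ : Fin m → ℝ → ℂ}
    (h : IsOrientedBoundary W Γ) {c : ℂ} (hc : c ≠ 0) :
    IsOrientedBoundary ((fun z => c * z) '' W) fun ℓ t => c * Γ ℓ t := by
  let φ : ℂ ≃ₜ ℂ := Homeomorph.mulLeft₀ c hc
  have himg : ∀ γ : ℝ → ℂ, (fun t => c * γ t) '' Icc 0 1 = φ '' (γ '' Icc 0 1) := fun γ => by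
    rw [image_image]; rfl
  refine { pos := h.pos
           jordan := fun ℓ => (h.jordan ℓ).const_mul hc
           disjoint := ?_
           frontier_eq := ?_
           winding_inside := ?_
           winding_outside := ?_ }
  · intro ℓ k hlk
    rw [himg, himg]
    exact (disjoint_image_iff φ.injective).2 (h.disjoint ℓ k hlk)
  · change frontier (φ '' W) = _
    rw [← φ.image_frontier, h.frontier_eq, image_iUnion]
    exact iUnion_congr fun ℓ => (himg _).symm
  · rintro _ ⟨z, hz, rfl⟩
    simp only [windingNumber_const_mul _ hc]
    exact h.winding_inside z hz
  · intro z hz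
    obtain ⟨w, rfl⟩ := φ.surjective z
    change φ w ∉ closure (φ '' W) at hz
    rw [← φ.image_closure, φ.injective.mem_set_image] at hz
    change ∑ ℓ, windingNumber (fun t => c * Γ ℓ t) (c * w) = -1
    simp only [windingNumber_const_mul _ hc]
    exact h.winding_outside w hz

lemma LocallyConnectedAtFrontier.image {W : Set ℂ} (h : LocallyConnectedAtFrontier W)
    (φ : ℂ ≃ₜ ℂ) : LocallyConnectedAtFrontier (φ '' W) := by
  intro p hp
  rw [← φ.image_frontier] at hp
  obtain ⟨q, hq, rfl⟩ := hp
  obtain ⟨N, hN, hNc⟩ := h q hq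
  refine ⟨φ '' N, φ.isOpenMap.image_mem_nhds hN, ?_⟩
  rw [← image_inter φ.injective]
  exact hNc.image φ φ.continuous.continuousOn

lemma star_mem_sq {g : GaussianInt} {z : ℂ} (h : z ∈ sq g) : (starRingEnd ℂ) z ∈ sq (star g) := by
  rw [mem_sq] at h ⊢
  simp only [GaussianInt.toComplex_star, conj_re, conj_im]
  refine ⟨h.1, ?_⟩
  rw [neg_sub_neg, abs_sub_comm]
  exact h.2

/-- A compact conjugation invariant subset of an open set `Ω` is separated from the complement of
`Ω` by an unbounded conjugation invariant Cauchy domain with an oriented boundary. -/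
theorem exists_cauchyDomain {K Ω : Set ℂ} (hK : IsCompact K) (hne : K.Nonempty) (hΩ : IsOpen Ω)
    (hKΩ : K ⊆ Ω) (hsymm : ∀ z ∈ K, (starRingEnd ℂ) z ∈ K) :
    ∃ W : Set ℂ, IsCauchyDomain W ∧ Bornology.IsBounded Wᶜ ∧ (∀ z ∈ W, (starRingEnd ℂ) z ∈ W) ∧
      closure W ⊆ Kᶜ ∧ Ωᶜ ⊆ W ∧ ∃ (m : ℕ) (Γ : Fin m → ℝ → ℂ), IsOrientedBoundary W Γ := by
  obtain ⟨δ, hδ, S, hS, h1, h2, h3⟩ := exists_brickwork hK hΩ hKΩ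
  have hδ0 : (δ : ℂ) ≠ 0 := by exact_mod_cast hδ.ne'
  -- the grid has mesh `1`, so the complement of the brickwork is scaled by `δ`
  let φ : ℂ ≃ₜ ℂ := Homeomorph.mulLeft₀ (δ : ℂ) hδ0
  have hSne : S.Nonempty := by
    obtain ⟨z, hz⟩ := hne
    have : φ.symm z ∈ interior (carrier S) := h1 (by
      change φ (φ.symm z) ∈ K
      rwa [φ.apply_symm_apply])
    obtain ⟨g, hg, -⟩ := mem_carrier.1 (interior_subset this)
    exact ⟨g, hg⟩
  have hor := (isOrientedBoundary_bdryCurves hS hSne).const_mul hδ0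
  change IsOrientedBoundary (φ '' (carrier S)ᶜ) _ at hor
  have hopen : IsOpen (φ '' (carrier S)ᶜ) := φ.isOpenMap _ (isClosed_carrier S).isOpen_compl
  refine ⟨φ '' (carrier S)ᶜ, isCauchyDomain_of_locallyConnected hopen
    ((locallyConnectedAtFrontier_compl_carrier hS).image φ) hor.toIsBoundary, ?_, ?_, ?_, ?_,
    _, _, hor⟩
  · rw [← image_compl_eq φ.bijective, compl_compl]
    have hcpt : IsCompact (carrier S) :=
      S.finite_toSet.isCompact_biUnion fun g _ => (isCompact_closedBall (g : ℂ) 1).of_isClosed_subset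
        (isClosed_sq g) fun z hz => by
          rw [Metric.mem_closedBall, dist_eq_norm]
          exact norm_sub_le_of_mem_sq hz
    exact (hcpt.image φ.continuous).isBounded
  · rintro _ ⟨z, hz, rfl⟩
    refine ⟨(starRingEnd ℂ) z, fun h => hz ?_, ?_⟩
    · obtain ⟨g, hg, hzg⟩ := mem_carrier.1 h
      refine mem_carrier.2 ⟨star g, h3 hsymm g hg, ?_⟩
      simpa using star_mem_sq hzg
    · change (δ : ℂ) * (starRingEnd ℂ) z = (starRingEnd ℂ) (δ * z)
      simp
  · rw [← φ.image_closure, closure_compl]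
    rintro _ ⟨z, hz, rfl⟩ hzK
    exact hz (h1 hzK)
  · intro z hz
    refine ⟨φ.symm z, fun h => hz ?_, φ.apply_symm_apply z⟩
    have := h2 _ h
    change φ (φ.symm z) ∈ Ω at this
    rwa [φ.apply_symm_apply] at this

end Existence

/-! ### Unbounded open sets with bounded frontier -/

section Unbounded

lemma isPreconnected_norm_gt (r : ℝ) (hr : 0 < r) : IsPreconnected {z : ℂ | r < ‖z‖} := by
  have h : {z : ℂ | r < ‖z‖} = exp '' {w : ℂ | Real.log r < w.re} := by
    ext z
    simp only [mem_ofPred_eq, mem_image]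
    constructor
    · intro hz
      have hz0 : z ≠ 0 := norm_pos_iff.1 (hr.trans hz)
      refine ⟨log z, ?_, exp_log hz0⟩
      rw [log_re]
      exact Real.log_lt_log hr hz
    · rintro ⟨w, hw, rfl⟩
      rw [norm_exp, ← Real.log_lt_iff_lt_exp hr]
      exact hw
  rw [h]
  exact (convex_halfSpace_re_gt _).isPreconnected.image _ continuous_exp.continuousOn

/-- The outside of a large disc is connected, so it lies on one side of a bounded frontier. -/
lemma isBounded_compl_of_isBounded_frontier {W : Set ℂ} (hW : IsOpen W)
    (hf : Bornology.IsBounded (frontier W)) (hub : ¬ Bornology.IsBounded W) :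
    Bornology.IsBounded Wᶜ := by
  obtain ⟨r, hr, hfr⟩ := hf.subset_ball_lt 0 0
  refine (Metric.isBounded_closedBall (x := (0 : ℂ)) (r := r)).subset ?_
  by_contra hcon
  obtain ⟨z, hzW, hz⟩ := not_subset.1 hcon
  rw [mem_closedBall_zero_iff, not_le] at hz
  obtain ⟨w, hwW, hw⟩ : ∃ w ∈ W, r < ‖w‖ := by
    by_contra! h
    exact hub ((Metric.isBounded_closedBall (x := (0 : ℂ)) (r := r)).subset
      fun w hw => mem_closedBall_zero_iff.2 (h w hw))
  have hdisj : ∀ x, r < ‖x‖ → x ∉ frontier W := fun x hx hxf => by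
    have := hfr hxf
    rw [mem_ball_zero_iff] at this
    exact lt_asymm hx this
  have := isPreconnected_norm_gt r hr W (closure W)ᶜ hW isClosed_closure.isOpen_compl
    (fun x hx => by
      by_cases h : x ∈ closure W
      · left
        by_contra hxW
        exact hdisj x hx (by rw [hW.frontier_eq]; exact ⟨h, hxW⟩)
      · exact Or.inr h)
    ⟨w, hw, hwW⟩ ⟨z, hz, fun h => hdisj z hz (by rw [hW.frontier_eq]; exact ⟨h, hzW⟩)⟩
  obtain ⟨x, -, hx, hx'⟩ := this
  exact hx' (subset_closure hx)

end Unbounded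

/-! ### Reflected cycles -/

section Conj

/-- The reflected cycle, traversed backwards. -/
def conjReverse {m : ℕ} (Γ : Fin m → ℝ → ℂ) : Fin m → ℝ → ℂ :=
  fun ℓ t => (starRingEnd ℂ) (Γ ℓ (1 - t))

lemma deriv_conjReverse {m : ℕ} (Γ : Fin m → ℝ → ℂ) (ℓ : Fin m) (t : ℝ) :
    deriv (conjReverse Γ ℓ) t = -(starRingEnd ℂ) (deriv (Γ ℓ) (1 - t)) := by
  have h1 : conjReverse Γ ℓ = fun t => star ((fun s => Γ ℓ (1 - s)) t) := rfl
  rw [h1, deriv.star, deriv_comp_const_sub]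
  simp

lemma windingNumber_conjReverse {m : ℕ} (Γ : Fin m → ℝ → ℂ) (ℓ : Fin m) (z : ℂ) :
    windingNumber (conjReverse Γ ℓ) z =
      (starRingEnd ℂ) (windingNumber (Γ ℓ) ((starRingEnd ℂ) z)) := by
  rw [windingNumber, windingNumber, map_mul]
  have h1 : ∀ t, deriv (conjReverse Γ ℓ) t / (conjReverse Γ ℓ t - z) =
      (fun s => -(starRingEnd ℂ) (deriv (Γ ℓ) s / (Γ ℓ s - (starRingEnd ℂ) z))) (1 - t) := by
    intro t
    rw [deriv_conjReverse]
    simp [conjReverse, neg_div]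
  simp only [h1]
  rw [intervalIntegral.integral_comp_sub_left (fun s => -(starRingEnd ℂ) (deriv (Γ ℓ) s /
    (Γ ℓ s - (starRingEnd ℂ) z))), intervalIntegral.integral_neg]
  have h2 : ∫ s in (0 : ℝ)..1, (starRingEnd ℂ) (deriv (Γ ℓ) s / (Γ ℓ s - (starRingEnd ℂ) z)) =
      (starRingEnd ℂ) (∫ s in (0 : ℝ)..1, deriv (Γ ℓ) s / (Γ ℓ s - (starRingEnd ℂ) z)) := by
    simp only [intervalIntegral.integral_of_le zero_le_one]
    exact integral_conj
  rw [sub_self, sub_zero, h2]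
  simp only [map_inv₀, map_mul, conj_ofReal, conj_I, map_ofNat]
  simp

/-- Reflection reverses the orientation, and so does running backwards. -/
lemma IsCycleAround.conjReverse {W : Set ℂ} {m : ℕ} {Γ : Fin m → ℝ → ℂ} (h : IsCycleAround W Γ)
    (hW : ∀ z ∈ W, (starRingEnd ℂ) z ∈ W) : IsCycleAround W (conjReverse Γ) := by
  have hmaps : MapsTo (fun t : ℝ => 1 - t) (Icc 0 1) (Icc 0 1) := fun t ht =>
    ⟨by linarith [ht.2], by linarith [ht.1]⟩
  have himg : (conjCLE.toHomeomorph : ℂ → ℂ) '' W = W := by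
    ext z
    constructor
    · rintro ⟨w, hw, rfl⟩
      exact hW w hw
    · exact fun hz => ⟨(starRingEnd ℂ) z, hW z hz, conj_conj z⟩
  refine ⟨fun ℓ => ?_, fun ℓ => ?_, fun ℓ t ht => ?_, fun z hz => ?_, fun z hz => ?_⟩
  · exact continuous_conj.comp_continuousOn ((h.continuousOn ℓ).comp (by fun_prop) hmaps)
  · have h1 : deriv (SliceCalc.conjReverse Γ ℓ) =
        fun t => -(conjCLE : ℂ →L[ℝ] ℂ) (deriv (Γ ℓ) (1 - t)) :=
      funext fun t => deriv_conjReverse Γ ℓ t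
    rw [h1]
    have h2 := (h.integrable ℓ).comp_sub_left 1
    simp only [sub_zero, sub_self] at h2
    have h3 := h2.symm
    rw [intervalIntegrable_iff] at h3 ⊢
    exact ((conjCLE : ℂ →L[ℝ] ℂ).integrable_comp h3).neg
  · rw [← himg, ← Homeomorph.image_frontier]
    exact ⟨Γ ℓ (1 - t), h.mem_frontier ℓ _ (hmaps ht), rfl⟩
  · simp only [windingNumber_conjReverse, ← map_sum, h.inside _ (hW z hz), map_zero]
  · simp only [windingNumber_conjReverse, ← map_sum]
    rw [h.outside, map_neg, map_one]
    intro hz'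
    refine hz ?_
    rw [← himg, ← Homeomorph.image_closure]
    exact ⟨(starRingEnd ℂ) z, hz', conj_conj z⟩

/-- The substitution `z ↦ z̄` in a contour integral, with a conjugate linear map `c` on the values.
-/
lemma cInt_conjReverse {E : Type*} [NormedAddCommGroup E] [NormedSpace ℂ E] [CompleteSpace E]
    {m : ℕ} {Γ : Fin m → ℝ → ℂ} (c : E →L⋆[ℂ] E) {Φ : ℂ → E}
    (hint : ∀ ℓ, IntervalIntegrable (fun t => deriv (Γ ℓ) t • Φ (Γ ℓ t)) volume 0 1) :
    cInt (conjReverse Γ) (fun z => c (Φ ((starRingEnd ℂ) z))) = -c (cInt Γ Φ) := by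
  let c' : E →L[ℝ] E :=
    { toFun := c, map_add' := map_add c, map_smul' := fun r x => by
        have := c.map_smulₛₗ (r : ℂ) x
        simpa using this
      cont := c.continuous }
  rw [cInt, cInt, map_sum, ← Finset.sum_neg_distrib]
  refine Finset.sum_congr rfl fun ℓ _ => ?_
  have h1 : ∀ t, deriv (conjReverse Γ ℓ) t • c (Φ ((starRingEnd ℂ) (conjReverse Γ ℓ t))) =
      (fun s => -c' (deriv (Γ ℓ) s • Φ (Γ ℓ s))) (1 - t) := by
    intro t
    change _ = -c (_ • _)
    rw [deriv_conjReverse, c.map_smulₛₗ, neg_smul]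
    simp [conjReverse]
  simp only [h1]
  rw [intervalIntegral.integral_comp_sub_left (fun s => -c' (deriv (Γ ℓ) s • Φ (Γ ℓ s))),
    intervalIntegral.integral_neg]
  simp only [sub_self, sub_zero]
  rw [c'.intervalIntegral_comp_comm (hint ℓ)]
  rfl

end Conj

/-! ### Complexification of a real Banach space -/

section Complexification

/-- The complexification of a real Banach space `V`, realized as the space of real linear maps
`ℂ → V` on which `ℂ` acts by `(c φ) w = φ (c w)`. -/
def Cx (V : Type*) [NormedAddCommGroup V] [NormedSpace ℝ V] : Type _ := ℂ →L[ℝ] V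

variable {V : Type*} [NormedAddCommGroup V] [NormedSpace ℝ V]

instance : NormedAddCommGroup (Cx V) := inferInstanceAs (NormedAddCommGroup (ℂ →L[ℝ] V))

instance [CompleteSpace V] : CompleteSpace (Cx V) :=
  inferInstanceAs (CompleteSpace (ℂ →L[ℝ] V))

/-- The real linear map that an element of the complexification stands for. -/
def Cx.clm (φ : Cx V) : ℂ →L[ℝ] V := φ

/-- A real linear map as an element of the complexification. -/
def Cx.mk (φ : ℂ →L[ℝ] V) : Cx V := φ

@[simp] lemma Cx.clm_mk (φ : ℂ →L[ℝ] V) : (Cx.mk φ).clm = φ := rfl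

lemma Cx.ext {φ ψ : Cx V} (h : ∀ w, φ.clm w = ψ.clm w) : φ = ψ := ContinuousLinearMap.ext h

lemma Cx.norm_def (φ : Cx V) : ‖φ‖ = ‖φ.clm‖ := rfl

@[simp] lemma Cx.clm_add (φ ψ : Cx V) : (φ + ψ).clm = φ.clm + ψ.clm := rfl

@[simp] lemma Cx.clm_neg (φ : Cx V) : (-φ).clm = -φ.clm := rfl

@[simp] lemma Cx.clm_zero : (0 : Cx V).clm = 0 := rfl

instance : SMul ℂ (Cx V) where
  smul c φ := Cx.mk (φ.clm ∘L ContinuousLinearMap.mul ℝ ℂ c)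

@[simp] lemma Cx.clm_smul (c : ℂ) (φ : Cx V) (w : ℂ) : (c • φ).clm w = φ.clm (c * w) := rfl

instance : Module ℂ (Cx V) where
  one_smul φ := Cx.ext fun w => by simp
  mul_smul a b φ := Cx.ext fun w => by simp only [Cx.clm_smul]; ring_nf
  smul_zero a := Cx.ext fun w => by simp
  smul_add a φ ψ := Cx.ext fun w => by simp
  add_smul a b φ := Cx.ext fun w => by simp [add_mul]
  zero_smul φ := Cx.ext fun w => by simp

instance : NormedSpace ℂ (Cx V) where
  norm_smul_le c φ := by
    rw [Cx.norm_def]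
    refine ContinuousLinearMap.opNorm_le_bound _ (by positivity) fun w => ?_
    rw [Cx.clm_smul, Cx.norm_def, mul_comm ‖c‖, mul_assoc, ← norm_mul]
    exact φ.clm.le_opNorm _

@[simp] lemma Cx.clm_real_smul (r : ℝ) (φ : Cx V) (w : ℂ) : (r • φ).clm w = r • φ.clm w := by
  have : r • φ = (r : ℂ) • φ := rfl
  rw [this, Cx.clm_smul, ← real_smul, map_smul]

/-- The complex Banach algebra of the bounded operators on the complexification. -/
abbrev CxEnd (V : Type*) [NormedAddCommGroup V] [NormedSpace ℝ V] : Type _ := Cx V →L[ℂ] Cx V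

/-- The complex linear extension of a bounded operator. -/
def cxMap : (V →L[ℝ] V) →L[ℝ] CxEnd V :=
  LinearMap.mkContinuous
    { toFun := fun A => LinearMap.mkContinuous
        { toFun := fun φ => Cx.mk (A ∘L φ.clm)
          map_add' := fun φ ψ => Cx.ext fun w => by simp
          map_smul' := fun c φ => Cx.ext fun w => by simp } ‖A‖ fun φ => by
            rw [Cx.norm_def, Cx.norm_def]
            exact A.opNorm_comp_le φ.clm
      map_add' := fun A B => by ext φ; exact Cx.ext fun w => by simp
      map_smul' := fun r A => by ext φ; exact Cx.ext fun w => by simp } 1 fun A => by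
        rw [one_mul]
        exact ContinuousLinearMap.opNorm_le_bound _ (norm_nonneg A) fun φ => A.opNorm_comp_le φ.clm

@[simp] lemma clm_cxMap (A : V →L[ℝ] V) (φ : Cx V) (w : ℂ) :
    (cxMap A φ).clm w = A (φ.clm w) := rfl

@[simp] lemma cxMap_comp (A B : V →L[ℝ] V) : cxMap (A ∘L B) = cxMap A * cxMap B := rfl

@[simp] lemma cxMap_one : cxMap (1 : V →L[ℝ] V) = 1 := rfl

/-- The inclusion of the real part, `v ↦ v ⊗ 1`. -/
def Cx.ofReal : V →L[ℝ] Cx V :=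
  LinearMap.mkContinuous
    { toFun := fun v => Cx.mk (reCLM.smulRight v)
      map_add' := fun v w => Cx.ext fun c => by simp
      map_smul' := fun r v => Cx.ext fun c => by simp [smul_smul, mul_comm] } 1 fun v => by
        rw [Cx.norm_def, one_mul]
        refine ContinuousLinearMap.opNorm_le_bound _ (norm_nonneg v) fun w => ?_
        change ‖w.re • v‖ ≤ ‖v‖ * ‖w‖
        rw [norm_smul, mul_comm]
        exact mul_le_mul_of_nonneg_left (abs_re_le_norm w) (norm_nonneg v)

@[simp] lemma Cx.clm_ofReal (v : V) (w : ℂ) : (Cx.ofReal v).clm w = w.re • v := rfl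

lemma Cx.eq_ofReal_sub (φ : Cx V) :
    φ = Cx.ofReal (φ.clm 1) - I • Cx.ofReal (φ.clm I) := by
  rw [eq_sub_iff_add_eq]
  refine Cx.ext fun w => ?_
  have hw : w = w.re • (1 : ℂ) + w.im • I := by simp [re_add_im]
  have h2 : φ.clm w = w.re • φ.clm 1 + w.im • φ.clm I := by
    conv_lhs => rw [hw, map_add, map_smul, map_smul]
  rw [Cx.clm_add, add_apply, h2]
  simp

/-- An operator on the complexification is determined by its values on the real part. -/
lemma cxEnd_ext {X Y : CxEnd V} (h : ∀ v, X (Cx.ofReal v) = Y (Cx.ofReal v)) : X = Y := by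
  ext φ
  rw [φ.eq_ofReal_sub, map_sub, map_sub, map_smul, map_smul, h, h]

lemma norm_clm_apply_ofReal_le (X : CxEnd V) (v : V) :
    ‖(X (Cx.ofReal v)).clm 1‖ ≤ ‖X‖ * ‖v‖ := by
  refine ((X (Cx.ofReal v)).clm.le_opNorm 1).trans ?_
  rw [norm_one, mul_one, ← Cx.norm_def]
  refine (X.le_opNorm _).trans (mul_le_mul_of_nonneg_left ?_ (norm_nonneg X))
  have h : ‖(Cx.ofReal : V →L[ℝ] Cx V)‖ ≤ 1 := LinearMap.mkContinuous_norm_le _ zero_le_one _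
  exact (Cx.ofReal.le_of_opNorm_le h v).trans (one_mul _).le

/-- The real part of an operator on the complexification. -/
def cxRe : CxEnd V →L[ℝ] (V →L[ℝ] V) :=
  LinearMap.mkContinuous
    { toFun := fun X => LinearMap.mkContinuous
        { toFun := fun v => (X (Cx.ofReal v)).clm 1
          map_add' := fun v w => by simp
          map_smul' := fun r v => by simp } ‖X‖ fun v => norm_clm_apply_ofReal_le X v
      map_add' := fun X Y => by ext v; simp
      map_smul' := fun r X => by ext v; simp } 1 fun X => by
        rw [one_mul]
        refine ContinuousLinearMap.opNorm_le_bound _ (norm_nonneg X) fun v => ?_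
        exact norm_clm_apply_ofReal_le X v

lemma cxRe_apply (X : CxEnd V) (v : V) : cxRe X v = (X (Cx.ofReal v)).clm 1 := rfl

/-- The imaginary part of an operator on the complexification. -/
def cxIm (X : CxEnd V) : V →L[ℝ] V := -cxRe (I • X)

@[simp] lemma cxRe_cxMap (A : V →L[ℝ] V) : cxRe (cxMap A) = A := by
  ext v; simp [cxRe_apply]

@[simp] lemma cxRe_I_smul_cxMap (A : V →L[ℝ] V) : cxRe (I • cxMap A) = 0 := by
  ext v; simp [cxRe_apply]

lemma cxIm_apply (X : CxEnd V) (v : V) : cxIm X v = -(X (Cx.ofReal v)).clm I := by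
  simp [cxIm, cxRe_apply]

lemma cxMap_cxRe_add (X : CxEnd V) : cxMap (cxRe X) + I • cxMap (cxIm X) = X := by
  refine cxEnd_ext fun v => Cx.ext fun w => ?_
  have hw : w = w.re • (1 : ℂ) + w.im • I := by simp [re_add_im]
  have h2 : (X (Cx.ofReal v)).clm w =
      w.re • (X (Cx.ofReal v)).clm 1 + w.im • (X (Cx.ofReal v)).clm I := by
    conv_lhs => rw [hw, map_add, map_smul, map_smul]
  rw [h2, add_apply, smul_apply, Cx.clm_add,
    add_apply, Cx.clm_smul, clm_cxMap, clm_cxMap]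
  simp [cxRe_apply, cxIm_apply]

/-- Complex conjugation of operators on the complexification. -/
def cxConj : CxEnd V →L⋆[ℂ] CxEnd V where
  toFun X := cxMap (cxRe X) - I • cxMap (cxIm X)
  map_add' X Y := by simp only [cxIm, smul_add, map_add, neg_add]; abel
  map_smul' c X := by
    have h1 : c • X = c.re • X + c.im • (I • X) := by
      conv_lhs => rw [← re_add_im c, add_smul, mul_smul]
      rfl
    have h2 : I • (c • X) = c.re • (I • X) - c.im • X := by
      rw [h1, smul_add, smul_comm I c.re, smul_comm I c.im, smul_smul I I, I_mul_I]
      simp [sub_eq_add_neg]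
    have h3 : ∀ Y : CxEnd V, (starRingEnd ℂ) c • Y = c.re • Y - c.im • (I • Y) := fun Y => by
      conv_lhs => rw [← re_add_im c, map_add, map_mul, conj_I, conj_ofReal, conj_ofReal, add_smul]
      rw [mul_neg, neg_smul, mul_smul, ← sub_eq_add_neg]
      rfl
    rw [h3, cxIm, cxIm, h2, h1]
    simp only [map_add, map_sub, map_smul, map_neg, smul_sub, smul_neg, smul_smul, neg_sub,
      smul_comm I]
    rw [I_mul_I]
    simp only [neg_smul, one_smul, smul_neg]
    abel
  cont := by
    have h : Continuous fun X : CxEnd V => cxMap (cxRe X) - I • cxMap (-cxRe (I • X)) := by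
      fun_prop
    exact h

lemma cxConj_apply (X : CxEnd V) : cxConj X = cxMap (cxRe X) - I • cxMap (cxIm X) := rfl

lemma cxConj_add_smul (A B : V →L[ℝ] V) :
    cxConj (cxMap A + I • cxMap B) = cxMap A - I • cxMap B := by
  have h : I • I • cxMap B = -cxMap B := by rw [smul_smul, I_mul_I]; simp
  rw [cxConj_apply, cxIm]
  simp [h]

lemma cxConj_mul (X Y : CxEnd V) : cxConj (X * Y) = cxConj X * cxConj Y := by
  conv_lhs => rw [← cxMap_cxRe_add X, ← cxMap_cxRe_add Y]
  rw [cxConj_apply X, cxConj_apply Y]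
  have h : (cxMap (cxRe X) + I • cxMap (cxIm X)) * (cxMap (cxRe Y) + I • cxMap (cxIm Y)) =
      cxMap (cxRe X ∘L cxRe Y - cxIm X ∘L cxIm Y) +
        I • cxMap (cxRe X ∘L cxIm Y + cxIm X ∘L cxRe Y) := by
    simp only [map_sub, map_add, cxMap_comp, mul_add, add_mul, smul_mul_assoc, mul_smul_comm,
      smul_smul, I_mul_I, smul_add, neg_smul, one_smul]
    abel
  rw [h, cxConj_add_smul]
  simp only [map_sub, map_add, cxMap_comp, mul_sub, sub_mul, smul_mul_assoc, mul_smul_comm,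
    smul_add, smul_sub]
  rw [smul_smul I I, I_mul_I, neg_smul, one_smul]
  abel

/-- An operator that is invariant under conjugation is the extension of its real part. -/
lemma cxMap_cxRe_of_cxConj_eq {X : CxEnd V} (h : cxConj X = X) : cxMap (cxRe X) = X := by
  have h1 := cxMap_cxRe_add X
  rw [cxConj_apply] at h
  have h2 : (2 : ℝ) • cxMap (cxRe X) = (2 : ℝ) • X := by
    rw [two_smul, two_smul]
    have h3 : cxMap (cxRe X) + cxMap (cxRe X) = (cxMap (cxRe X) + I • cxMap (cxIm X)) +
        (cxMap (cxRe X) - I • cxMap (cxIm X)) := by abel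
    rw [h3, h1, h]
  exact smul_right_injective _ two_ne_zero h2

end Complexification

/-! ### Algebraic properties of integrals over cycles -/

section CIntegral

variable {E : Type*} [NormedAddCommGroup E] [NormedSpace ℂ E]
variable {W W₁ W₂ : Set ℂ} {m m₁ m₂ : ℕ} {Γ : Fin m → ℝ → ℂ} {Γ₁ : Fin m₁ → ℝ → ℂ}
  {Γ₂ : Fin m₂ → ℝ → ℂ}

lemma IsCycleAround.cInt_congr (h : IsCycleAround W Γ) {Φ Ψ : ℂ → E}
    (hΦ : ∀ z ∈ frontier W, Φ z = Ψ z) : cInt Γ Φ = cInt Γ Ψ := by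
  refine Finset.sum_congr rfl fun ℓ _ => intervalIntegral.integral_congr fun t ht => ?_
  rw [uIcc_of_le zero_le_one] at ht
  rw [hΦ _ (h.mem_frontier ℓ t ht)]

lemma IsCycleAround.cInt_sub (h : IsCycleAround W Γ) {Φ Ψ : ℂ → E}
    (hΦ : ContinuousOn Φ (frontier W)) (hΨ : ContinuousOn Ψ (frontier W)) :
    cInt Γ (fun z => Φ z - Ψ z) = cInt Γ Φ - cInt Γ Ψ := by
  simp only [cInt, smul_sub, ← Finset.sum_sub_distrib]
  exact Finset.sum_congr rfl fun ℓ _ => intervalIntegral.integral_sub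
    (h.intervalIntegrable subset_rfl hΦ ℓ) (h.intervalIntegrable subset_rfl hΨ ℓ)

lemma cInt_smul (c : ℂ) (Φ : ℂ → E) : cInt Γ (fun z => c • Φ z) = c • cInt Γ Φ := by
  simp only [cInt, Finset.smul_sum, smul_comm _ c]
  exact Finset.sum_congr rfl fun ℓ _ => intervalIntegral.integral_smul _ _

lemma IsCycleAround.clm_cInt {F : Type*} [NormedAddCommGroup F] [NormedSpace ℂ F] [CompleteSpace E]
    [CompleteSpace F] (h : IsCycleAround W Γ) (L : E →L[ℂ] F) {Φ : ℂ → E}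
    (hΦ : ContinuousOn Φ (frontier W)) : L (cInt Γ Φ) = cInt Γ fun z => L (Φ z) := by
  rw [cInt, cInt, map_sum]
  refine Finset.sum_congr rfl fun ℓ _ => ?_
  rw [← L.intervalIntegral_comp_comm (h.intervalIntegrable subset_rfl hΦ ℓ)]
  simp only [map_smul]

lemma cInt_swap (h₁ : IsCycleAround W₁ Γ₁) (h₂ : IsCycleAround W₂ Γ₂) {K : ℂ → ℂ → E}
    (hK : ContinuousOn (Function.uncurry K) (frontier W₁ ×ˢ frontier W₂)) :
    cInt Γ₁ (fun z => cInt Γ₂ fun w => K z w) = cInt Γ₂ (fun w => cInt Γ₁ fun z => K z w) := by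
  have hKc : ∀ ℓ k, ContinuousOn (Function.uncurry fun t u => K (Γ₁ ℓ t) (Γ₂ k u))
      (Icc (0 : ℝ) 1 ×ˢ Icc (0 : ℝ) 1) := by
    intro ℓ k
    refine hK.comp (f := fun p : ℝ × ℝ => (Γ₁ ℓ p.1, Γ₂ k p.2)) (ContinuousOn.prodMk
      ((h₁.continuousOn ℓ).comp continuousOn_fst fun p hp => hp.1)
      ((h₂.continuousOn k).comp continuousOn_snd fun p hp => hp.2)) fun p hp =>
        ⟨h₁.mem_frontier ℓ _ hp.1, h₂.mem_frontier k _ hp.2⟩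
  have hKc' : ∀ ℓ k, ContinuousOn (Function.uncurry fun u t => K (Γ₁ ℓ t) (Γ₂ k u))
      (Icc (0 : ℝ) 1 ×ˢ Icc (0 : ℝ) 1) := fun ℓ k =>
    (hKc ℓ k).comp continuous_swap.continuousOn fun p hp => ⟨hp.2, hp.1⟩
  simp only [cInt, Finset.smul_sum]
  have e1 : ∀ ℓ, ∫ t in (0 : ℝ)..1, ∑ k, deriv (Γ₁ ℓ) t •
      ∫ u in (0 : ℝ)..1, deriv (Γ₂ k) u • K (Γ₁ ℓ t) (Γ₂ k u) =
      ∑ k, ∫ t in (0 : ℝ)..1, deriv (Γ₁ ℓ) t •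
      ∫ u in (0 : ℝ)..1, deriv (Γ₂ k) u • K (Γ₁ ℓ t) (Γ₂ k u) := fun ℓ =>
    intervalIntegral.integral_finsetSum fun k _ =>
      intervalIntegrable_smul_continuousOn zero_le_one (h₁.integrable ℓ)
        (continuousOn_intervalIntegral_smul zero_le_one (h₂.integrable k) (hKc' ℓ k))
  have e2 : ∀ k, ∫ u in (0 : ℝ)..1, ∑ ℓ, deriv (Γ₂ k) u •
      ∫ t in (0 : ℝ)..1, deriv (Γ₁ ℓ) t • K (Γ₁ ℓ t) (Γ₂ k u) =
      ∑ ℓ, ∫ u in (0 : ℝ)..1, deriv (Γ₂ k) u •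
      ∫ t in (0 : ℝ)..1, deriv (Γ₁ ℓ) t • K (Γ₁ ℓ t) (Γ₂ k u) := fun k =>
    intervalIntegral.integral_finsetSum fun ℓ _ =>
      intervalIntegrable_smul_continuousOn zero_le_one (h₂.integrable k)
        (continuousOn_intervalIntegral_smul zero_le_one (h₁.integrable ℓ) (hKc ℓ k))
  simp only [e1, e2]
  rw [Finset.sum_comm]
  refine Finset.sum_congr rfl fun k _ => Finset.sum_congr rfl fun ℓ _ => ?_
  exact intervalIntegral_smul_swap zero_le_one zero_le_one (h₁.integrable ℓ) (h₂.integrable k)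
    (hKc ℓ k)

end CIntegral

/-! ### The product rule for pseudo-resolvents -/

section Product

variable {𝓐 : Type*} [NormedRing 𝓐] [NormedAlgebra ℂ 𝓐] [CompleteSpace 𝓐]
variable {W W₁ W₂ : Set ℂ} {m m₁ m₂ : ℕ} {Γ : Fin m → ℝ → ℂ} {Γ₁ : Fin m₁ → ℝ → ℂ}
  {Γ₂ : Fin m₂ → ℝ → ℂ}

lemma IsCycleAround.mul_cInt (h : IsCycleAround W Γ) (a : 𝓐) {Φ : ℂ → 𝓐}
    (hΦ : ContinuousOn Φ (frontier W)) : a * cInt Γ Φ = cInt Γ fun z => a * Φ z :=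
  h.clm_cInt (ContinuousLinearMap.mul ℂ 𝓐 a) hΦ

lemma IsCycleAround.cInt_mul (h : IsCycleAround W Γ) (a : 𝓐) {Φ : ℂ → 𝓐}
    (hΦ : ContinuousOn Φ (frontier W)) : cInt Γ Φ * a = cInt Γ fun z => Φ z * a :=
  h.clm_cInt ((ContinuousLinearMap.mul ℂ 𝓐).flip a) hΦ

/-- The product rule for the functional calculus of a pseudo-resolvent `R`, with `𝓐`-valued
functions `f` to the left and `g` to the right of `R`. It needs no commutation: by the resolvent
identity the product of the integrals is a double integral of `f(z) (R(z) - R(w)) g(w) / (w - z)`,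
and Cauchy's formula evaluates one of the two integrations in each of the two summands. -/
theorem pseudoResolvent_product {R : ℂ → 𝓐} {ρ : Set ℂ} (hR : ContinuousOn R ρ)
    (hres : ∀ z ∈ ρ, ∀ w ∈ ρ, R z - R w = (w - z) • (R z * R w))
    (h₁ : IsCycleAround W₁ Γ₁) (h₂ : IsCycleAround W₂ Γ₂) (hW₁ : IsOpen W₁) (hW₂ : IsOpen W₂)
    (hb₁ : Bornology.IsBounded W₁ᶜ) (hb₂ : Bornology.IsBounded W₂ᶜ)
    (hρ : ρᶜ ⊆ W₁) (h₁₂ : closure W₁ ⊆ W₂) {D : Set ℂ} (hD : IsOpen D) (h₂D : closure W₂ ⊆ D)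
    {f g : ℂ → 𝓐} (hf : DifferentiableOn ℂ f D) (hg : DifferentiableOn ℂ g D) {f₀ g₀ : 𝓐}
    (hf₀ : Tendsto f (Bornology.cobounded ℂ) (𝓝 f₀))
    (hg₀ : Tendsto g (Bornology.cobounded ℂ) (𝓝 g₀)) :
    (f₀ + (2 * Real.pi * I)⁻¹ • cInt Γ₁ fun z => f z * R z) *
      (g₀ + (2 * Real.pi * I)⁻¹ • cInt Γ₂ fun z => R z * g z) =
      f₀ * g₀ + (2 * Real.pi * I)⁻¹ • cInt Γ₁ fun z => f z * R z * g z := by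
  have hc := two_pi_I_ne_zero
  have hfr₁ : frontier W₁ ⊆ ρ := fun z hz => by
    by_contra h
    rw [hW₁.frontier_eq] at hz
    exact hz.2 (hρ h)
  have hfr₂ : frontier W₂ ⊆ ρ := fun z hz => by
    by_contra h
    rw [hW₂.frontier_eq] at hz
    exact hz.2 (h₁₂ (subset_closure (hρ h)))
  have hfr₁' : frontier W₁ ⊆ W₂ := frontier_subset_closure.trans h₁₂
  have hfr₁D : frontier W₁ ⊆ D := hfr₁'.trans (subset_closure.trans h₂D)
  have hfr₂D : frontier W₂ ⊆ D := frontier_subset_closure.trans h₂D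
  have hne : ∀ z ∈ frontier W₁, ∀ w ∈ frontier W₂, w - z ≠ 0 := by
    intro z hz w hw h
    rw [hW₂.frontier_eq] at hw
    exact hw.2 (sub_eq_zero.1 h ▸ hfr₁' hz)
  have hR₁ := hR.mono hfr₁
  have hR₂ := hR.mono hfr₂
  have hf₁ := hf.continuousOn.mono hfr₁D
  have hg₁ := hg.continuousOn.mono hfr₁D
  have hg₂ := hg.continuousOn.mono hfr₂D
  have hfR : ContinuousOn (fun z => f z * R z) (frontier W₁) := hf₁.mul hR₁
  have hRg : ContinuousOn (fun z => R z * g z) (frontier W₂) := hR₂.mul hg₂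
  have hfRg : ContinuousOn (fun z => f z * R z * g z) (frontier W₁) := hfR.mul hg₁
  have hfRg₀ : ContinuousOn (fun z => f z * R z * g₀) (frontier W₁) := hfR.mul continuousOn_const
  have hint : ContinuousOn (fun z => (2 * Real.pi * I : ℂ) • (f z * R z * g z - f z * R z * g₀))
      (frontier W₁) := (hfRg.sub hfRg₀).const_smul _
  set X := cInt Γ₁ fun z => f z * R z with hX
  set Y := cInt Γ₂ fun z => R z * g z with hY
  set Z := cInt Γ₁ fun z => f z * R z * g z with hZ
  have hinv : ContinuousOn (fun p : ℂ × ℂ => (p.2 - p.1)⁻¹) (frontier W₁ ×ˢ frontier W₂) :=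
    ContinuousOn.inv₀ (by fun_prop) fun p hp => hne p.1 hp.1 p.2 hp.2
  have hpt : ∀ z ∈ frontier W₁, f z * R z * Y =
      (2 * Real.pi * I) • (f z * R z * g z - f z * R z * g₀) -
        cInt Γ₂ fun w => (w - z)⁻¹ • (f z * (R w * g w)) := by
    intro z hz
    have hinvz : ContinuousOn (fun w : ℂ => (w - z)⁻¹) (frontier W₂) :=
      ContinuousOn.inv₀ (by fun_prop) fun w hw => hne z hz w hw
    have e1 : f z * R z * Y = cInt Γ₂ fun w =>
        f z * R z * ((w - z)⁻¹ • g w) - (w - z)⁻¹ • (f z * (R w * g w)) := by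
      rw [hY, h₂.mul_cInt _ hRg]
      refine h₂.cInt_congr fun w hw => ?_
      have := hres z (hfr₁ hz) w (hfr₂ hw)
      have h3 : R z * R w = (w - z)⁻¹ • (R z - R w) := by
        rw [this, smul_smul, inv_mul_cancel₀ (hne z hz w hw), one_smul]
      rw [mul_assoc, ← mul_assoc (R z), h3, smul_mul_assoc, mul_smul_comm, mul_smul_comm, ← smul_sub,
        sub_mul, mul_sub, mul_assoc]
    have hcg : ContinuousOn (fun w => (w - z)⁻¹ • g w) (frontier W₂) := hinvz.smul hg₂
    have hcg' : ContinuousOn (fun w => f z * R z * ((w - z)⁻¹ • g w)) (frontier W₂) :=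
      continuousOn_const.mul hcg
    have hcg'' : ContinuousOn (fun w => (w - z)⁻¹ • (f z * (R w * g w))) (frontier W₂) :=
      hinvz.smul (continuousOn_const.mul hRg)
    rw [e1, h₂.cInt_sub hcg' hcg'', ← h₂.mul_cInt _ hcg,
      cInt_cauchy_of_mem h₂ hW₂ hb₂ hD h₂D hg hg₀ (hfr₁' hz), mul_smul_comm, mul_sub]
  -- the resolvent identity, Cauchy's formula for `g` on `Γ₂`, and Cauchy's formula for `f` on `Γ₁`
  have hXY : X * Y = (2 * Real.pi * I) • (Z - X * g₀) - (2 * Real.pi * I) • (f₀ * Y) := by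
    rw [hX, h₁.cInt_mul _ hfR, h₁.cInt_congr hpt]
    have hcont : ContinuousOn (fun z => cInt Γ₂ fun w => (w - z)⁻¹ • (f z * (R w * g w)))
        (frontier W₁) := by
      have : ContinuousOn (fun z => (2 * Real.pi * I : ℂ) • (f z * R z * g z - f z * R z * g₀) -
          f z * R z * Y) (frontier W₁) := hint.sub (hfR.mul continuousOn_const)
      refine this.congr fun z hz => ?_
      simp only
      rw [hpt z hz]; abel
    rw [h₁.cInt_sub hint hcont, cInt_smul, h₁.cInt_sub hfRg hfRg₀, ← h₁.cInt_mul _ hfR]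
    congr 1
    have hK : ContinuousOn (Function.uncurry fun z w => (w - z)⁻¹ • (f z * (R w * g w)))
        (frontier W₁ ×ˢ frontier W₂) :=
      hinv.smul ((hf₁.comp continuousOn_fst fun p hp => hp.1).mul
        (hRg.comp continuousOn_snd fun p hp => hp.2))
    rw [cInt_swap h₁ h₂ hK, hY, h₂.mul_cInt _ hRg, ← cInt_smul]
    refine h₂.cInt_congr fun w hw => ?_
    have hw₁ : w ∉ closure W₁ := fun h => by
      rw [hW₂.frontier_eq] at hw
      exact hw.2 (h₁₂ h)
    have hinvw : ContinuousOn (fun z : ℂ => (z - w)⁻¹) (frontier W₁) :=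
      ContinuousOn.inv₀ (by fun_prop) fun z hz h =>
        hne z hz w hw (by rw [← neg_sub, h, neg_zero])
    have e2 := cInt_cauchy_of_notMem h₁ hW₁ hb₁ hD ((h₁₂.trans subset_closure).trans h₂D) hf hf₀ hw₁
    have e3 : (fun z => (w - z)⁻¹ • (f z * (R w * g w))) =
        fun z => (-1 : ℂ) • ((z - w)⁻¹ • f z * (R w * g w)) := by
      funext z
      rw [smul_mul_assoc, smul_smul, ← neg_sub z w, inv_neg, neg_one_mul]
    have hcf : ContinuousOn (fun z => (z - w)⁻¹ • f z) (frontier W₁) := hinvw.smul hf₁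
    rw [e3, cInt_smul, ← h₁.cInt_mul _ hcf, e2, neg_mul, smul_neg, neg_smul, one_smul,
      neg_neg, smul_mul_assoc]
  rw [add_mul, mul_add, mul_add, smul_mul_smul_comm, hXY, mul_smul_comm, smul_mul_assoc]
  have h4 : ((2 * Real.pi * I)⁻¹ * (2 * Real.pi * I)⁻¹ : ℂ) •
      ((2 * Real.pi * I) • (Z - X * g₀) - (2 * Real.pi * I) • (f₀ * Y)) =
      (2 * Real.pi * I : ℂ)⁻¹ • (Z - X * g₀) - (2 * Real.pi * I : ℂ)⁻¹ • (f₀ * Y) := by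
    rw [smul_sub, smul_smul, smul_smul, inv_mul_cancel_right₀ hc]
  rw [h4, smul_sub]
  abel

end Product

/-! ### The resolvent of the complexified operator -/

section Resolvent

variable {V : Type*} [NormedAddCommGroup V] [NormedSpace ℝ V]

/-- `boundedOp` is chosen among the bounded operators with the given values, of which there is only
one. -/
lemma boundedOp_coe (A : V →L[ℝ] V) : boundedOp ⇑A = A := by
  have h : ∃ B : V →L[ℝ] V, ⇑B = ⇑A := ⟨A, rfl⟩
  rw [boundedOp, dif_pos h]
  exact DFunLike.coe_injective h.choose_spec

lemma boundedOp_eq {φ : V → V} (A : V →L[ℝ] V) (h : ∀ v, A v = φ v) : boundedOp φ = A := by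
  rw [← boundedOp_coe A]
  congr 1
  exact funext fun v => (h v).symm

variable {K : Type*} [Ring K] [Module K V]

omit [NormedSpace ℝ V] in
lemma opApply_of_mem {T : V →ₗ.[K] V} {v : V} (h : v ∈ T.domain) : opApply T v = T ⟨v, h⟩ :=
  dif_pos h

omit [NormedSpace ℝ V] in
lemma opApply_add {T : V →ₗ.[K] V} {v w : V} (hv : v ∈ T.domain) (hw : w ∈ T.domain) :
    opApply T (v + w) = opApply T v + opApply T w := by
  rw [opApply_of_mem hv, opApply_of_mem hw, opApply_of_mem (T.domain.add_mem hv hw), ← T.map_add]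
  rfl

omit [NormedSpace ℝ V] in
lemma opApply_sub {T : V →ₗ.[K] V} {v w : V} (hv : v ∈ T.domain) (hw : w ∈ T.domain) :
    opApply T (v - w) = opApply T v - opApply T w := by
  rw [opApply_of_mem hv, opApply_of_mem hw, opApply_of_mem (T.domain.sub_mem hv hw), ← T.map_sub]
  rfl

lemma real_smul_mem_domain [Module ℝ K] [IsScalarTower ℝ K V] {T : V →ₗ.[K] V} {v : V}
    (hv : v ∈ T.domain) (r : ℝ) :
    r • v ∈ T.domain := by
  rw [← one_smul K v, ← smul_assoc]
  exact T.domain.smul_mem _ hv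

lemma opApply_smul [Module ℝ K] [IsScalarTower ℝ K V] {T : V →ₗ.[K] V} {v : V}
    (hv : v ∈ T.domain) (r : ℝ) :
    opApply T (r • v) = r • opApply T v := by
  have h : r • v = (r • (1 : K)) • v := by rw [smul_assoc, one_smul]
  have h' : r • opApply T v = (r • (1 : K)) • opApply T v := by rw [smul_assoc, one_smul]
  rw [h', h, opApply_of_mem hv, opApply_of_mem (T.domain.smul_mem _ hv), ← T.map_smul]
  rfl

/-- `T² - 2 Re(z) T + |z|²`, for `z ∈ ℂ`. -/
def quadOp (T : V →ₗ.[K] V) (z : ℂ) (v : V) : V :=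
  opApply T (opApply T v) - (2 * z.re) • opApply T v + (‖z‖ ^ 2) • v

/-- `B` is the bounded inverse of `T² - 2 Re(z) T + |z|²`. -/
def IsQuadInv (T : V →ₗ.[K] V) (z : ℂ) (B : V →L[ℝ] V) : Prop :=
  (∀ w, B w ∈ domSq T ∧ quadOp T z (B w) = w) ∧ ∀ v ∈ domSq T, B (quadOp T z v) = v

/-- The complex trace of the `S`-resolvent set. -/
def cxResolventSet (T : V →ₗ.[K] V) : Set ℂ := {z | ∃ B : V →L[ℝ] V, IsQuadInv T z B}

open Classical in
/-- The bounded inverse of `T² - 2 Re(z) T + |z|²`, and `0` if there is none. -/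
def quadInv (T : V →ₗ.[K] V) (z : ℂ) : V →L[ℝ] V :=
  if h : ∃ B : V →L[ℝ] V, IsQuadInv T z B then h.choose else 0

lemma isQuadInv_quadInv {T : V →ₗ.[K] V} {z : ℂ} (hz : z ∈ cxResolventSet T) :
    IsQuadInv T z (quadInv T z) := by
  have h : ∃ B : V →L[ℝ] V, IsQuadInv T z B := hz
  rw [quadInv, dif_pos h]
  exact h.choose_spec

lemma isQuadInv_conj {T : V →ₗ.[K] V} {z : ℂ} {B : V →L[ℝ] V} :
    IsQuadInv T ((starRingEnd ℂ) z) B ↔ IsQuadInv T z B := by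
  simp only [IsQuadInv, quadOp, conj_re, norm_conj]

lemma conj_mem_cxResolventSet {T : V →ₗ.[K] V} {z : ℂ} :
    (starRingEnd ℂ) z ∈ cxResolventSet T ↔ z ∈ cxResolventSet T := by
  simp only [cxResolventSet, mem_ofPred_eq, isQuadInv_conj]

lemma quadInv_conj (T : V →ₗ.[K] V) (z : ℂ) : quadInv T ((starRingEnd ℂ) z) = quadInv T z := by
  have h : IsQuadInv T ((starRingEnd ℂ) z) = IsQuadInv T z :=
    funext fun B => propext isQuadInv_conj
  rw [quadInv, quadInv, h]

lemma IsQuadInv.opApply_opApply {T : V →ₗ.[K] V} {z : ℂ} {B : V →L[ℝ] V} (hB : IsQuadInv T z B)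
    (w : V) : opApply T (opApply T (B w)) = w + (2 * z.re) • opApply T (B w) - (‖z‖ ^ 2) • B w := by
  have := (hB.1 w).2
  rw [quadOp] at this
  nth_rewrite 2 [← this]
  abel

/-- `T` commutes with the inverse of its quadratic polynomial. -/
lemma IsQuadInv.opApply_comm [Module ℝ K] [IsScalarTower ℝ K V] {T : V →ₗ.[K] V}
    {z : ℂ} {B : V →L[ℝ] V} (hB : IsQuadInv T z B)
    {v : V} (hv : v ∈ T.domain) : opApply T (B v) = B (opApply T v) := by
  obtain ⟨h1, h2⟩ := (hB.1 v).1
  have h3 := hB.opApply_opApply v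
  have h4 : opApply T (opApply T (B v)) ∈ T.domain := by
    rw [h3]
    exact T.domain.sub_mem (T.domain.add_mem hv (real_smul_mem_domain h2 _))
      (real_smul_mem_domain h1 _)
  have h5 : quadOp T z (opApply T (B v)) = opApply T v := by
    rw [quadOp, ← opApply_smul h1,
      ← opApply_smul h2, ← opApply_sub h4 (real_smul_mem_domain h2 _),
      ← opApply_add (T.domain.sub_mem h4 (real_smul_mem_domain h2 _)) (real_smul_mem_domain h1 _)]
    congr 1
    exact (hB.1 v).2
  rw [← h5, hB.2 _ ⟨h2, h4⟩]

/-- Every bounded operator with range in the domain of `T` has a bounded composition with `T`. -/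
def HasBoundedComp (T : V →ₗ.[K] V) : Prop :=
  ∀ B : V →L[ℝ] V, (∀ v, B v ∈ T.domain) → ∃ C : V →L[ℝ] V, ∀ v, C v = opApply T (B v)

/-- The bounded operator `T (T² - 2 Re(z) T + |z|²)⁻¹`. -/
def opQuadInv (T : V →ₗ.[K] V) (z : ℂ) : V →L[ℝ] V := boundedOp fun v => opApply T (quadInv T z v)

lemma opQuadInv_apply {T : V →ₗ.[K] V} (hT : HasBoundedComp T) {z : ℂ}
    (hz : z ∈ cxResolventSet T) (v : V) : opQuadInv T z v = opApply T (quadInv T z v) := by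
  obtain ⟨C, hC⟩ := hT _ fun v => ((isQuadInv_quadInv hz).1 v).1.1
  rw [opQuadInv, boundedOp_eq C hC, hC]

/-- The resolvent `(z - T)⁻¹ = (z̄ - T) (T² - 2 Re(z) T + |z|²)⁻¹` on the complexification. -/
def cxResolvent (T : V →ₗ.[K] V) (z : ℂ) : CxEnd V :=
  cxMap (z.re • quadInv T z - opQuadInv T z) + I • cxMap (-z.im • quadInv T z)

/-- `(φ, ψ)` belongs to the graph of the complex linear extension of `T`. -/
def CxGraph (T : V →ₗ.[K] V) (φ ψ : Cx V) : Prop :=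
  ∀ w, φ.clm w ∈ T.domain ∧ opApply T (φ.clm w) = ψ.clm w

lemma clm_cxResolvent {T : V →ₗ.[K] V} (hT : HasBoundedComp T) {z : ℂ}
    (hz : z ∈ cxResolventSet T) (φ : Cx V) (w : ℂ) :
    (cxResolvent T z φ).clm w = z.re • quadInv T z (φ.clm w) - opApply T (quadInv T z (φ.clm w)) -
      z.im • quadInv T z (φ.clm (I * w)) := by
  rw [← opQuadInv_apply hT hz, cxResolvent]
  simp [sub_eq_add_neg]

lemma clm_mul_apply (φ : Cx V) (z w : ℂ) :
    φ.clm (z * w) = z.re • φ.clm w + z.im • φ.clm (I * w) := by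
  have : z * w = z.re • w + z.im • (I * w) := by
    conv_lhs => rw [← re_add_im z]
    rw [real_smul, real_smul]; ring
  rw [this, map_add, map_smul, map_smul]

lemma clm_smul_cxResolvent [Module ℝ K] [IsScalarTower ℝ K V] {T : V →ₗ.[K] V}
    (hT : HasBoundedComp T) {z : ℂ}
    (hz : z ∈ cxResolventSet T) (φ : Cx V) (w : ℂ) :
    (z • cxResolvent T z φ).clm w = (‖z‖ ^ 2) • quadInv T z (φ.clm w) -
      z.re • opApply T (quadInv T z (φ.clm w)) -
      z.im • opApply T (quadInv T z (φ.clm (I * w))) := by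
  have h1 : I * (z * w) = (I * z) * w := by ring
  have h2 : ‖z‖ ^ 2 = z.re * z.re + z.im * z.im := by rw [Complex.sq_norm, normSq_apply]
  have hd := fun v => ((isQuadInv_quadInv hz).1 v).1.1
  rw [Cx.clm_smul, clm_cxResolvent hT hz, h1, clm_mul_apply, clm_mul_apply φ (I * z), h2]
  simp only [map_add, map_smul, I_mul_re, I_mul_im]
  rw [opApply_add (real_smul_mem_domain (hd _) _) (real_smul_mem_domain (hd _) _),
    opApply_smul (hd _), opApply_smul (hd _)]
  module

/-- `cxResolvent T z` is a right inverse of `z - T`. -/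
lemma cxGraph_cxResolvent [Module ℝ K] [IsScalarTower ℝ K V] {T : V →ₗ.[K] V}
    (hT : HasBoundedComp T) {z : ℂ}
    (hz : z ∈ cxResolventSet T) (φ : Cx V) :
    CxGraph T (cxResolvent T z φ) (z • cxResolvent T z φ - φ) := by
  intro w
  have hQ := isQuadInv_quadInv hz
  have hd := fun v => (hQ.1 v).1.1
  have hd2 := fun v => (hQ.1 v).1.2
  have e1 : (z • cxResolvent T z φ - φ).clm w = (z • cxResolvent T z φ).clm w - φ.clm w := rfl
  have h1 := real_smul_mem_domain (hd (φ.clm w)) z.re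
  have h2 := real_smul_mem_domain (hd (φ.clm (I * w))) z.im
  rw [e1, clm_smul_cxResolvent hT hz, clm_cxResolvent hT hz]
  refine ⟨T.domain.sub_mem (T.domain.sub_mem h1 (hd2 _)) h2, ?_⟩
  rw [opApply_sub (T.domain.sub_mem h1 (hd2 _)) h2, opApply_sub h1 (hd2 _), opApply_smul (hd _),
    opApply_smul (hd _), hQ.opApply_opApply]
  module

/-- `cxResolvent T z` is a left inverse of `z - T`. -/
lemma cxResolvent_of_cxGraph [Module ℝ K] [IsScalarTower ℝ K V] {T : V →ₗ.[K] V}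
    (hT : HasBoundedComp T) {z : ℂ}
    (hz : z ∈ cxResolventSet T) {φ ψ : Cx V} (h : CxGraph T φ ψ) :
    cxResolvent T z (z • φ - ψ) = φ := by
  refine Cx.ext fun w => ?_
  have hQ := isQuadInv_quadInv hz
  have e1 : (cxResolvent T z (z • φ - ψ)).clm w =
      (z • cxResolvent T z φ).clm w - (cxResolvent T z ψ).clm w := by
    rw [map_sub, map_smul]; rfl
  rw [e1, clm_smul_cxResolvent hT hz, clm_cxResolvent hT hz, ← (h w).2, ← (h (I * w)).2,
    ← hQ.opApply_comm (h w).1, ← hQ.opApply_comm (h _).1, hQ.opApply_opApply]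
  module

/-- The resolvent identity. -/
theorem cxResolvent_sub [Module ℝ K] [IsScalarTower ℝ K V] {T : V →ₗ.[K] V}
    (hT : HasBoundedComp T) {z w : ℂ}
    (hz : z ∈ cxResolventSet T) (hw : w ∈ cxResolventSet T) :
    cxResolvent T z - cxResolvent T w = (w - z) • (cxResolvent T z * cxResolvent T w) := by
  ext φ
  have h := cxResolvent_of_cxGraph hT hz (cxGraph_cxResolvent hT hw φ)
  change cxResolvent T z φ - cxResolvent T w φ =
    (w - z) • cxResolvent T z (cxResolvent T w φ)
  simp only [map_sub, map_smul] at h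
  rw [sub_smul]
  nth_rewrite 1 [← h]
  abel

lemma cxResolvent_conj (T : V →ₗ.[K] V) (z : ℂ) :
    cxResolvent T ((starRingEnd ℂ) z) = cxConj (cxResolvent T z) := by
  rw [cxResolvent, cxResolvent, cxConj_add_smul, opQuadInv, opQuadInv, quadInv_conj]
  simp [sub_eq_add_neg]

lemma quadOp_eq_add {T : V →ₗ.[K] V} (z z₀ : ℂ) (v : V) : quadOp T z v =
    quadOp T z₀ v + ((2 * z₀.re - 2 * z.re) • opApply T v + (‖z‖ ^ 2 - ‖z₀‖ ^ 2) • v) := by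
  simp only [quadOp]; module

/-- The quadratic polynomial at `z` is `(1 + N) (T² - 2 Re(z₀) T + |z₀|²)` with a bounded operator
`N` that is small for `z` near `z₀`. -/
lemma isOpen_cxResolventSet [CompleteSpace V] {T : V →ₗ.[K] V} (hT : HasBoundedComp T) :
    IsOpen (cxResolventSet T) := by
  rw [isOpen_iff_mem_nhds]
  intro z₀ hz₀
  have hQ := isQuadInv_quadInv hz₀
  -- the relative perturbation of the quadratic polynomial when `z₀` moves to `z`
  let N : ℂ → (V →L[ℝ] V) := fun z => (2 * z₀.re - 2 * z.re) • opQuadInv T z₀ +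
    (‖z‖ ^ 2 - ‖z₀‖ ^ 2) • quadInv T z₀
  have hN : Continuous N := by fun_prop
  have hN0 : N z₀ = 0 := by simp [N]
  have hu : ∀ᶠ z in 𝓝 z₀, IsUnit (1 + N z) := by
    have h1 : Tendsto (fun z => 1 + N z) (𝓝 z₀) (𝓝 1) := by
      have := (continuous_const.add hN).tendsto' (f := fun z => (1 : V →L[ℝ] V) + N z) z₀ 1
        (by rw [hN0, add_zero])
      exact this
    exact h1.eventually (Units.isOpen.mem_nhds isUnit_one)
  filter_upwards [hu] with z hz
  obtain ⟨u, hu⟩ := hz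
  have hNv : ∀ v, quadOp T z (quadInv T z₀ v) = v + N z v := by
    intro v
    rw [quadOp_eq_add z z₀, (hQ.1 v).2]
    simp [N, opQuadInv_apply hT hz₀]
  have huv : ∀ v, (u : V →L[ℝ] V) v = v + N z v := fun v => by rw [hu]; rfl
  refine ⟨quadInv T z₀ * ((u⁻¹ : (V →L[ℝ] V)ˣ) : V →L[ℝ] V), fun w => ⟨(hQ.1 _).1, ?_⟩,
    fun v hv => ?_⟩
  · change quadOp T z (quadInv T z₀ _) = w
    rw [hNv, ← huv]
    change ((u : V →L[ℝ] V) * ((u⁻¹ : (V →L[ℝ] V)ˣ) : V →L[ℝ] V)) w = w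
    rw [u.mul_inv]; rfl
  · have h1 := hQ.2 v hv
    conv_lhs => rw [← h1, hNv, ← huv]
    change (quadInv T z₀ * (((u⁻¹ : (V →L[ℝ] V)ˣ) : V →L[ℝ] V) * (u : V →L[ℝ] V))) _ = v
    rw [u.inv_mul, mul_one, h1]

/-- Near `z₀`, the resolvent identity gives `R(z) = (1 + (z - z₀) R(z₀))⁻¹ R(z₀)`. -/
lemma differentiableOn_cxResolvent [CompleteSpace V] [Module ℝ K] [IsScalarTower ℝ K V]
    {T : V →ₗ.[K] V} (hT : HasBoundedComp T) :
    DifferentiableOn ℂ (cxResolvent T) (cxResolventSet T) := by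
  intro z₀ hz₀
  refine DifferentiableAt.differentiableWithinAt ?_
  set R₀ := cxResolvent T z₀ with hR₀
  have h1 : DifferentiableAt ℂ (fun z => 1 + (z - z₀) • R₀) z₀ := by fun_prop
  have h2 : DifferentiableAt ℂ (fun z => Ring.inverse (1 + (z - z₀) • R₀) * R₀) z₀ := by
    refine DifferentiableAt.mul ?_ (differentiableAt_const _)
    have h3 : DifferentiableAt ℂ Ring.inverse ((fun z => 1 + (z - z₀) • R₀) z₀) := by
      simp only [sub_self, zero_smul, add_zero]
      exact differentiableAt_inverse (𝕜 := ℂ) isUnit_one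
    exact h3.comp z₀ h1
  refine h2.congr_of_eventuallyEq ?_
  have hu : ∀ᶠ z in 𝓝 z₀, IsUnit (1 + (z - z₀) • R₀) := by
    refine h1.continuousAt.eventually (Units.isOpen.mem_nhds ?_)
    simp
  filter_upwards [hu, (isOpen_cxResolventSet hT).mem_nhds hz₀] with z hz hzρ
  have h4 := cxResolvent_sub hT hz₀ hzρ
  have h5 : (1 + (z - z₀) • R₀) * cxResolvent T z = R₀ := by
    rw [add_mul, one_mul, smul_mul_assoc, ← h4]; abel
  calc cxResolvent T z = Ring.inverse (1 + (z - z₀) • R₀) * (1 + (z - z₀) • R₀) *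
        cxResolvent T z := by rw [Ring.inverse_mul_cancel _ hz, one_mul]
    _ = Ring.inverse (1 + (z - z₀) • R₀) * R₀ := by rw [mul_assoc, h5]

end Resolvent

/-! ### Derivatives of functions with values in a finite-dimensional algebra -/

section Calculus

variable {X E G : Type*} [AddCommGroup X] [Module ℝ X] [TopologicalSpace X]
  [AddCommGroup E] [Module ℝ E] [TopologicalSpace E] [AddCommGroup G] [Module ℝ G]
  [TopologicalSpace G]

lemma hasFDerivAtFilter_clm_comp (ℓ : E →L[ℝ] G) {f : X → E} {f' : X →L[ℝ] E} {L : Filter (X × X)}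
    (h : HasFDerivAtFilter f f' L) : HasFDerivAtFilter (fun x => ℓ (f x)) (ℓ ∘L f') L := by
  refine HasFDerivAtFilter.of_isLittleOTVS ?_
  have := (ℓ.isBigOTVS_comp (f := fun p : X × X => f p.1 - f p.2 - f' (p.1 - p.2))).trans_isLittleOTVS
    h.isLittleOTVS
  refine this.congr_left fun p => ?_
  simp

lemma differentiableOn_clm_comp (ℓ : E →L[ℝ] G) {f : X → E} {D : Set X}
    (h : DifferentiableOn ℝ f D) : DifferentiableOn ℝ (fun x => ℓ (f x)) D := fun x hx => by
  obtain ⟨f', hf'⟩ := h x hx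
  exact ⟨_, hasFDerivAtFilter_clm_comp ℓ hf'⟩

variable [ContinuousSMul ℝ E] [ContinuousSMul ℝ G]

lemma hasDerivAt_clm_comp (ℓ : E →L[ℝ] G) {f : ℝ → E} {a : E} {x : ℝ} (h : HasDerivAt f a x) :
    HasDerivAt (fun x => ℓ (f x)) (ℓ a) x := by
  have := hasFDerivAtFilter_clm_comp ℓ h
  have e : ℓ ∘L ContinuousLinearMap.toSpanSingleton ℝ a =
      ContinuousLinearMap.toSpanSingleton ℝ (ℓ a) := by ext; simp
  rw [e] at this
  exact this

end Calculus

section Algebra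

variable {F : Type*} [Ring F] [Algebra ℝ F] [TopologicalSpace F] [IsTopologicalAddGroup F]
  [ContinuousSMul ℝ F] [T2Space F] [FiniteDimensional ℝ F]

variable (F) in
/-- The multiplication of a finite-dimensional algebra, in Euclidean coordinates. -/
lemma exists_bilinear_coordinates : ∃ (n : ℕ) (e : F ≃L[ℝ] EuclideanSpace ℝ (Fin n))
    (μ : EuclideanSpace ℝ (Fin n) →L[ℝ] EuclideanSpace ℝ (Fin n) →L[ℝ] EuclideanSpace ℝ (Fin n)),
    ∀ a b, e (a * b) = μ (e a) (e b) := by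
  let e : F ≃L[ℝ] EuclideanSpace ℝ (Fin (Module.finrank ℝ F)) := toEuclidean
  let μ : EuclideanSpace ℝ (Fin (Module.finrank ℝ F)) →ₗ[ℝ]
      EuclideanSpace ℝ (Fin (Module.finrank ℝ F)) →ₗ[ℝ]
        EuclideanSpace ℝ (Fin (Module.finrank ℝ F)) :=
    LinearMap.mk₂ ℝ (fun x y => e (e.symm x * e.symm y)) (by simp [add_mul]) (by simp)
      (by simp [mul_add]) (by simp)
  exact ⟨_, e, LinearMap.toContinuousLinearMap
    ((LinearMap.toContinuousLinearMap : _ ≃ₗ[ℝ] _).toLinearMap ∘ₗ μ), fun a b => by simp [μ]⟩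

lemma differentiableOn_mul {X : Type*} [NormedAddCommGroup X] [NormedSpace ℝ X] {f g : X → F}
    {D : Set X} (hf : DifferentiableOn ℝ f D) (hg : DifferentiableOn ℝ g D) :
    DifferentiableOn ℝ (fun x => f x * g x) D := by
  obtain ⟨n, e, μ, hμ⟩ := exists_bilinear_coordinates F
  have h : DifferentiableOn ℝ (fun x => μ (e (f x)) (e (g x))) D :=
    (μ.differentiable.comp_differentiableOn
      (differentiableOn_clm_comp (e : F →L[ℝ] _) hf)).clm_apply
      (differentiableOn_clm_comp (e : F →L[ℝ] _) hg)
  have := differentiableOn_clm_comp (e.symm : _ →L[ℝ] F) h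
  refine this.congr fun x _ => ?_
  simp [← hμ]

lemma hasDerivAt_mul {f g : ℝ → F} {a b : F} {x : ℝ} (hf : HasDerivAt f a x)
    (hg : HasDerivAt g b x) : HasDerivAt (fun x => f x * g x) (a * g x + f x * b) x := by
  obtain ⟨n, e, μ, hμ⟩ := exists_bilinear_coordinates F
  have hf' := hasDerivAt_clm_comp (e : F →L[ℝ] EuclideanSpace ℝ (Fin n)) hf
  have hg' := hasDerivAt_clm_comp (e : F →L[ℝ] EuclideanSpace ℝ (Fin n)) hg
  have h := (μ.hasFDerivAt.comp_hasDerivAt x hf').clm_apply hg'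
  have := hasDerivAt_clm_comp (e.symm : _ →L[ℝ] F) h
  simp only [Function.comp_def, ContinuousLinearEquiv.coe_coe, ← hμ, map_add,
    ContinuousLinearEquiv.symm_apply_apply] at this
  exact this

lemma hasDerivAt_fun_add {f g : ℝ → F} {a b : F} {x : ℝ} (hf : HasDerivAt f a x)
    (hg : HasDerivAt g b x) : HasDerivAt (fun x => f x + g x) (a + b) x := by
  obtain ⟨n, e, -⟩ := exists_bilinear_coordinates F
  have hf' := hasDerivAt_clm_comp (e : F →L[ℝ] EuclideanSpace ℝ (Fin n)) hf
  have hg' := hasDerivAt_clm_comp (e : F →L[ℝ] EuclideanSpace ℝ (Fin n)) hg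
  have := hasDerivAt_clm_comp (e.symm : _ →L[ℝ] F) (hf'.add hg')
  simpa [Pi.add_def] using this

omit [T2Space F] [FiniteDimensional ℝ F] in
lemma hasDerivAt_fun_neg {f : ℝ → F} {a : F} {x : ℝ} (hf : HasDerivAt f a x) :
    HasDerivAt (fun x => -f x) (-a) x :=
  hasDerivAt_clm_comp (-ContinuousLinearMap.id ℝ F) hf

lemma tendsto_fun_mul {ι : Type*} {l : Filter ι} {f g : ι → F} {a b : F} (hf : Tendsto f l (𝓝 a))
    (hg : Tendsto g l (𝓝 b)) : Tendsto (fun x => f x * g x) l (𝓝 (a * b)) := by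
  obtain ⟨n, e, μ, hμ⟩ := exists_bilinear_coordinates F
  have h1 : Continuous fun p : F × F => p.1 * p.2 := by
    have : Continuous fun p : F × F => e.symm (μ (e p.1) (e p.2)) := by fun_prop
    simpa only [← hμ, ContinuousLinearEquiv.symm_apply_apply] using this
  exact (h1.tendsto (a, b)).comp (hf.prodMk_nhds hg)

end Algebra

/-! ### The planes of a slice setting -/

namespace SliceSetting

variable {P F : Type*} [NormedAddCommGroup P] [NormedSpace ℝ P] [Ring F] [Algebra ℝ F]
  [Nontrivial F] (S : SliceSetting P F)

omit [Nontrivial F] in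
lemma re_pt {I : P} (hI : I ∈ S.units) (z : ℂ) : S.re (S.pt I z) = z.re := by
  simp [pt, S.re_one, hI.1]

omit [Nontrivial F] in
lemma emb_mul_self_of_mem_units {I : P} (hI : I ∈ S.units) : S.emb I * S.emb I = -1 := by
  rw [S.emb_sq, hI.1, hI.2]; simp

omit [Nontrivial F] in
lemma emb_pt (I : P) (z : ℂ) : S.emb (S.pt I z) = z.re • (1 : F) + z.im • S.emb I := by
  simp [pt, S.emb_one]

lemma smul_one_injective {a b : ℝ} (h : a • (1 : F) = b • (1 : F)) : a = b := by
  rw [← Algebra.algebraMap_eq_smul_one, ← Algebra.algebraMap_eq_smul_one] at h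
  exact (algebraMap ℝ F).injective h

lemma norm_pt {I : P} (hI : I ∈ S.units) (z : ℂ) : ‖S.pt I z‖ = ‖z‖ := by
  have h := S.emb_sq (S.pt I z)
  rw [S.re_pt hI, S.emb_pt] at h
  simp only [mul_add, add_mul, smul_mul_smul_comm, one_mul, mul_one,
    S.emb_mul_self_of_mem_units hI] at h
  have h2 : (‖S.pt I z‖ ^ 2) • (1 : F) = (z.re ^ 2 + z.im ^ 2) • (1 : F) := by
    rw [eq_sub_iff_add_eq, ← eq_sub_iff_add_eq'] at h
    rw [h]
    module
  have h3 : ‖S.pt I z‖ ^ 2 = ‖z‖ ^ 2 := by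
    rw [smul_one_injective h2, Complex.sq_norm, normSq_apply]; ring
  exact (sq_eq_sq₀ (norm_nonneg _) (norm_nonneg _)).1 h3

omit [Nontrivial F] in
lemma neg_mem_units {I : P} (hI : I ∈ S.units) : -I ∈ S.units :=
  ⟨by rw [map_neg, hI.1, neg_zero], by rw [norm_neg, hI.2]⟩

omit [Nontrivial F] in
lemma pt_neg (I : P) (z : ℂ) : S.pt (-I) z = S.pt I ((starRingEnd ℂ) z) := by
  simp [pt]

omit [Nontrivial F] in
lemma conj_pt {I : P} (hI : I ∈ S.units) (z : ℂ) :
    S.conj (S.pt I z) = S.pt I ((starRingEnd ℂ) z) := by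
  rw [conj, S.re_pt hI, pt, pt]
  simp only [conj_re, conj_im]
  module

/-- `pt I` as a continuous linear map. -/
def ptL (I : P) : ℂ →L[ℝ] P := reCLM.smulRight S.one + imCLM.smulRight I

omit [Nontrivial F] in
lemma continuous_pt (I : P) : Continuous (S.pt I) := (S.ptL I).continuous

/-- The point `x₀ + i |x - x₀|` of the upper half plane that corresponds to `x`. -/
def toC (x : P) : ℂ := ⟨S.re x, ‖x - S.re x • S.one‖⟩

omit [Nontrivial F] in
lemma exists_pt_toC (hS : S.units.Nonempty) (x : P) : ∃ I ∈ S.units, S.pt I (S.toC x) = x := by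
  set y := x - S.re x • S.one with hy
  have hre : S.re y = 0 := by simp [hy, S.re_one]
  by_cases h : y = 0
  · obtain ⟨I, hI⟩ := hS
    refine ⟨I, hI, ?_⟩
    rw [pt, toC, ← hy, h, norm_zero, zero_smul, add_zero]
    exact (sub_eq_zero.1 (hy ▸ h)).symm
  · have hn : ‖y‖ ≠ 0 := norm_ne_zero_iff.2 h
    refine ⟨‖y‖⁻¹ • y, ⟨by simp [hre], by simp [norm_smul, hn]⟩, ?_⟩
    rw [pt, toC, ← hy, smul_smul, mul_inv_cancel₀ hn, one_smul, hy]
    abel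

lemma abs_re_le (hS : S.units.Nonempty) (x : P) : |S.re x| ≤ ‖x‖ := by
  obtain ⟨I, hI, hx⟩ := S.exists_pt_toC hS x
  rw [← hx, S.norm_pt hI, S.re_pt hI]
  exact abs_re_le_norm _

lemma continuous_toC (hS : S.units.Nonempty) : Continuous S.toC := by
  have hre : Continuous S.re := AddMonoidHomClass.continuous_of_bound S.re 1 fun x => by
    rw [one_mul, Real.norm_eq_abs]; exact S.abs_re_le hS x
  have h : S.toC = fun x => ((S.re x : ℝ) : ℂ) + ((‖x - S.re x • S.one‖ : ℝ) : ℂ) * I := by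
    funext x
    exact Complex.ext (by simp [toC]) (by simp [toC])
  rw [h]
  fun_prop

omit [Nontrivial F] in
lemma toC_pt {I : P} (hI : I ∈ S.units) (z : ℂ) : S.toC (S.pt I z) = ⟨z.re, |z.im|⟩ := by
  have h : S.pt I z - z.re • S.one = z.im • I := by simp [pt]
  rw [toC, S.re_pt hI, h, norm_smul, hI.2, mul_one, Real.norm_eq_abs]

lemma tendsto_pt {I : P} (hI : I ∈ S.units) :
    Tendsto (S.pt I) (Bornology.cobounded ℂ) (Bornology.cobounded P) := by
  rw [← tendsto_norm_atTop_iff_cobounded]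
  simp only [S.norm_pt hI]
  exact tendsto_norm_cobounded_atTop

omit [Nontrivial F] in
lemma slice_eq {U : Set P} (hU : S.AxiallySymmetric U) {I J : P} (hI : I ∈ S.units)
    (hJ : J ∈ S.units) : S.slice I U = S.slice J U :=
  Set.ext fun z => ⟨hU I hI J hJ z, hU J hJ I hI z⟩

omit [Nontrivial F] in
lemma conj_mem_slice {U : Set P} (hU : S.AxiallySymmetric U) {I : P} (hI : I ∈ S.units) {z : ℂ}
    (hz : z ∈ S.slice I U) : (starRingEnd ℂ) z ∈ S.slice I U := by
  change S.pt I ((starRingEnd ℂ) z) ∈ U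
  rw [← S.pt_neg]
  exact hU I hI _ (S.neg_mem_units hI) z hz

variable {V : Type*} [NormedAddCommGroup V] [NormedSpace ℝ V] {K : Type*} [Ring K] [Module K V]

lemma isQInv_pt (T : V →ₗ.[K] V) {I : P} (hI : I ∈ S.units) (z : ℂ) :
    S.IsQInv T (S.pt I z) = IsQuadInv T z := by
  funext B
  simp only [IsQInv, IsQuadInv, qOp, quadOp, S.re_pt hI, S.norm_pt hI]

lemma pt_mem_resolventSet (T : V →ₗ.[K] V) {I : P} (hI : I ∈ S.units) (z : ℂ) :
    S.pt I z ∈ S.resolventSet T ↔ z ∈ cxResolventSet T := by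
  simp only [resolventSet, cxResolventSet, mem_ofPred_eq, S.isQInv_pt T hI]

lemma qInv_pt (T : V →ₗ.[K] V) {I : P} (hI : I ∈ S.units) (z : ℂ) :
    S.qInv T (S.pt I z) = quadInv T z := by
  rw [qInv, quadInv, S.isQInv_pt T hI]

end SliceSetting

/-! ### Holomorphic representations of slice hyperholomorphic functions -/

section CxHol

variable {V : Type*} [NormedAddCommGroup V] [NormedSpace ℝ V]

/-- `H` is a holomorphic function on `Ω` that intertwines the conjugations and has the real limit
`c` at infinity. -/
structure IsCxHol (Ω : Set ℂ) (H : ℂ → CxEnd V) (c : V →L[ℝ] V) : Prop where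
  diff : DifferentiableOn ℂ H Ω
  conj : ∀ z ∈ Ω, H ((starRingEnd ℂ) z) = cxConj (H z)
  lim : Tendsto H (Bornology.cobounded ℂ) (𝓝 (cxMap c))

/-- The partial derivative in the direction of the real axis. -/
lemma hasDerivAt_re_line {E : Type*} [NormedAddCommGroup E] [NormedSpace ℝ E] {g : ℂ → E}
    {g' : ℂ →L[ℝ] E} {z : ℂ} (h : HasFDerivAt g g' z) :
    HasDerivAt (fun t : ℝ => g ⟨t, z.im⟩) (g' 1) z.re := by
  have h1 : HasDerivAt (fun t : ℝ => (⟨t, z.im⟩ : ℂ)) 1 z.re := by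
    have : (fun t : ℝ => (⟨t, z.im⟩ : ℂ)) = fun t : ℝ => (t : ℂ) + (z.im : ℂ) * I := by
      funext t; exact Complex.ext (by simp) (by simp)
    rw [this]
    exact (Complex.ofRealCLM.hasDerivAt).add_const _
  exact HasFDerivAt.comp_hasDerivAt (f := fun t : ℝ => (⟨t, z.im⟩ : ℂ)) z.re h h1

/-- The partial derivative in the direction of the imaginary axis. -/
lemma hasDerivAt_im_line {E : Type*} [NormedAddCommGroup E] [NormedSpace ℝ E] {g : ℂ → E}
    {g' : ℂ →L[ℝ] E} {z : ℂ} (h : HasFDerivAt g g' z) :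
    HasDerivAt (fun t : ℝ => g ⟨z.re, t⟩) (g' I) z.im := by
  have h1 : HasDerivAt (fun t : ℝ => (⟨z.re, t⟩ : ℂ)) I z.im := by
    have : (fun t : ℝ => (⟨z.re, t⟩ : ℂ)) = fun t : ℝ => (z.re : ℂ) + (t : ℂ) * I := by
      funext t; exact Complex.ext (by simp) (by simp)
    rw [this]
    simpa using ((Complex.ofRealCLM.hasDerivAt (x := z.im)).mul_const I).const_add (z.re : ℂ)
  exact HasFDerivAt.comp_hasDerivAt (f := fun t : ℝ => (⟨z.re, t⟩ : ℂ)) z.im h h1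

/-- The operator-valued function `α + iβ`. -/
def cxFun (α β : ℝ → ℝ → (V →L[ℝ] V)) (z : ℂ) : CxEnd V :=
  cxMap (α z.re z.im) + I • cxMap (β z.re z.im)

/-- The Cauchy-Riemann equations make `α + iβ` holomorphic. They only concern partial derivatives;
the real differentiability comes from functions `p`, `q` that agree with `α`, `β` near `z`. -/
lemma differentiableAt_cxFun {α β : ℝ → ℝ → (V →L[ℝ] V)} {p q : ℂ → (V →L[ℝ] V)} {z : ℂ}
    (hp : DifferentiableAt ℝ p z) (hq : DifferentiableAt ℝ q z)
    (hα : ∀ᶠ w in 𝓝 z, α w.re w.im = p w) (hβ : ∀ᶠ w in 𝓝 z, β w.re w.im = q w)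
    {a b : V →L[ℝ] V} (h1 : HasDerivAt (fun t => α t z.im) a z.re)
    (h2 : HasDerivAt (fun t => β z.re t) a z.im) (h3 : HasDerivAt (fun t => β t z.im) b z.re)
    (h4 : HasDerivAt (fun t => α z.re t) (-b) z.im) : DifferentiableAt ℂ (cxFun α β) z := by
  have hH : cxFun α β =ᶠ[𝓝 z] fun w => cxMap (p w) + I • cxMap (q w) := by
    filter_upwards [hα, hβ] with w hw hw'
    rw [cxFun, hw, hw']
  have hd : DifferentiableAt ℝ (cxFun α β) z := by
    refine DifferentiableAt.congr_of_eventuallyEq ?_ hH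
    exact ((cxMap (V := V)).differentiableAt.comp z hp).add
      (((cxMap (V := V)).differentiableAt.comp z hq).const_smul I)
  have e1 : fderiv ℝ (cxFun α β) z 1 = cxMap a + I • cxMap b := by
    refine (hasDerivAt_re_line hd.hasFDerivAt).unique ?_
    exact ((cxMap (V := V)).hasFDerivAt.comp_hasDerivAt z.re h1).add
      (((cxMap (V := V)).hasFDerivAt.comp_hasDerivAt z.re h3).const_smul I)
  have e2 : fderiv ℝ (cxFun α β) z I = cxMap (-b) + I • cxMap a := by
    refine (hasDerivAt_im_line hd.hasFDerivAt).unique ?_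
    exact ((cxMap (V := V)).hasFDerivAt.comp_hasDerivAt z.im h4).add
      (((cxMap (V := V)).hasFDerivAt.comp_hasDerivAt z.im h2).const_smul I)
  rw [differentiableAt_iff_restrictScalars ℝ hd]
  refine ⟨ContinuousLinearMap.toSpanSingleton ℂ (cxMap a + I • cxMap b), ?_⟩
  refine ContinuousLinearMap.ext fun w => ?_
  have hw : w = w.re • (1 : ℂ) + w.im • I := by simp [re_add_im]
  have e3 : fderiv ℝ (cxFun α β) z w =
      w.re • (cxMap a + I • cxMap b) + w.im • (cxMap (-b) + I • cxMap a) := by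
    conv_lhs => rw [hw, map_add, map_smul, map_smul, e1, e2]
  rw [e3]
  change w • (cxMap a + I • cxMap b) = _
  have hI : I • I • cxMap b = -cxMap b := by rw [smul_smul, I_mul_I, neg_one_smul]
  conv_lhs => rw [← re_add_im w, add_smul, mul_smul, smul_add I, hI]
  rw [map_neg, add_comm (-cxMap b)]
  rfl

end CxHol

namespace SliceSetting

variable {P F : Type*} [NormedAddCommGroup P] [NormedSpace ℝ P] [Ring F] [Algebra ℝ F]
  [Nontrivial F] [TopologicalSpace F] [IsTopologicalAddGroup F] [ContinuousSMul ℝ F] [T2Space F]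
  [FiniteDimensional ℝ F] {S : SliceSetting P F}
  {V : Type*} [NormedAddCommGroup V] [NormedSpace ℝ V]
  (L : F →ₐ[ℝ] (V →L[ℝ] V))

/-- The operator-valued function `L(α) + i L(β)` that represents the slice hyperholomorphic function
with the components `α`, `β`, where `L` is the action of the algebra on `V`. -/
def cxRep (L : F →ₐ[ℝ] (V →L[ℝ] V)) (α β : ℝ → ℝ → F) : ℂ → CxEnd V :=
  cxFun (fun x y => L (α x y)) fun x y => L (β x y)

/-- The action of the algebra on `V` as a continuous linear map. -/
def actL : F →L[ℝ] (V →L[ℝ] V) := LinearMap.toContinuousLinearMap L.toLinearMap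

/-- The part common to left and right slice hyperholomorphic functions: the components are recovered
from the values at conjugate points by `α = p` and `β = q`. -/
lemma isCxHol_cxRep {D : Set P} {α β : ℝ → ℝ → F} (hαβ : S.IsHolPair D α β) (hD : IsOpen D)
    {I' : P} (hI : I' ∈ S.units) {r : ℝ} (hr : ∀ s : P, r < ‖s‖ → s ∈ D) {c : F}
    {p q : ℂ → (V →L[ℝ] V)} (hp : DifferentiableOn ℝ p (S.slice I' D))
    (hq : DifferentiableOn ℝ q (S.slice I' D))
    (hα : ∀ z ∈ S.slice I' D, L (α z.re z.im) = p z)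
    (hβ : ∀ z ∈ S.slice I' D, L (β z.re z.im) = q z)
    (hpc : Tendsto p (Bornology.cobounded ℂ) (𝓝 (L c)))
    (hqc : Tendsto q (Bornology.cobounded ℂ) (𝓝 0)) :
    IsCxHol (S.slice I' D) (cxRep L α β) (L c) := by
  have hΩ : IsOpen (S.slice I' D) := hD.preimage (S.continuous_pt I')
  refine ⟨fun z hz => ?_, fun z hz => ?_, ?_⟩
  · obtain ⟨a, b, h1, h2, h3, h4⟩ := hαβ.cauchyRiemann I' hI z hz
    have hzn := hΩ.mem_nhds hz
    have h4' := hasDerivAt_clm_comp (actL L) h4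
    rw [map_neg] at h4'
    refine (differentiableAt_cxFun (hp.differentiableAt hzn) (hq.differentiableAt hzn)
      (by filter_upwards [hzn] with w hw using hα w hw)
      (by filter_upwards [hzn] with w hw using hβ w hw)
      (hasDerivAt_clm_comp (actL L) h1) (hasDerivAt_clm_comp (actL L) h2)
      (hasDerivAt_clm_comp (actL L) h3) h4').differentiableWithinAt
  · rw [cxRep, cxFun, cxFun, cxConj_add_smul]
    simp only [conj_re, conj_im]
    rw [hαβ.even I' hI z hz, hαβ.odd I' hI z hz, map_neg, map_neg, smul_neg, sub_eq_add_neg]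
  · have h1 : Tendsto (fun z => cxMap (p z) + I • cxMap (q z)) (Bornology.cobounded ℂ)
        (𝓝 (cxMap (L c) + I • cxMap (0 : V →L[ℝ] V))) :=
      (((cxMap (V := V)).continuous.tendsto _).comp hpc).add
        ((((cxMap (V := V)).continuous.tendsto _).comp hqc).const_smul I)
    rw [map_zero, smul_zero, add_zero] at h1
    refine h1.congr' ?_
    have hlarge : ∀ᶠ z : ℂ in Bornology.cobounded ℂ, r < ‖z‖ :=
      tendsto_norm_cobounded_atTop.eventually_gt_atTop r
    filter_upwards [hlarge] with z hz
    have hzD : z ∈ S.slice I' D := hr _ (by rw [S.norm_pt hI]; exact hz)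
    rw [cxRep, cxFun, hα z hzD, hβ z hzD]

omit [Nontrivial F] in
lemma differentiableOn_act_pt {D : Set P} {f : P → F} (hf : DifferentiableOn ℝ f D) (I' : P) :
    DifferentiableOn ℝ (fun z => L (f (S.pt I' z))) (S.slice I' D) :=
  (differentiableOn_clm_comp (actL L) hf).comp (S.ptL I').differentiable.differentiableOn
    fun _ hz => hz

omit [Nontrivial F] in
lemma differentiableOn_act_pt_conj {D : Set P} (hD : S.AxiallySymmetric D) {f : P → F}
    (hf : DifferentiableOn ℝ f D) {I' : P} (hI : I' ∈ S.units) :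
    DifferentiableOn ℝ (fun z => L (f (S.pt I' ((starRingEnd ℂ) z)))) (S.slice I' D) :=
  (differentiableOn_act_pt L hf I').comp conjCLE.differentiable.differentiableOn
    fun _ hz => S.conj_mem_slice hD hI hz

lemma tendsto_act_pt {f : P → F} {c : F} (hf : Tendsto f (Bornology.cobounded P) (𝓝 c)) {I' : P}
    (hI : I' ∈ S.units) :
    Tendsto (fun z => L (f (S.pt I' z))) (Bornology.cobounded ℂ) (𝓝 (L c)) :=
  ((actL L).continuous.tendsto c).comp (hf.comp (S.tendsto_pt hI))

lemma tendsto_act_pt_conj {f : P → F} {c : F} (hf : Tendsto f (Bornology.cobounded P) (𝓝 c))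
    {I' : P} (hI : I' ∈ S.units) :
    Tendsto (fun z => L (f (S.pt I' ((starRingEnd ℂ) z)))) (Bornology.cobounded ℂ) (𝓝 (L c)) := by
  have h := tendsto_act_pt L hf (S.neg_mem_units hI)
  simpa only [S.pt_neg] using h

/-- The components are recovered from the values by `α = (f(x₀ + I x₁) + f(x₀ - I x₁)) / 2` and
`β = -I (f(x₀ + I x₁) - f(x₀ - I x₁)) / 2`. -/
theorem isCxHol_of_left {K : Type*} [Ring K] [Module K V] {T : V →ₗ.[K] V} {D : Set P}
    (hD : S.IsSpectralNhd T D) {f : P → F} (hf : DifferentiableOn ℝ f D)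
    {α β : ℝ → ℝ → F} (hαβ : S.IsHolPair D α β) {I' : P} (hI : I' ∈ S.units)
    (hfαβ : ∀ z : ℂ, S.pt I' z ∈ D → f (S.pt I' z) = α z.re z.im + S.emb I' * β z.re z.im)
    {c : F} (hc : Tendsto f (Bornology.cobounded P) (𝓝 c)) :
    IsCxHol (S.slice I' D) (cxRep L α β) (L c) := by
  obtain ⟨r, -, hr⟩ := hD.infinity
  have hd1 := differentiableOn_act_pt (S := S) L hf I'
  have hd2 := differentiableOn_act_pt_conj L hD.axial hf hI
  have ht1 := tendsto_act_pt L hc hI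
  have ht2 := tendsto_act_pt_conj L hc hI
  have hconj : ∀ z ∈ S.slice I' D, f (S.pt I' ((starRingEnd ℂ) z)) =
      α z.re z.im - S.emb I' * β z.re z.im := by
    intro z hz
    rw [hfαβ _ (S.conj_mem_slice hD.axial hI hz), conj_re, conj_im, hαβ.even I' hI z hz,
      hαβ.odd I' hI z hz, mul_neg, sub_eq_add_neg]
  have hd3 : DifferentiableOn ℝ (fun z => (1 / 2 : ℝ) • (L (f (S.pt I' z)) -
      L (f (S.pt I' ((starRingEnd ℂ) z))))) (S.slice I' D) :=
    (hd1.fun_sub hd2).fun_const_smul _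
  refine isCxHol_cxRep L hαβ hD.isOpen hI hr
    (p := fun z => (1 / 2 : ℝ) • (L (f (S.pt I' z)) + L (f (S.pt I' ((starRingEnd ℂ) z)))))
    (q := fun z => -L (S.emb I') *
      ((1 / 2 : ℝ) • (L (f (S.pt I' z)) - L (f (S.pt I' ((starRingEnd ℂ) z))))))
    ((hd1.fun_add hd2).fun_const_smul _) (hd3.const_mul _)
    (fun z hz => ?_) (fun z hz => ?_) ?_ ?_
  · rw [← map_add, ← map_smul, hconj z hz, hfαβ z hz]
    congr 1
    module
  · rw [← map_sub, ← map_smul, ← map_neg, ← map_mul, hconj z hz, hfαβ z hz]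
    congr 1
    have h1 : (1 / 2 : ℝ) • (α z.re z.im + S.emb I' * β z.re z.im -
        (α z.re z.im - S.emb I' * β z.re z.im)) = S.emb I' * β z.re z.im := by module
    rw [h1, neg_mul, ← mul_assoc, S.emb_mul_self_of_mem_units hI, neg_one_mul, neg_neg]
  · have h2 := (ht1.add ht2).const_smul (1 / 2 : ℝ)
    have h3 : (1 / 2 : ℝ) • (L c + L c) = L c := by module
    rwa [h3] at h2
  · have h2 := ((ht1.sub ht2).const_smul (1 / 2 : ℝ)).const_mul (-L (S.emb I'))
    rwa [sub_self, smul_zero, mul_zero] at h2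

/-- The components are recovered as in the left case, with the factor `-I` on the right. -/
theorem isCxHol_of_right {K : Type*} [Ring K] [Module K V] {T : V →ₗ.[K] V} {D : Set P}
    (hD : S.IsSpectralNhd T D) {f : P → F} (hf : DifferentiableOn ℝ f D)
    {α β : ℝ → ℝ → F} (hαβ : S.IsHolPair D α β) {I' : P} (hI : I' ∈ S.units)
    (hfαβ : ∀ z : ℂ, S.pt I' z ∈ D → f (S.pt I' z) = α z.re z.im + β z.re z.im * S.emb I')
    {c : F} (hc : Tendsto f (Bornology.cobounded P) (𝓝 c)) :
    IsCxHol (S.slice I' D) (cxRep L α β) (L c) := by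
  obtain ⟨r, -, hr⟩ := hD.infinity
  have hd1 := differentiableOn_act_pt (S := S) L hf I'
  have hd2 := differentiableOn_act_pt_conj L hD.axial hf hI
  have ht1 := tendsto_act_pt L hc hI
  have ht2 := tendsto_act_pt_conj L hc hI
  have hconj : ∀ z ∈ S.slice I' D, f (S.pt I' ((starRingEnd ℂ) z)) =
      α z.re z.im - β z.re z.im * S.emb I' := by
    intro z hz
    rw [hfαβ _ (S.conj_mem_slice hD.axial hI hz), conj_re, conj_im, hαβ.even I' hI z hz,
      hαβ.odd I' hI z hz, neg_mul, sub_eq_add_neg]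
  have hd3 : DifferentiableOn ℝ (fun z => (1 / 2 : ℝ) • (L (f (S.pt I' z)) -
      L (f (S.pt I' ((starRingEnd ℂ) z))))) (S.slice I' D) :=
    (hd1.fun_sub hd2).fun_const_smul _
  refine isCxHol_cxRep L hαβ hD.isOpen hI hr
    (p := fun z => (1 / 2 : ℝ) • (L (f (S.pt I' z)) + L (f (S.pt I' ((starRingEnd ℂ) z)))))
    (q := fun z => ((1 / 2 : ℝ) • (L (f (S.pt I' z)) - L (f (S.pt I' ((starRingEnd ℂ) z))))) *
      -L (S.emb I'))
    ((hd1.fun_add hd2).fun_const_smul _) (hd3.mul_const _)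
    (fun z hz => ?_) (fun z hz => ?_) ?_ ?_
  · rw [← map_add, ← map_smul, hconj z hz, hfαβ z hz]
    congr 1
    module
  · rw [← map_sub, ← map_smul, ← map_neg, ← map_mul, hconj z hz, hfαβ z hz]
    congr 1
    have h1 : (1 / 2 : ℝ) • (α z.re z.im + β z.re z.im * S.emb I' -
        (α z.re z.im - β z.re z.im * S.emb I')) = β z.re z.im * S.emb I' := by module
    rw [h1, mul_neg, mul_assoc, S.emb_mul_self_of_mem_units hI, mul_neg_one, neg_neg]
  · have h2 := (ht1.add ht2).const_smul (1 / 2 : ℝ)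
    have h3 : (1 / 2 : ℝ) • (L c + L c) = L c := by module
    rwa [h3] at h2
  · have h2 := ((ht1.sub ht2).const_smul (1 / 2 : ℝ)).mul_const (-L (S.emb I'))
    rwa [sub_self, smul_zero, zero_mul] at h2

end SliceSetting

/-! ### Integrals of conjugation invariant functions -/

section CalcCycle

/-- `Γ` is the oriented boundary of a conjugation invariant open neighborhood `W` of `ρᶜ` and of
infinity, whose closure lies in `Ω`. -/
structure IsCalcCycle (ρ Ω W : Set ℂ) {m : ℕ} (Γ : Fin m → ℝ → ℂ) : Prop
    extends IsCycleAround W Γ where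
  isOpen : IsOpen W
  bounded : Bornology.IsBounded Wᶜ
  conj : ∀ z ∈ W, (starRingEnd ℂ) z ∈ W
  compl_subset : ρᶜ ⊆ W
  closure_subset : closure W ⊆ Ω

variable {ρ Ω W W' : Set ℂ} {m m' : ℕ} {Γ : Fin m → ℝ → ℂ} {Γ' : Fin m' → ℝ → ℂ}

lemma IsCalcCycle.frontier_subset (h : IsCalcCycle ρ Ω W Γ) : frontier W ⊆ Ω ∩ ρ := fun z hz => by
  refine ⟨h.closure_subset (frontier_subset_closure hz), ?_⟩
  by_contra hzρ
  rw [h.isOpen.frontier_eq] at hz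
  exact hz.2 (h.compl_subset hzρ)

lemma IsCalcCycle.mono {Ω' : Set ℂ} (h : IsCalcCycle ρ Ω W Γ) (hΩ : Ω ⊆ Ω') :
    IsCalcCycle ρ Ω' W Γ :=
  { h with closure_subset := h.closure_subset.trans hΩ }

variable {E : Type*} [NormedAddCommGroup E] [NormedSpace ℂ E] [CompleteSpace E]

/-- The integrals over all such cycles agree, since any two of them are homologous in `Ω ∩ ρ`. -/
lemma IsCalcCycle.cInt_eq (h : IsCalcCycle ρ Ω W Γ) (h' : IsCalcCycle ρ Ω W' Γ') (hΩ : IsOpen Ω)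
    (hρ : IsOpen ρ) {Φ : ℂ → E} (hΦ : DifferentiableOn ℂ Φ (Ω ∩ ρ)) : cInt Γ Φ = cInt Γ' Φ := by
  refine cInt_eq_cInt h.toIsCycleAround h'.toIsCycleAround h.isOpen h'.isOpen h.bounded h'.bounded
    (hΩ.inter hρ) (fun z hz hz' => ⟨?_, ?_⟩) hΦ
  · rcases hz with hz | hz
    · exact h.closure_subset hz
    · exact h'.closure_subset hz
  · by_contra hzρ
    exact hz' ⟨h.compl_subset hzρ, h'.compl_subset hzρ⟩

/-- The reflected cycle is homologous to `Γ` with the opposite sign. -/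
lemma IsCalcCycle.conj_cInt (h : IsCalcCycle ρ Ω W Γ) (hΩ : IsOpen Ω) (hρ : IsOpen ρ)
    (c : E →L⋆[ℂ] E) {Φ : ℂ → E} (hΦ : DifferentiableOn ℂ Φ (Ω ∩ ρ))
    (hc : ∀ z ∈ Ω ∩ ρ, Φ ((starRingEnd ℂ) z) = c (Φ z)) : c (cInt Γ Φ) = -cInt Γ Φ := by
  have hr : IsCalcCycle ρ Ω W (conjReverse Γ) :=
    { h with toIsCycleAround := h.toIsCycleAround.conjReverse h.conj }
  have hconj : ∀ z ∈ frontier W, (starRingEnd ℂ) z ∈ frontier W := by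
    intro z hz
    have himg : (conjCLE.toHomeomorph : ℂ → ℂ) '' W = W := by
      ext z
      constructor
      · rintro ⟨w, hw, rfl⟩
        exact h.conj w hw
      · exact fun hz => ⟨(starRingEnd ℂ) z, h.conj z hz, conj_conj z⟩
    rw [← himg, ← Homeomorph.image_frontier]
    exact ⟨z, hz, rfl⟩
  have h1 := cInt_conjReverse c (Γ := Γ) (Φ := Φ) fun ℓ =>
    h.toIsCycleAround.intervalIntegrable h.frontier_subset hΦ.continuousOn ℓ
  have h2 : cInt (conjReverse Γ) (fun z => c (Φ ((starRingEnd ℂ) z))) = cInt (conjReverse Γ) Φ :=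
    hr.toIsCycleAround.cInt_congr fun z hz => by
      rw [← hc _ (h.frontier_subset (hconj z hz)), conj_conj]
  rw [h2, hr.cInt_eq h hΩ hρ hΦ] at h1
  rw [eq_comm, neg_eq_iff_eq_neg]
  exact h1

end CalcCycle

/-! ### Real parts of contour integrals -/

section Real

variable {V : Type*} [NormedAddCommGroup V] [NormedSpace ℝ V]

lemma cxRe_cxConj (X : CxEnd V) : cxRe (cxConj X) = cxRe X := by
  rw [cxConj_apply, map_sub, cxRe_cxMap, cxRe_I_smul_cxMap, sub_zero]

/-- An operator that is anti-invariant under conjugation is purely imaginary. -/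
lemma cxRe_eq_zero_of_cxConj_eq_neg {X : CxEnd V} (h : cxConj X = -X) : cxRe X = 0 := by
  have h1 := cxRe_cxConj X
  rw [h, map_neg] at h1
  have h2 : (2 : ℝ) • cxRe X = 0 := by
    rw [two_smul]
    nth_rewrite 1 [← h1]
    exact neg_add_cancel _
  exact (smul_eq_zero.1 h2).resolve_left two_ne_zero

lemma cxMap_mul (A B : V →L[ℝ] V) : cxMap (A * B) = cxMap A * cxMap B := rfl

lemma cx_mul_cx (A B C D : V →L[ℝ] V) :
    (cxMap A + I • cxMap B) * (cxMap C + I • cxMap D) =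
      cxMap (A * C - B * D) + I • cxMap (A * D + B * C) := by
  simp only [map_sub, map_add, cxMap_mul, mul_add, add_mul, smul_mul_assoc, mul_smul_comm,
    smul_smul, I_mul_I, smul_add, neg_smul, one_smul]
  abel

lemma smul_cx (w : ℂ) (A B : V →L[ℝ] V) : w • (cxMap A + I • cxMap B) =
    cxMap (w.re • A - w.im • B) + I • cxMap (w.re • B + w.im • A) := by
  have hI : I • I • cxMap B = -cxMap B := by rw [smul_smul, I_mul_I, neg_one_smul]
  conv_lhs => rw [← re_add_im w, add_smul, mul_smul, smul_add I, hI]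
  have h : ∀ (r : ℝ) (X : CxEnd V), (r : ℂ) • X = r • X := fun r X => rfl
  simp only [h, map_sub, map_add, map_smul, smul_add, smul_neg]
  rw [smul_comm I w.re, smul_comm I w.im]
  abel

lemma cxRe_cx (A B : V →L[ℝ] V) : cxRe (cxMap A + I • cxMap B) = A := by
  rw [map_add, cxRe_cxMap, cxRe_I_smul_cxMap, add_zero]

lemma cxRe_neg_I_smul_cx (A B : V →L[ℝ] V) : cxRe (-I • (cxMap A + I • cxMap B)) = B := by
  rw [smul_cx, cxRe_cx]; simp

/-- The integrand of the left calculus, with the imaginary unit `j` acting on `V`, in terms of the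
complexification, where `i` and `j` are independent. -/
lemma left_integrand_eq {A B a b j : V →L[ℝ] V} (hj : j * j = -1) (w : ℂ) :
    (A + B * j) * (-j * (w.re • 1 + w.im • j) * (a + j * b)) =
      cxRe (-I • (w • ((cxMap A + I • cxMap B) * (cxMap a + I • cxMap b))) -
        w • ((cxMap A + I • cxMap B) * (cxMap j * (cxMap a + I • cxMap b)))) := by
  have e : cxMap j * (cxMap a + I • cxMap b) = cxMap (j * a) + I • cxMap (j * b) := by
    rw [mul_add, mul_smul_comm, cxMap_mul, cxMap_mul]
  rw [e, cx_mul_cx, cx_mul_cx, smul_cx, map_sub, cxRe_neg_I_smul_cx, smul_cx, cxRe_cx]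
  have hjj : ∀ x, j * (j * x) = -x := fun x => by rw [← mul_assoc, hj, neg_one_mul]
  simp only [mul_add, add_mul, neg_mul, mul_neg, smul_mul_assoc, mul_smul_comm, mul_assoc, hjj, hj,
    one_mul, mul_one, smul_add, smul_sub, smul_neg, neg_neg]
  abel

/-- The integrand of the right calculus in terms of the complexification. -/
lemma right_integrand_eq {A B a b j : V →L[ℝ] V} (hj : j * j = -1) (w : ℂ) :
    ((a + b * j) * -j * (w.re • 1 + w.im • j)) * (A + j * B) =
      cxRe (-I • (w • ((cxMap a + I • cxMap b) * (cxMap A + I • cxMap B))) -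
        w • ((cxMap a + I • cxMap b) * (cxMap j * (cxMap A + I • cxMap B)))) := by
  have e : cxMap j * (cxMap A + I • cxMap B) = cxMap (j * A) + I • cxMap (j * B) := by
    rw [mul_add, mul_smul_comm, cxMap_mul, cxMap_mul]
  rw [e, cx_mul_cx, cx_mul_cx, smul_cx, map_sub, cxRe_neg_I_smul_cx, smul_cx, cxRe_cx]
  have hjj : ∀ x, j * (j * x) = -x := fun x => by rw [← mul_assoc, hj, neg_one_mul]
  simp only [mul_add, add_mul, neg_mul, mul_neg, smul_mul_assoc, mul_smul_comm, mul_assoc, hjj, hj,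
    mul_one, smul_add, smul_sub, smul_neg, neg_neg]
  abel

variable [CompleteSpace V] {W : Set ℂ} {m : ℕ} {Γ : Fin m → ℝ → ℂ}

lemma sum_integral_cxRe (h : IsCycleAround W Γ) {Φ Ψ : ℂ → CxEnd V}
    (hΦ : ContinuousOn Φ (frontier W)) (hΨ : ContinuousOn Ψ (frontier W)) :
    ∑ ℓ, ∫ t in (0 : ℝ)..1, cxRe (-I • (deriv (Γ ℓ) t • Φ (Γ ℓ t)) - deriv (Γ ℓ) t • Ψ (Γ ℓ t)) =
      cxRe (-I • cInt Γ Φ - cInt Γ Ψ) := by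
  have hΦ' : ContinuousOn (fun z => -I • Φ z) (frontier W) :=
    (continuousOn_const (c := -I)).smul hΦ
  have h1 : -I • cInt Γ Φ - cInt Γ Ψ = cInt Γ (fun z => -I • Φ z - Ψ z) := by
    rw [h.cInt_sub hΦ' hΨ, cInt_smul]
  have hc : ContinuousOn (fun z => -I • Φ z - Ψ z) (frontier W) :=
    ContinuousOn.sub hΦ' hΨ
  rw [h1, cInt, map_sum]
  refine Finset.sum_congr rfl fun ℓ _ => ?_
  rw [← (cxRe (V := V)).intervalIntegral_comp_comm (h.intervalIntegrable subset_rfl hc ℓ)]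
  simp only [smul_sub, smul_comm (deriv (Γ ℓ) _)]

omit [CompleteSpace V] in
lemma two_pi_inv_smul_cxRe (X : CxEnd V) :
    (2 * Real.pi)⁻¹ • cxRe (-I • X) = cxRe ((2 * Real.pi * I : ℂ)⁻¹ • X) := by
  rw [← map_smul]
  congr 1
  have h : ∀ (r : ℝ) (X : CxEnd V), r • X = (r : ℂ) • X := fun r X => rfl
  rw [h, smul_smul, mul_inv (2 * Real.pi : ℂ), inv_I]
  push_cast
  rfl

end Real

/-! ### Slice Cauchy domains and slice integrals -/

/-- Cycles of this kind exist in every conjugation invariant neighborhood of `ρᶜ` and of infinity.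
-/
lemma exists_isCalcCycle {ρ Ω : Set ℂ} (hρ : IsOpen ρ) (hne : ρ.Nonempty)
    (hρc : ∀ z ∈ ρ, (starRingEnd ℂ) z ∈ ρ) (hΩ : IsOpen Ω) (hΩc : ∀ z ∈ Ω, (starRingEnd ℂ) z ∈ Ω)
    (hΩb : Bornology.IsBounded Ωᶜ) (h : ρᶜ ⊆ Ω) :
    ∃ (W : Set ℂ) (m : ℕ) (Γ : Fin m → ℝ → ℂ), IsCauchyDomain W ∧ IsOrientedBoundary W Γ ∧
      IsCalcCycle ρ Ω W Γ := by
  obtain ⟨z₀, hz₀⟩ := hne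
  -- adding a conjugate pair of points keeps the boundary from being empty
  have hK : IsCompact (Ωᶜ ∪ {z₀, (starRingEnd ℂ) z₀}) :=
    (Metric.isCompact_of_isClosed_isBounded hΩ.isClosed_compl hΩb).union
      (Set.toFinite _).isCompact
  obtain ⟨W, hW, hWb, hWc, hWK, hρW, m, Γ, hΓ⟩ := exists_cauchyDomain hK ⟨z₀, by simp⟩ hρ (by
      rintro z (hz | rfl | rfl)
      · by_contra hzρ
        exact hz (h hzρ)
      · exact hz₀
      · exact hρc _ hz₀) (by
      rintro z (hz | rfl | rfl)
      · left
        intro hz'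
        exact hz (by simpa using hΩc _ hz')
      · simp
      · simp)
  refine ⟨W, m, Γ, hW, hΓ, { hΓ.isCycleAround with
    isOpen := hW.isOpen
    bounded := hWb
    conj := hWc
    compl_subset := hρW
    closure_subset := fun z hz => ?_ }⟩
  by_contra hzΩ
  exact hWK hz (Or.inl hzΩ)

lemma cxConj_cxMap {V : Type*} [NormedAddCommGroup V] [NormedSpace ℝ V] (A : V →L[ℝ] V) :
    cxConj (cxMap A) = cxMap A := by
  have := cxConj_add_smul A 0
  simpa using this

namespace SliceSetting

variable {P F : Type*} [NormedAddCommGroup P] [NormedSpace ℝ P] [Ring F] [Algebra ℝ F]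
  [Nontrivial F] {S : SliceSetting P F}
  {V : Type*} [NormedAddCommGroup V] [NormedSpace ℝ V] {K : Type*} [Ring K] [Module K V]
  {T : V →ₗ.[K] V}

section Domains

lemma compl_cxResolventSet_subset {D : Set P} (hD : S.spectrum T ⊆ D) {I' : P} (hI : I' ∈ S.units) :
    (cxResolventSet T)ᶜ ⊆ S.slice I' D := fun z hz =>
  hD fun h => hz ((S.pt_mem_resolventSet T hI z).1 h)

lemma isCalcCycle_of_isCalcDomain {D U : Set P} (hU : S.IsCalcDomain T D U) {I' : P}
    (hI : I' ∈ S.units) {m : ℕ} {Γ : Fin m → ℝ → ℂ}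
    (hΓ : IsOrientedBoundary (S.slice I' U) Γ) :
    IsCalcCycle (cxResolventSet T) (S.slice I' D) (S.slice I' U) Γ := by
  have hcyc := hΓ.isCycleAround
  have hopen := (hU.cauchy I' hI).isOpen
  refine { hcyc with
    isOpen := hopen
    bounded := ?_
    conj := fun z hz => S.conj_mem_slice hU.axial hI hz
    compl_subset := compl_cxResolventSet_subset hU.spectrum_subset hI
    closure_subset := fun z hz => hU.closure_subset
      (map_mem_closure (S.continuous_pt I') hz fun w hw => hw) }
  refine isBounded_compl_of_isBounded_frontier hopen ?_ fun hb => hU.unbounded ?_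
  · rw [hΓ.frontier_eq]
    exact (isCompact_iUnion fun ℓ =>
      isCompact_Icc.image_of_continuousOn (hcyc.continuousOn ℓ)).isBounded
  · obtain ⟨r, hr⟩ := hb.subset_closedBall 0
    refine (Metric.isBounded_closedBall (x := (0 : P)) (r := r)).subset fun x hx => ?_
    obtain ⟨J, hJ, hxJ⟩ := S.exists_pt_toC ⟨I', hI⟩ x
    have h1 : S.toC x ∈ S.slice I' U := by
      rw [S.slice_eq hU.axial hI hJ]
      change S.pt J (S.toC x) ∈ U
      rwa [hxJ]
    rw [mem_closedBall_zero_iff, ← hxJ, S.norm_pt hJ]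
    exact mem_closedBall_zero_iff.1 (hr h1)

omit [Nontrivial F] in
lemma slice_preimage_toC {W : Set ℂ} (hW : ∀ z ∈ W, (starRingEnd ℂ) z ∈ W) {I' : P}
    (hI : I' ∈ S.units) : S.slice I' (S.toC ⁻¹' W) = W := by
  ext z
  change S.toC (S.pt I' z) ∈ W ↔ z ∈ W
  rw [S.toC_pt hI]
  have hconj : (starRingEnd ℂ) z ∈ W ↔ z ∈ W :=
    ⟨fun h => by simpa using hW _ h, fun h => hW z h⟩
  rcases abs_cases z.im with ⟨h, -⟩ | ⟨h, -⟩
  · rw [h]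
  · rw [h]
    exact hconj

/-- A conjugation invariant Cauchy domain in the plane generates a slice Cauchy domain by rotation.
-/
lemma isCalcDomain_preimage_toC {D : Set P} (hD : S.IsSpectralNhd T D) {I' : P} (hI : I' ∈ S.units)
    {W : Set ℂ} (hW : IsCauchyDomain W) {m : ℕ} {Γ : Fin m → ℝ → ℂ}
    (hcyc : IsCalcCycle (cxResolventSet T) (S.slice I' D) W Γ) :
    S.IsCalcDomain T D (S.toC ⁻¹' W) where
  axial I₁ hI₁ I₂ hI₂ z hz := by
    change z ∈ S.slice I₂ (S.toC ⁻¹' W)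
    rw [slice_preimage_toC hcyc.conj hI₂, ← slice_preimage_toC hcyc.conj hI₁]
    exact hz
  cauchy J hJ := by
    rw [slice_preimage_toC hcyc.conj hJ]
    exact hW
  unbounded hb := by
    obtain ⟨r, hr⟩ := hb.subset_closedBall 0
    refine NormedSpace.unbounded_univ ℝ ℂ ?_
    rw [← union_compl_self W]
    refine Bornology.IsBounded.union ?_ hcyc.bounded
    refine (Metric.isBounded_closedBall (x := (0 : ℂ)) (r := r)).subset fun z hz => ?_
    rw [← slice_preimage_toC hcyc.conj hI] at hz
    have := hr hz
    rwa [mem_closedBall_zero_iff, S.norm_pt hI, ← mem_closedBall_zero_iff] at this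
  spectrum_subset s hs := by
    obtain ⟨J, hJ, hsJ⟩ := S.exists_pt_toC ⟨I', hI⟩ s
    refine hcyc.compl_subset fun h => hs ?_
    rw [← hsJ]
    exact (S.pt_mem_resolventSet T hJ _).2 h
  closure_subset x hx := by
    obtain ⟨J, hJ, hxJ⟩ := S.exists_pt_toC ⟨I', hI⟩ x
    have h1 : S.toC x ∈ closure W :=
      map_mem_closure (S.continuous_toC ⟨I', hI⟩) hx fun w hw => hw
    have h2 := hcyc.closure_subset h1
    rw [S.slice_eq hD.axial hI hJ] at h2
    rw [← hxJ]
    exact h2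

/-- A spectral neighborhood contains a neighborhood of infinity in each plane. -/
lemma isBounded_compl_slice {D : Set P} (hD : S.IsSpectralNhd T D) {I' : P} (hI : I' ∈ S.units) :
    Bornology.IsBounded (S.slice I' D)ᶜ := by
  obtain ⟨r, -, hr⟩ := hD.infinity
  refine (Metric.isBounded_closedBall (x := (0 : ℂ)) (r := r)).subset fun z hz => ?_
  rw [mem_closedBall_zero_iff, ← S.norm_pt hI]
  by_contra! h
  exact hz (hr _ h)

omit [Nontrivial F] in
lemma IsSpectralNhd.inter {D D' : Set P} (h : S.IsSpectralNhd T D) (h' : S.IsSpectralNhd T D') :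
    S.IsSpectralNhd T (D ∩ D') where
  isOpen := h.isOpen.inter h'.isOpen
  axial I₁ hI₁ I₂ hI₂ z hz := ⟨h.axial I₁ hI₁ I₂ hI₂ z hz.1, h'.axial I₁ hI₁ I₂ hI₂ z hz.2⟩
  spectrum_subset := subset_inter h.spectrum_subset h'.spectrum_subset
  infinity := by
    obtain ⟨r, hr, h1⟩ := h.infinity
    obtain ⟨r', -, h2⟩ := h'.infinity
    exact ⟨max r r', lt_max_of_lt_left hr, fun s hs =>
      ⟨h1 s ((le_max_left _ _).trans_lt hs), h2 s ((le_max_right _ _).trans_lt hs)⟩⟩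

end Domains

section Integrals

variable {L : F →ₐ[ℝ] (V →L[ℝ] V)}

omit [Nontrivial F] in
lemma map_emb_mul_self {I' : P} (hI : I' ∈ S.units) : L (S.emb I') * L (S.emb I') = -1 := by
  rw [← map_mul, S.emb_mul_self_of_mem_units hI, map_neg, map_one]

variable [Module F V] (hL : ∀ a v, L a v = a • v)
include hL

omit [Nontrivial F] in
lemma scalarOp_eq (a : F) : scalarOp a = L a := boundedOp_eq (L a) (hL a)

/-- In `S_L⁻¹(s, T) = 𝒬_s(T)⁻¹ s̄ - T 𝒬_s(T)⁻¹`, the part `x₀ 𝒬⁻¹ - T 𝒬⁻¹` and the coefficient `-x₁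
𝒬⁻¹` of the imaginary unit are the real and imaginary parts of the resolvent on the
complexification. -/
lemma leftResolvent_pt (hT : HasBoundedComp T) {I' : P} (hI : I' ∈ S.units) {z : ℂ}
    (hz : z ∈ cxResolventSet T) : S.leftResolvent T (S.pt I' z) =
      (z.re • quadInv T z - opQuadInv T z) + (-z.im • quadInv T z) * L (S.emb I') := by
  refine boundedOp_eq _ fun v => ?_
  rw [S.qInv_pt T hI, S.conj_pt hI, S.emb_pt, ← hL, ← opQuadInv_apply hT hz]
  simp only [conj_re, conj_im, map_add, map_smul, map_one]
  simp
  abel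

lemma rightResolvent_pt (hT : HasBoundedComp T) {I' : P} (hI : I' ∈ S.units) {z : ℂ}
    (hz : z ∈ cxResolventSet T) : S.rightResolvent T (S.pt I' z) =
      (z.re • quadInv T z - opQuadInv T z) + L (S.emb I') * (-z.im • quadInv T z) := by
  refine boundedOp_eq _ fun v => ?_
  rw [S.qInv_pt T hI, S.conj_pt hI, S.emb_pt, ← hL, ← opQuadInv_apply hT hz]
  simp only [conj_re, conj_im, map_add, map_smul, map_one]
  simp
  abel

variable [CompleteSpace V] [Module ℝ K] [IsScalarTower ℝ K V]

/-- The left slice integral is the real part of a contour integral on the complexification: the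
second term in `left_integrand_eq` has a purely imaginary integral. -/
lemma leftIntegral_eq (hT : HasBoundedComp T) {I' : P} (hI : I' ∈ S.units) {Ω W : Set ℂ}
    {m : ℕ} {Γ : Fin m → ℝ → ℂ} (hcyc : IsCalcCycle (cxResolventSet T) Ω W Γ) (hΩ : IsOpen Ω)
    {f : P → F} {α β : ℝ → ℝ → F} {c : V →L[ℝ] V} (hH : IsCxHol Ω (cxRep L α β) c)
    (hf : ∀ z ∈ Ω, f (S.pt I' z) = α z.re z.im + S.emb I' * β z.re z.im) :
    S.leftIntegral T f I' Γ = cxRe (-I • cInt Γ fun z => cxResolvent T z * cxRep L α β z) := by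
  have hR := differentiableOn_cxResolvent hT
  have hΦ : DifferentiableOn ℂ (fun z => cxResolvent T z * cxRep L α β z)
      (Ω ∩ cxResolventSet T) := (hR.mono inter_subset_right).mul (hH.diff.mono inter_subset_left)
  have hΨ : DifferentiableOn ℂ (fun z => cxResolvent T z * (cxMap (L (S.emb I')) * cxRep L α β z))
      (Ω ∩ cxResolventSet T) := (hR.mono inter_subset_right).mul
        ((hH.diff.mono inter_subset_left).const_mul _)
  have h0 := cxRe_eq_zero_of_cxConj_eq_neg (hcyc.conj_cInt hΩ (isOpen_cxResolventSet hT) cxConj hΨ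
    fun z hz => by
      rw [cxResolvent_conj, hH.conj z hz.1, cxConj_mul, cxConj_mul, cxConj_cxMap])
  rw [← sub_zero (cxRe (-I • _)), ← h0, ← map_sub, ← sum_integral_cxRe hcyc.toIsCycleAround
    (hΦ.continuousOn.mono hcyc.frontier_subset) (hΨ.continuousOn.mono hcyc.frontier_subset),
    leftIntegral]
  refine Finset.sum_congr rfl fun ℓ _ => intervalIntegral.integral_congr fun t ht => ?_
  rw [uIcc_of_le zero_le_one] at ht
  have hz := hcyc.frontier_subset (hcyc.mem_frontier ℓ t ht)
  have h1 := left_integrand_eq (A := (Γ ℓ t).re • quadInv T (Γ ℓ t) - opQuadInv T (Γ ℓ t))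
    (B := -(Γ ℓ t).im • quadInv T (Γ ℓ t)) (a := L (α (Γ ℓ t).re (Γ ℓ t).im))
    (b := L (β (Γ ℓ t).re (Γ ℓ t).im)) (map_emb_mul_self (L := L) hI) (deriv (Γ ℓ) t)
  refine Eq.trans ?_ h1
  rw [leftResolvent_pt hL hT hI hz.2, scalarOp_eq hL, hf _ hz.1, S.emb_pt]
  simp only [map_mul, map_add, map_neg, map_smul, map_one]
  rfl

/-- The right slice integral is the real part of a contour integral on the complexification. -/
lemma rightIntegral_eq (hT : HasBoundedComp T) {I' : P} (hI : I' ∈ S.units) {Ω W : Set ℂ}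
    {m : ℕ} {Γ : Fin m → ℝ → ℂ} (hcyc : IsCalcCycle (cxResolventSet T) Ω W Γ) (hΩ : IsOpen Ω)
    {f : P → F} {α β : ℝ → ℝ → F} {c : V →L[ℝ] V} (hH : IsCxHol Ω (cxRep L α β) c)
    (hf : ∀ z ∈ Ω, f (S.pt I' z) = α z.re z.im + β z.re z.im * S.emb I') :
    S.rightIntegral T f I' Γ = cxRe (-I • cInt Γ fun z => cxRep L α β z * cxResolvent T z) := by
  have hR := differentiableOn_cxResolvent hT
  have hΦ : DifferentiableOn ℂ (fun z => cxRep L α β z * cxResolvent T z)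
      (Ω ∩ cxResolventSet T) := (hH.diff.mono inter_subset_left).mul (hR.mono inter_subset_right)
  have hΨ : DifferentiableOn ℂ (fun z => cxRep L α β z * (cxMap (L (S.emb I')) * cxResolvent T z))
      (Ω ∩ cxResolventSet T) := (hH.diff.mono inter_subset_left).mul
        ((hR.mono inter_subset_right).const_mul _)
  have h0 := cxRe_eq_zero_of_cxConj_eq_neg (hcyc.conj_cInt hΩ (isOpen_cxResolventSet hT) cxConj hΨ
    fun z hz => by
      rw [cxResolvent_conj, hH.conj z hz.1, cxConj_mul, cxConj_mul, cxConj_cxMap])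
  rw [← sub_zero (cxRe (-I • _)), ← h0, ← map_sub, ← sum_integral_cxRe hcyc.toIsCycleAround
    (hΦ.continuousOn.mono hcyc.frontier_subset) (hΨ.continuousOn.mono hcyc.frontier_subset),
    rightIntegral]
  refine Finset.sum_congr rfl fun ℓ _ => intervalIntegral.integral_congr fun t ht => ?_
  rw [uIcc_of_le zero_le_one] at ht
  have hz := hcyc.frontier_subset (hcyc.mem_frontier ℓ t ht)
  have h1 := right_integrand_eq (A := (Γ ℓ t).re • quadInv T (Γ ℓ t) - opQuadInv T (Γ ℓ t))
    (B := -(Γ ℓ t).im • quadInv T (Γ ℓ t)) (a := L (α (Γ ℓ t).re (Γ ℓ t).im))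
    (b := L (β (Γ ℓ t).re (Γ ℓ t).im)) (map_emb_mul_self (L := L) hI) (deriv (Γ ℓ) t)
  refine Eq.trans ?_ h1
  rw [rightResolvent_pt hL hT hI hz.2, scalarOp_eq hL, hf _ hz.1, S.emb_pt]
  simp only [map_mul, map_add, map_neg, map_smul, map_one]
  rfl

end Integrals

end SliceSetting

/-! ### The product rule for slice hyperholomorphic functions -/

namespace SliceSetting

variable {P F : Type*} [NormedAddCommGroup P] [NormedSpace ℝ P] [Ring F] [Algebra ℝ F]
  [Nontrivial F] [TopologicalSpace F] [IsTopologicalAddGroup F] [ContinuousSMul ℝ F] [T2Space F]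
  [FiniteDimensional ℝ F] {S : SliceSetting P F}

section HolPair

omit [Nontrivial F] in
/-- The product of holomorphic pairs, as for `(α + iβ) (α' + iβ')` with `i` central. -/
lemma IsHolPair.mul {D D' : Set P} {α β α' β' : ℝ → ℝ → F} (h : S.IsHolPair D α β)
    (h' : S.IsHolPair D' α' β') :
    S.IsHolPair (D ∩ D') (fun x y => α x y * α' x y - β x y * β' x y)
      (fun x y => α x y * β' x y + β x y * α' x y) where
  even J hJ z hz := by
    rw [h.even J hJ z hz.1, h.odd J hJ z hz.1, h'.even J hJ z hz.2, h'.odd J hJ z hz.2, neg_mul_neg]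
  odd J hJ z hz := by
    rw [h.even J hJ z hz.1, h.odd J hJ z hz.1, h'.even J hJ z hz.2, h'.odd J hJ z hz.2]
    noncomm_ring
  cauchyRiemann J hJ z hz := by
    obtain ⟨a, b, h1, h2, h3, h4⟩ := h.cauchyRiemann J hJ z hz.1
    obtain ⟨a', b', h1', h2', h3', h4'⟩ := h'.cauchyRiemann J hJ z hz.2
    have e1 := hasDerivAt_fun_add (hasDerivAt_mul h1 h1')
      (hasDerivAt_fun_neg (hasDerivAt_mul h3 h3'))
    have e2 := hasDerivAt_fun_add (hasDerivAt_mul h4 h2') (hasDerivAt_mul h2 h4')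
    have e3 := hasDerivAt_fun_add (hasDerivAt_mul h1 h3') (hasDerivAt_mul h3 h1')
    have e4 := hasDerivAt_fun_add (hasDerivAt_mul h4 h4')
      (hasDerivAt_fun_neg (hasDerivAt_mul h2 h2'))
    simp only [← sub_eq_add_neg] at e1 e4
    refine ⟨_, _, e1, ?_, e3, ?_⟩
    · convert e2 using 1
      noncomm_ring
    · convert e4 using 1
      noncomm_ring

variable {V : Type*} [NormedAddCommGroup V] [NormedSpace ℝ V]

omit [Nontrivial F] [TopologicalSpace F] [IsTopologicalAddGroup F] [ContinuousSMul ℝ F] [T2Space F]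
  [FiniteDimensional ℝ F] in
/-- The representation is multiplicative, because `i` commutes with the action of the algebra. -/
lemma cxRep_mul (L : F →ₐ[ℝ] (V →L[ℝ] V)) (α β α' β' : ℝ → ℝ → F) (z : ℂ) :
    cxRep L (fun x y => α x y * α' x y - β x y * β' x y)
      (fun x y => α x y * β' x y + β x y * α' x y) z = cxRep L α β z * cxRep L α' β' z := by
  simp only [cxRep, cxFun, cx_mul_cx, map_sub, map_add, map_mul]

omit [Nontrivial F] [TopologicalSpace F] [IsTopologicalAddGroup F] [ContinuousSMul ℝ F] [T2Space F]
  [FiniteDimensional ℝ F] in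
/-- Real components are represented by complex scalars. -/
lemma cxRep_comm (L : F →ₐ[ℝ] (V →L[ℝ] V)) {α β : ℝ → ℝ → F} {z : ℂ}
    (hα : α z.re z.im ∈ range (algebraMap ℝ F)) (hβ : β z.re z.im ∈ range (algebraMap ℝ F))
    (X : CxEnd V) : cxRep L α β z * X = X * cxRep L α β z := by
  obtain ⟨a, ha⟩ := hα
  obtain ⟨b, hb⟩ := hβ
  have h : ∀ r : ℝ, cxMap (L (algebraMap ℝ F r)) = r • (1 : CxEnd V) := fun r => by
    rw [AlgHom.commutes, Algebra.algebraMap_eq_smul_one, map_smul, cxMap_one]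
  rw [cxRep, cxFun, ← ha, ← hb, h, h]
  simp only [add_mul, mul_add, smul_mul_assoc, mul_smul_comm, one_mul, mul_one]

end HolPair

section Calc

variable {V : Type*} [NormedAddCommGroup V] [NormedSpace ℝ V] [CompleteSpace V] {K : Type*} [Ring K]
  [Module K V] [Module ℝ K] [IsScalarTower ℝ K V] {T : V →ₗ.[K] V}
  [Module F V] {L : F →ₐ[ℝ] (V →L[ℝ] V)}

omit [Nontrivial F] [TopologicalSpace F] [IsTopologicalAddGroup F] [ContinuousSMul ℝ F] [T2Space F]
  [FiniteDimensional ℝ F] [Ring K] [Module K V] [Module ℝ K] [IsScalarTower ℝ K V] [Module F V]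
  [Ring F] [Algebra ℝ F] in
/-- The operator on the complexification given by a conjugation invariant integral comes from an
operator on `V`. -/
lemma cxMap_cxRe_calc {ρ Ω W : Set ℂ} {m : ℕ} {Γ : Fin m → ℝ → ℂ} (hcyc : IsCalcCycle ρ Ω W Γ)
    (hΩ : IsOpen Ω) (hρ : IsOpen ρ) {Φ : ℂ → CxEnd V} (hΦ : DifferentiableOn ℂ Φ (Ω ∩ ρ))
    (hc : ∀ z ∈ Ω ∩ ρ, Φ ((starRingEnd ℂ) z) = cxConj (Φ z)) (a : V →L[ℝ] V) :
    cxMap (cxRe (cxMap a + (2 * Real.pi * I : ℂ)⁻¹ • cInt Γ Φ)) =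
      cxMap a + (2 * Real.pi * I : ℂ)⁻¹ • cInt Γ Φ := by
  refine cxMap_cxRe_of_cxConj_eq ?_
  rw [map_add, cxConj_cxMap, map_smulₛₗ, hcyc.conj_cInt hΩ hρ cxConj hΦ hc]
  congr 1
  have h2 : (starRingEnd ℂ) (2 : ℂ) = 2 := map_ofNat _ 2
  rw [map_inv₀, map_mul, map_mul, h2, conj_ofReal, conj_I, mul_neg, inv_neg, neg_smul, smul_neg,
    neg_neg]

/-- To evaluate `f(T)` it suffices to compute one contour integral on the complexification, in a
single plane and over a single cycle. -/
lemma isLeftCalc_of (hL : ∀ a v, L a v = a • v) (hT : HasBoundedComp T) {D : Set P}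
    (hD : S.IsSpectralNhd T D) {f : P → F} (hf : DifferentiableOn ℝ f D) {α β : ℝ → ℝ → F}
    (hαβ : S.IsHolPair D α β) (hfαβ : ∀ J ∈ S.units, ∀ z : ℂ, S.pt J z ∈ D →
      f (S.pt J z) = α z.re z.im + S.emb J * β z.re z.im)
    {c : F} (hc : Tendsto f (Bornology.cobounded P) (𝓝 c)) {I' : P} (hI : I' ∈ S.units)
    {W : Set ℂ} {m : ℕ} {Γ : Fin m → ℝ → ℂ} (hW : IsCauchyDomain W) (hΓ : IsOrientedBoundary W Γ)
    (hcyc : IsCalcCycle (cxResolventSet T) (S.slice I' D) W Γ) {A : V →L[ℝ] V}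
    (hA : cxMap A = cxMap (L c) +
      (2 * Real.pi * I : ℂ)⁻¹ • cInt Γ fun z => cxResolvent T z * cxRep L α β z) :
    S.IsLeftCalc T D f A where
  mem := ⟨hD, ⟨hf, α, β, hαβ, hfαβ⟩, c, hc⟩
  exists_domain := by
    refine ⟨_, isCalcDomain_preimage_toC hD hI hW hcyc, fun J hJ => ⟨m, Γ, ?_⟩⟩
    rwa [slice_preimage_toC hcyc.conj hJ]
  eq_integral := by
    intro c' hc' U hU J hJ k Γ' hΓ'
    have hΩ : IsOpen (S.slice J D) := hD.isOpen.preimage (S.continuous_pt J)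
    have hcyc' := isCalcCycle_of_isCalcDomain hU hJ hΓ'
    have hH := isCxHol_of_left L hD hf hαβ hJ (hfαβ J hJ) hc
    rw [S.slice_eq hD.axial hI hJ] at hcyc
    have hΦ : DifferentiableOn ℂ (fun z => cxResolvent T z * cxRep L α β z)
        (S.slice J D ∩ cxResolventSet T) :=
      ((differentiableOn_cxResolvent hT).mono inter_subset_right).mul
        (hH.diff.mono inter_subset_left)
    rw [leftIntegral_eq hL hT hJ hcyc' hΩ hH (hfαβ J hJ), two_pi_inv_smul_cxRe, scalarOp_eq hL,
      tendsto_nhds_unique (tendsto_act_pt L hc' hJ) (tendsto_act_pt L hc hJ),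
      hcyc'.cInt_eq hcyc hΩ (isOpen_cxResolventSet hT) hΦ, ← cxRe_cxMap A, hA, map_add, cxRe_cxMap]

/-- The analogue of `isLeftCalc_of` for the right calculus. -/
lemma isRightCalc_of (hL : ∀ a v, L a v = a • v) (hT : HasBoundedComp T) {D : Set P}
    (hD : S.IsSpectralNhd T D) {f : P → F} (hf : DifferentiableOn ℝ f D) {α β : ℝ → ℝ → F}
    (hαβ : S.IsHolPair D α β) (hfαβ : ∀ J ∈ S.units, ∀ z : ℂ, S.pt J z ∈ D →
      f (S.pt J z) = α z.re z.im + β z.re z.im * S.emb J)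
    {c : F} (hc : Tendsto f (Bornology.cobounded P) (𝓝 c)) {I' : P} (hI : I' ∈ S.units)
    {W : Set ℂ} {m : ℕ} {Γ : Fin m → ℝ → ℂ} (hW : IsCauchyDomain W) (hΓ : IsOrientedBoundary W Γ)
    (hcyc : IsCalcCycle (cxResolventSet T) (S.slice I' D) W Γ) {A : V →L[ℝ] V}
    (hA : cxMap A = cxMap (L c) +
      (2 * Real.pi * I : ℂ)⁻¹ • cInt Γ fun z => cxRep L α β z * cxResolvent T z) :
    S.IsRightCalc T D f A where
  mem := ⟨hD, ⟨hf, α, β, hαβ, hfαβ⟩, c, hc⟩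
  exists_domain := by
    refine ⟨_, isCalcDomain_preimage_toC hD hI hW hcyc, fun J hJ => ⟨m, Γ, ?_⟩⟩
    rwa [slice_preimage_toC hcyc.conj hJ]
  eq_integral := by
    intro c' hc' U hU J hJ k Γ' hΓ'
    have hΩ : IsOpen (S.slice J D) := hD.isOpen.preimage (S.continuous_pt J)
    have hcyc' := isCalcCycle_of_isCalcDomain hU hJ hΓ'
    have hH := isCxHol_of_right L hD hf hαβ hJ (hfαβ J hJ) hc
    rw [S.slice_eq hD.axial hI hJ] at hcyc
    have hΦ : DifferentiableOn ℂ (fun z => cxRep L α β z * cxResolvent T z)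
        (S.slice J D ∩ cxResolventSet T) :=
      (hH.diff.mono inter_subset_left).mul
        ((differentiableOn_cxResolvent hT).mono inter_subset_right)
    rw [rightIntegral_eq hL hT hJ hcyc' hΩ hH (hfαβ J hJ), two_pi_inv_smul_cxRe, scalarOp_eq hL,
      tendsto_nhds_unique (tendsto_act_pt L hc' hJ) (tendsto_act_pt L hc hJ),
      hcyc'.cInt_eq hcyc hΩ (isOpen_cxResolventSet hT) hΦ, ← cxRe_cxMap A, hA, map_add, cxRe_cxMap]

omit [Nontrivial F] [TopologicalSpace F] [IsTopologicalAddGroup F] [ContinuousSMul ℝ F] [T2Space F]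
  [FiniteDimensional ℝ F] [CompleteSpace V] [Module ℝ K] [IsScalarTower ℝ K V] [Module F V] in
/-- Two functions with holomorphic representations have nested cycles for which the two integrals
over them multiply by the product rule for pseudo-resolvents. -/
lemma exists_nested_cycles [Nontrivial F] [CompleteSpace V] [Module ℝ K] [IsScalarTower ℝ K V]
    (hT : HasBoundedComp T) (hρ : (S.resolventSet T).Nonempty) {Df Dg : Set P}
    (hDf : S.IsSpectralNhd T Df) (hDg : S.IsSpectralNhd T Dg) {I' : P} (hI : I' ∈ S.units)
    {Hf Hg : ℂ → CxEnd V} {a b : V →L[ℝ] V} (hHf : IsCxHol (S.slice I' Df) Hf a)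
    (hHg : IsCxHol (S.slice I' Dg) Hg b) :
    ∃ (W₁ W₂ : Set ℂ) (m₁ m₂ : ℕ) (Γ₁ : Fin m₁ → ℝ → ℂ) (Γ₂ : Fin m₂ → ℝ → ℂ) (A B : V →L[ℝ] V),
      IsCauchyDomain W₁ ∧ IsOrientedBoundary W₁ Γ₁ ∧
      IsCalcCycle (cxResolventSet T) (S.slice I' (Df ∩ Dg)) W₁ Γ₁ ∧
      IsCauchyDomain W₂ ∧ IsOrientedBoundary W₂ Γ₂ ∧
      IsCalcCycle (cxResolventSet T) (S.slice I' (Df ∩ Dg)) W₂ Γ₂ ∧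
      cxMap A = cxMap a + (2 * Real.pi * I : ℂ)⁻¹ • cInt Γ₁ (fun z => Hf z * cxResolvent T z) ∧
      cxMap B = cxMap b + (2 * Real.pi * I : ℂ)⁻¹ • cInt Γ₂ (fun z => cxResolvent T z * Hg z) ∧
      cxMap (A ∘L B) = cxMap (a * b) +
        (2 * Real.pi * I : ℂ)⁻¹ • cInt Γ₁ (fun z => Hf z * cxResolvent T z * Hg z) := by
  have hD := hDf.inter hDg
  have hρo := isOpen_cxResolventSet hT
  have hR := differentiableOn_cxResolvent hT
  have hΩ : IsOpen (S.slice I' (Df ∩ Dg)) := hD.isOpen.preimage (S.continuous_pt I')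
  have hρne : (cxResolventSet T).Nonempty := by
    obtain ⟨s, hs⟩ := hρ
    obtain ⟨J, hJ, hsJ⟩ := S.exists_pt_toC ⟨I', hI⟩ s
    exact ⟨S.toC s, (S.pt_mem_resolventSet T hJ _).1 (by rwa [hsJ])⟩
  have hρc : ∀ z ∈ cxResolventSet T, (starRingEnd ℂ) z ∈ cxResolventSet T := fun z hz =>
    conj_mem_cxResolventSet.2 hz
  obtain ⟨W₂, m₂, Γ₂, hW₂, hΓ₂, hcyc₂⟩ := exists_isCalcCycle hρo hρne hρc hΩ
    (fun z hz => S.conj_mem_slice hD.axial hI hz) (isBounded_compl_slice hD hI)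
    (compl_cxResolventSet_subset hD.spectrum_subset hI)
  -- the second domain is the neighborhood for the first, so that `closure W₁ ⊆ W₂`
  obtain ⟨W₁, m₁, Γ₁, hW₁, hΓ₁, hcyc₁⟩ := exists_isCalcCycle hρo hρne hρc hcyc₂.isOpen hcyc₂.conj
    hcyc₂.bounded hcyc₂.compl_subset
  have hcyc₁' := hcyc₁.mono (subset_closure.trans hcyc₂.closure_subset)
  have hHf' := hHf.diff.mono (fun z (hz : z ∈ S.slice I' (Df ∩ Dg)) => hz.1)
  have hHg' := hHg.diff.mono (fun z (hz : z ∈ S.slice I' (Df ∩ Dg)) => hz.2)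
  have hA := cxMap_cxRe_calc hcyc₁' hΩ hρo (Φ := fun z => Hf z * cxResolvent T z)
    ((hHf'.mono inter_subset_left).mul (hR.mono inter_subset_right)) (fun z hz => by
      rw [hHf.conj z hz.1.1, cxResolvent_conj, cxConj_mul]) a
  have hB := cxMap_cxRe_calc hcyc₂ hΩ hρo (Φ := fun z => cxResolvent T z * Hg z)
    ((hR.mono inter_subset_right).mul (hHg'.mono inter_subset_left)) (fun z hz => by
      rw [hHg.conj z hz.1.2, cxResolvent_conj, cxConj_mul]) b
  refine ⟨W₁, W₂, m₁, m₂, Γ₁, Γ₂, _, _, hW₁, hΓ₁, hcyc₁', hW₂, hΓ₂, hcyc₂, hA, hB, ?_⟩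
  rw [cxMap_comp, hA, hB, cxMap_mul]
  exact pseudoResolvent_product hR.continuousOn (fun z hz w hw => cxResolvent_sub hT hz hw)
    hcyc₁.toIsCycleAround hcyc₂.toIsCycleAround hcyc₁.isOpen hcyc₂.isOpen hcyc₁.bounded
    hcyc₂.bounded hcyc₁.compl_subset hcyc₁.closure_subset hΩ hcyc₂.closure_subset hHf' hHg' hHf.lim
    hHg.lim

/-- The product rule for an intrinsic `f` and a left slice hyperholomorphic `g`, for every operator
whose compositions with bounded operators are bounded. -/
theorem left_product (hL : ∀ a v, L a v = a • v) (hT : HasBoundedComp T) (hS : S.units.Nonempty)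
    (hρ : (S.resolventSet T).Nonempty) {Df Dg : Set P} {f g : P → F}
    (hf : S.MemIntrinsic T Df f) (hg : S.MemLeftSH T Dg g) :
    ∃ A B : V →L[ℝ] V, S.IsLeftCalc T Df f A ∧ S.IsRightCalc T Df f A ∧ S.IsLeftCalc T Dg g B ∧
      S.IsLeftCalc T (Df ∩ Dg) (fun s => f s * g s) (A ∘L B) := by
  obtain ⟨hDf, ⟨hfd, α, β, hαβ, hfl, hreal⟩, c, hc⟩ := hf
  obtain ⟨hDg, ⟨hgd, α', β', hαβ', hgl⟩, c', hc'⟩ := hg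
  obtain ⟨I', hI⟩ := hS
  have hcomm : ∀ J ∈ S.units, ∀ z : ℂ, S.pt J z ∈ Df → ∀ x : F,
      α z.re z.im * x = x * α z.re z.im ∧ β z.re z.im * x = x * β z.re z.im := by
    intro J hJ z hz x
    obtain ⟨⟨a, ha⟩, b, hb⟩ := hreal J hJ z hz
    rw [← ha, ← hb]
    exact ⟨Algebra.commutes a x, Algebra.commutes b x⟩
  have hfr : ∀ J ∈ S.units, ∀ z : ℂ, S.pt J z ∈ Df →
      f (S.pt J z) = α z.re z.im + β z.re z.im * S.emb J := fun J hJ z hz => by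
    rw [hfl J hJ z hz, (hcomm J hJ z hz _).2]
  have hHf := isCxHol_of_left L hDf hfd hαβ hI (hfl I' hI) hc
  have hHg := isCxHol_of_left L hDg hgd hαβ' hI (hgl I' hI) hc'
  obtain ⟨W₁, W₂, m₁, m₂, Γ₁, Γ₂, A, B, hW₁, hΓ₁, hcyc₁, hW₂, hΓ₂, hcyc₂, hA, hB, hAB⟩ :=
    exists_nested_cycles hT hρ hDf hDg hI hHf hHg
  have hswap : ∀ z ∈ frontier W₁, ∀ X, cxRep L α β z * X = X * cxRep L α β z := fun z hz =>
    have h := hreal I' hI z (hcyc₁.frontier_subset hz).1.1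
    cxRep_comm L h.1 h.2
  have hf₁ : S.slice I' (Df ∩ Dg) ⊆ S.slice I' Df := fun z hz => hz.1
  have hg₁ : S.slice I' (Df ∩ Dg) ⊆ S.slice I' Dg := fun z hz => hz.2
  have hA' := hA
  rw [hcyc₁.cInt_congr (Ψ := fun z => cxResolvent T z * cxRep L α β z) fun z hz => hswap z hz _]
    at hA'
  rw [hcyc₁.cInt_congr (Ψ := fun z => cxResolvent T z *
      cxRep L (fun x y => α x y * α' x y - β x y * β' x y)
        (fun x y => α x y * β' x y + β x y * α' x y) z) fun z hz => by
        rw [cxRep_mul, hswap z hz, mul_assoc], ← map_mul] at hAB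
  refine ⟨A, B, isLeftCalc_of hL hT hDf hfd hαβ hfl hc hI hW₁ hΓ₁ (hcyc₁.mono hf₁) hA',
    isRightCalc_of hL hT hDf hfd hαβ hfr hc hI hW₁ hΓ₁ (hcyc₁.mono hf₁) hA,
    isLeftCalc_of hL hT hDg hgd hαβ' hgl hc' hI hW₂ hΓ₂ (hcyc₂.mono hg₁) hB,
    isLeftCalc_of hL hT (hDf.inter hDg) (differentiableOn_mul (hfd.mono inter_subset_left)
      (hgd.mono inter_subset_right)) (hαβ.mul hαβ') (fun J hJ z hz => ?_) (tendsto_fun_mul hc hc')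
      hI hW₁ hΓ₁ hcyc₁ hAB⟩
  have h1 := hcomm J hJ z hz.1 (S.emb J)
  have h2 := S.emb_mul_self_of_mem_units hJ
  rw [hfl J hJ z hz.1, hgl J hJ z hz.2, ← h1.2]
  have e1 : α z.re z.im * (S.emb J * β' z.re z.im) = S.emb J * (α z.re z.im * β' z.re z.im) := by
    rw [← mul_assoc, h1.1, mul_assoc]
  have e2 : β z.re z.im * S.emb J * α' z.re z.im = S.emb J * (β z.re z.im * α' z.re z.im) := by
    rw [h1.2, mul_assoc]
  have e3 : β z.re z.im * S.emb J * (S.emb J * β' z.re z.im) = -(β z.re z.im * β' z.re z.im) := by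
    rw [mul_assoc, ← mul_assoc (S.emb J), h2, neg_one_mul, mul_neg]
  rw [add_mul, mul_add, mul_add, e1, e2, e3, mul_add]
  abel

/-- The product rule for a right slice hyperholomorphic `f` and an intrinsic `g`. -/
theorem right_product (hL : ∀ a v, L a v = a • v) (hT : HasBoundedComp T) (hS : S.units.Nonempty)
    (hρ : (S.resolventSet T).Nonempty) {Df Dg : Set P} {f g : P → F}
    (hf : S.MemRightSH T Df f) (hg : S.MemIntrinsic T Dg g) :
    ∃ A B : V →L[ℝ] V, S.IsRightCalc T Df f A ∧ S.IsLeftCalc T Dg g B ∧ S.IsRightCalc T Dg g B ∧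
      S.IsRightCalc T (Df ∩ Dg) (fun s => f s * g s) (A ∘L B) := by
  obtain ⟨hDf, ⟨hfd, α, β, hαβ, hfr⟩, c, hc⟩ := hf
  obtain ⟨hDg, ⟨hgd, α', β', hαβ', hgl, hreal⟩, c', hc'⟩ := hg
  obtain ⟨I', hI⟩ := hS
  have hcomm : ∀ J ∈ S.units, ∀ z : ℂ, S.pt J z ∈ Dg → ∀ x : F,
      α' z.re z.im * x = x * α' z.re z.im ∧ β' z.re z.im * x = x * β' z.re z.im := by
    intro J hJ z hz x
    obtain ⟨⟨a, ha⟩, b, hb⟩ := hreal J hJ z hz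
    rw [← ha, ← hb]
    exact ⟨Algebra.commutes a x, Algebra.commutes b x⟩
  have hgr : ∀ J ∈ S.units, ∀ z : ℂ, S.pt J z ∈ Dg →
      g (S.pt J z) = α' z.re z.im + β' z.re z.im * S.emb J := fun J hJ z hz => by
    rw [hgl J hJ z hz, (hcomm J hJ z hz _).2]
  have hHf := isCxHol_of_right L hDf hfd hαβ hI (hfr I' hI) hc
  have hHg := isCxHol_of_left L hDg hgd hαβ' hI (hgl I' hI) hc'
  obtain ⟨W₁, W₂, m₁, m₂, Γ₁, Γ₂, A, B, hW₁, hΓ₁, hcyc₁, hW₂, hΓ₂, hcyc₂, hA, hB, hAB⟩ :=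
    exists_nested_cycles hT hρ hDf hDg hI hHf hHg
  have hswap : ∀ z ∈ S.slice I' Dg, ∀ X, cxRep L α' β' z * X = X * cxRep L α' β' z := fun z hz =>
    have h := hreal I' hI z hz
    cxRep_comm L h.1 h.2
  have hf₁ : S.slice I' (Df ∩ Dg) ⊆ S.slice I' Df := fun z hz => hz.1
  have hg₁ : S.slice I' (Df ∩ Dg) ⊆ S.slice I' Dg := fun z hz => hz.2
  have hB' := hB
  rw [hcyc₂.cInt_congr (Ψ := fun z => cxRep L α' β' z * cxResolvent T z) fun z hz =>
    (hswap z (hcyc₂.frontier_subset hz).1.2 _).symm] at hB'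
  rw [hcyc₁.cInt_congr (Ψ := fun z =>
      cxRep L (fun x y => α x y * α' x y - β x y * β' x y)
        (fun x y => α x y * β' x y + β x y * α' x y) z * cxResolvent T z) fun z hz => by
        rw [cxRep_mul, mul_assoc, mul_assoc, hswap z (hcyc₁.frontier_subset hz).1.2],
    ← map_mul] at hAB
  refine ⟨A, B, isRightCalc_of hL hT hDf hfd hαβ hfr hc hI hW₁ hΓ₁ (hcyc₁.mono hf₁) hA,
    isLeftCalc_of hL hT hDg hgd hαβ' hgl hc' hI hW₂ hΓ₂ (hcyc₂.mono hg₁) hB,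
    isRightCalc_of hL hT hDg hgd hαβ' hgr hc' hI hW₂ hΓ₂ (hcyc₂.mono hg₁) hB',
    isRightCalc_of hL hT (hDf.inter hDg) (differentiableOn_mul (hfd.mono inter_subset_left)
      (hgd.mono inter_subset_right)) (hαβ.mul hαβ') (fun J hJ z hz => ?_) (tendsto_fun_mul hc hc')
      hI hW₁ hΓ₁ hcyc₁ hAB⟩
  have h1 := hcomm J hJ z hz.2 (S.emb J)
  have h2 := S.emb_mul_self_of_mem_units hJ
  rw [hfr J hJ z hz.1, hgr J hJ z hz.2]
  have e1 : β z.re z.im * S.emb J * α' z.re z.im = β z.re z.im * α' z.re z.im * S.emb J := by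
    rw [mul_assoc, ← h1.1, mul_assoc]
  have e2 : β z.re z.im * S.emb J * (β' z.re z.im * S.emb J) = -(β z.re z.im * β' z.re z.im) := by
    rw [h1.2, mul_assoc, ← mul_assoc (S.emb J), h2, neg_one_mul, mul_neg]
  rw [add_mul, mul_add, mul_add, e1, e2, add_mul, mul_assoc (α _ _)]
  abel

end Calc

end SliceSetting

/-! ### The quaternionic and the Clifford setting -/

/-- The closed graph theorem for a closed operator composed with a bounded one. -/
lemma exists_clm_opApply {X V : Type*} [NormedAddCommGroup X] [NormedSpace ℝ X] [CompleteSpace X]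
    [NormedAddCommGroup V] [NormedSpace ℝ V] [CompleteSpace V] {K : Type*} [Ring K] [Module K V]
    [Module ℝ K] [IsScalarTower ℝ K V] {T : V →ₗ.[K] V} (hT : IsClosed (T.graph : Set (V × V)))
    (B : X →L[ℝ] V) (hB : ∀ x, B x ∈ T.domain) :
    ∃ C : X →L[ℝ] V, ∀ x, C x = opApply T (B x) := by
  let g : X →ₗ[ℝ] V :=
    { toFun := fun x => opApply T (B x)
      map_add' := fun x y => by rw [map_add, opApply_add (hB x) (hB y)]
      map_smul' := fun r x => by rw [map_smul, opApply_smul (hB x), RingHom.id_apply] }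
  have hmem : ∀ x, (B x, g x) ∈ T.graph := fun x => by
    rw [LinearPMap.mem_graph_iff]
    exact ⟨⟨B x, hB x⟩, rfl, (opApply_of_mem (hB x)).symm⟩
  refine ⟨ContinuousLinearMap.ofSeqClosedGraph (g := g) fun u x y hu hy => ?_, fun x => rfl⟩
  have h1 : Tendsto (fun k => (B (u k), g (u k))) atTop (𝓝 (B x, y)) :=
    ((B.continuous.tendsto x).comp hu).prodMk_nhds hy
  have h2 : (B x, y) ∈ T.graph := hT.mem_of_tendsto h1 (Eventually.of_forall fun k => hmem (u k))
  rw [LinearPMap.mem_graph_iff] at h2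
  obtain ⟨v, hv, hv'⟩ := h2
  change y = opApply T (B x)
  rw [opApply_of_mem (hB x), show T ⟨B x, hB x⟩ = T v from congrArg T (Subtype.ext hv.symm)]
  exact hv'.symm

section Quaternions

open Quaternion

lemma quatSetting_units_nonempty : quatSetting.units.Nonempty := by
  refine ⟨⟨0, 1, 0, 0⟩, rfl, ?_⟩
  set i : ℍ[ℝ] := ⟨0, 1, 0, 0⟩ with hi
  have h : ‖i‖ * ‖i‖ = 1 := by
    rw [← Quaternion.normSq_eq_norm_mul_self, Quaternion.normSq_def', hi]
    norm_num
  nlinarith [norm_nonneg i]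

variable {V : Type*} [NormedAddCommGroup V] [NormedSpace ℝ V] [Module ℍ[ℝ] V]
  [IsScalarTower ℝ ℍ[ℝ] V]

/-- Left multiplication by quaternions as a representation by bounded operators. -/
def quatLeftMul (h : ∀ (a : ℍ[ℝ]) (v : V), ‖a • v‖ = ‖a‖ * ‖v‖) : ℍ[ℝ] →ₐ[ℝ] (V →L[ℝ] V) where
  toFun a := LinearMap.mkContinuous
    { toFun := fun v => a • v
      map_add' := smul_add a
      map_smul' := fun r v => by
        rw [RingHom.id_apply, ← smul_one_smul ℍ[ℝ] r v, ← smul_one_smul ℍ[ℝ] r (a • v), smul_smul,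
          smul_smul, mul_smul_comm, smul_mul_assoc, mul_one, one_mul] } ‖a‖ fun v => (h a v).le
  map_one' := by ext v; exact one_smul _ v
  map_mul' a b := by ext v; exact mul_smul a b v
  map_zero' := by ext v; exact zero_smul _ v
  map_add' a b := by ext v; exact add_smul a b v
  commutes' r := by
    ext v
    rw [Algebra.algebraMap_eq_smul_one, Algebra.algebraMap_eq_smul_one]
    exact smul_one_smul ℍ[ℝ] r v

end Quaternions

section Clifford

variable {n : ℕ} {W : Type*} [NormedAddCommGroup W] [NormedSpace ℝ W]

lemma cliffSetting_units_nonempty (hn : 1 ≤ n) : (cliffSetting n).units.Nonempty := by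
  refine ⟨EuclideanSpace.single (Fin.last n) 1, ?_, by simp⟩
  change (EuclideanSpace.single (Fin.last n) (1 : ℝ)) 0 = 0
  have h : (0 : Fin (n + 1)) ≠ Fin.last n := fun h => by
    have := congrArg Fin.val h
    simp at this
    omega
  simp [h]

instance : FiniteDimensional ℝ (Cliff n) := Module.Finite.of_basis (Cliff.basis n)

instance : IsScalarTower ℝ (Cliff n) (CliffMod n W) where
  smul_assoc r a v := by
    apply CliffMod.coeff.injective
    funext B
    simp [CliffMod.coeff_smul, Finset.smul_sum, mul_smul]

/-- The components of the elements of `W ⊗ ℝₙ`, as a homeomorphism. -/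
def CliffMod.coeffL : CliffMod n W ≃L[ℝ] (Finset (Fin n) → W) :=
  PiLp.continuousLinearEquiv 1 ℝ fun _ : Finset (Fin n) => W

/-- Left multiplication by elements of `ℝₙ` as a representation by bounded operators. -/
def cliffLeftMul (n : ℕ) (W : Type*) [NormedAddCommGroup W] [NormedSpace ℝ W] :
    Cliff n →ₐ[ℝ] (CliffMod n W →L[ℝ] CliffMod n W) where
  toFun a :=
    { toFun := fun v => a • v
      map_add' := smul_add a
      map_smul' := fun r v => (smul_comm r a v).symm
      cont := by
        have h : Continuous fun (w : Finset (Fin n) → W) (B : Finset (Fin n)) =>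
            ∑ A, (Cliff.basis n).repr (a * Cliff.basis n A) B • w A := by fun_prop
        exact (CliffMod.coeffL (n := n) (W := W)).symm.continuous.comp
          (h.comp (CliffMod.coeffL (n := n) (W := W)).continuous) }
  map_one' := by ext v; exact one_smul (Cliff n) v
  map_mul' a b := by ext v; exact mul_smul a b v
  map_zero' := by ext v; exact zero_smul (Cliff n) v
  map_add' a b := by ext v; exact add_smul a b v
  commutes' r := by
    ext v
    rw [Algebra.algebraMap_eq_smul_one, Algebra.algebraMap_eq_smul_one]
    exact smul_one_smul (Cliff n) r v

/-- Although a paravector operator need not be closed, its compositions with bounded operators are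
bounded, since this holds for the closed components `Tᵢ`. -/
lemma hasBoundedComp_paravectorOp [CompleteSpace W] {T : Fin (n + 1) → (W →ₗ.[ℝ] W)}
    (hT : ∀ i, (T i).IsClosed) : HasBoundedComp (paravectorOp T) := by
  intro B hB
  have h : ∀ (i : Fin (n + 1)) (A : Finset (Fin n)), ∃ C : CliffMod n W →L[ℝ] W,
      ∀ v, C v = opApply (T i) (CliffMod.coeff (B v) A) := fun i A =>
    exists_clm_opApply (hT i)
      ((ContinuousLinearMap.proj (R := ℝ) (φ := fun _ : Finset (Fin n) => W) A ∘L
        (CliffMod.coeffL (n := n) (W := W)).toContinuousLinearMap) ∘L B)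
      fun v => hB v A i
  choose C hC using h
  refine ⟨∑ i, cliffLeftMul n W (Cliff.unit i) ∘L
    ((CliffMod.coeffL (n := n) (W := W)).symm.toContinuousLinearMap ∘L
      ContinuousLinearMap.pi (C i)), fun v => ?_⟩
  rw [opApply_of_mem (hB v), sum_apply]
  change _ = ∑ i, Cliff.unit i •
    CliffMod.coeff.symm fun A => T i ⟨CliffMod.coeff (B v) A, hB v A i⟩
  refine Finset.sum_congr rfl fun i _ => ?_
  change Cliff.unit i • CliffMod.coeff.symm (fun A => C i A v) = _
  congr 2
  funext A
  rw [hC, opApply_of_mem (hB v A i)]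

end Clifford

end SliceCalc

end

open SliceCalc Quaternion in
theorem mainTheorem2 :
    -- quaternionic setting
    (∀ (V : Type*) [NormedAddCommGroup V] [NormedSpace ℝ V] [CompleteSpace V]
      [Module ℍ[ℝ] V] [Module ℍ[ℝ]ᵐᵒᵖ V] [SMulCommClass ℍ[ℝ] ℍ[ℝ]ᵐᵒᵖ V]
      [IsScalarTower ℝ ℍ[ℝ] V] [IsScalarTower ℝ ℍ[ℝ]ᵐᵒᵖ V]
      (_ : ∀ (a : ℍ[ℝ]) (v : V), ‖a • v‖ = ‖a‖ * ‖v‖)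
      (_ : ∀ (a : ℍ[ℝ]) (v : V), ‖MulOpposite.op a • v‖ = ‖v‖ * ‖a‖)
      (T : V →ₗ.[ℍ[ℝ]ᵐᵒᵖ] V) (_ : IsClosed (T.graph : Set (V × V)))
      (_ : (quatSetting.resolventSet T).Nonempty)
      (Df Dg : Set ℍ[ℝ]) (f g : ℍ[ℝ] → ℍ[ℝ]),
      (quatSetting.MemIntrinsic T Df f → quatSetting.MemLeftSH T Dg g →
        ∃ A B : V →L[ℝ] V,
          quatSetting.IsLeftCalc T Df f A ∧ quatSetting.IsRightCalc T Df f A ∧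
          quatSetting.IsLeftCalc T Dg g B ∧
          quatSetting.IsLeftCalc T (Df ∩ Dg) (fun s => f s * g s) (A ∘L B)) ∧
      (quatSetting.MemRightSH T Df f → quatSetting.MemIntrinsic T Dg g →
        ∃ A B : V →L[ℝ] V,
          quatSetting.IsRightCalc T Df f A ∧
          quatSetting.IsLeftCalc T Dg g B ∧ quatSetting.IsRightCalc T Dg g B ∧
          quatSetting.IsRightCalc T (Df ∩ Dg) (fun s => f s * g s) (A ∘L B))) ∧
    -- Clifford setting
    (∀ (n : ℕ) (_ : 1 ≤ n) (W : Type*) [NormedAddCommGroup W] [NormedSpace ℝ W] [CompleteSpace W]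
      (T : Fin (n + 1) → (W →ₗ.[ℝ] W)) (_ : ∀ i, (T i).IsClosed)
      (_ : ((cliffSetting n).resolventSet (paravectorOp T)).Nonempty)
      (Df Dg : Set (Paravector n)) (f g : Paravector n → Cliff n),
      ((cliffSetting n).MemIntrinsic (paravectorOp T) Df f →
        (cliffSetting n).MemLeftSH (paravectorOp T) Dg g →
        ∃ A B : CliffMod n W →L[ℝ] CliffMod n W,
          (cliffSetting n).IsLeftCalc (paravectorOp T) Df f A ∧
          (cliffSetting n).IsRightCalc (paravectorOp T) Df f A ∧
          (cliffSetting n).IsLeftCalc (paravectorOp T) Dg g B ∧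
          (cliffSetting n).IsLeftCalc (paravectorOp T) (Df ∩ Dg) (fun s => f s * g s) (A ∘L B)) ∧
      ((cliffSetting n).MemRightSH (paravectorOp T) Df f →
        (cliffSetting n).MemIntrinsic (paravectorOp T) Dg g →
        ∃ A B : CliffMod n W →L[ℝ] CliffMod n W,
          (cliffSetting n).IsRightCalc (paravectorOp T) Df f A ∧
          (cliffSetting n).IsLeftCalc (paravectorOp T) Dg g B ∧
          (cliffSetting n).IsRightCalc (paravectorOp T) Dg g B ∧
          (cliffSetting n).IsRightCalc (paravectorOp T) (Df ∩ Dg) (fun s => f s * g s)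
            (A ∘L B))) := by

  refine ⟨?_, ?_⟩
  · intro V _ _ _ _ _ _ _ _ hl _ T hT hρ Df Dg f g
    have hL : ∀ a v, quatLeftMul hl a v = a • v := fun _ _ => rfl
    have hB : HasBoundedComp T := fun B hB => exists_clm_opApply hT B hB
    exact ⟨SliceSetting.left_product hL hB quatSetting_units_nonempty hρ,
      SliceSetting.right_product hL hB quatSetting_units_nonempty hρ⟩
  · intro n hn W _ _ _ T hT hρ Df Dg f g
    have hL : ∀ a v, cliffLeftMul n W a v = a • v := fun _ _ => rfl
    exact ⟨SliceSetting.left_product hL (hasBoundedComp_paravectorOp hT)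
        (cliffSetting_units_nonempty hn) hρ,
      SliceSetting.right_product hL (hasBoundedComp_paravectorOp hT)
        (cliffSetting_units_nonempty hn) hρ⟩
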